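/- **Setting.** Let $G$ be a finite connected plane graph with at least one edge and with non-negative edge lengths. Its external face is bounded by a closed walk; each visit of this walk to a vertex is a *corner* of the external face. Let $P$ be a finite set of *non-crossing shortest paths* (NCS), i.e. of simple paths of $G$, each with two distinct extremal vertices on the external face, such that * each path is a shortest path of $G$; * $P$ is *single-touch*: the intersection of any two of the paths is a (possibly empty) path; * no two of the paths cross: there is no common subpath which both paths continue beyond both of its ends, separating there, such that one path arrives on one side of the other and leaves on the other side; * the terminal pairs are *well-formed*: the extremal vertices of each path can be placed at corners of the external face so that, after cutting the boundary walk at one of its edges $e_1$, the arcs $\gamma_p$ of the walk between the two corners of $p$ that avoid $e_1$ are non-trivial, pairwise distinct, and any two of them are nested or share no edge. A *forest labeling* of $P$ is a map $\mathcal L$ from $P$ to a set of labels such that, for every label $c$, the union of the paths $p$ with $\mathcal L(p)=c$ is a forest. $\mathrm{PCFN}(P)$ is the minimum size of a set of forests such that each path of $P$ is contained in one of them. **Algorithm FourForests.** *Step 1.* Choose $e_1$ and the corners, and complete $P$ by finitely many auxiliary paths of $G$ (single vertices placed at two different corners are allowed, and they need not be shortest) to a family $P'$ that is still single-touch, non-crossing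 and well-formed with distinct arcs, such that, ordering $P'$ by $p\preceq q\iff\gamma_p\subseteq\gamma_q$, there is a greatest element $p_1$ and every path has no children or exactly two children, whose arcs share no edge. (The children of $q$ are the maximal elements strictly below $q$.) For a path $q$ with children, let $q_r$ be the child that comes first along the walk from $e_1$ and $q_\ell$ the other one. If $q\cup q_r\cup q_\ell$ contains a cycle, this cycle is unique and bounds the face $f$ *with upper path $q$*; its lower boundary is the part not on $q$, and $e^f_r\in q_r$, $e^f_\ell\in q_\ell$ are the extremal edges of the lower boundary (those with an endpoint on $q$). A path *interferes* with $f$ if it contains $e^f_r$ or $e^f_\ell$. For $p\in P'$ let $\mathrm{Touch}_p$ be the set of $q\preceq p$ sharing a vertex with $p$, and $\mathrm{Max}_p$ the set of maximal elements of $\{q\preceq p\}\setminus \mathrm{Touch}_p$. Put $\mathrm{MAX}_0=\{p_1\}$, $\mathrm{MAX}_{i+1}=\bigcup_{p\in \mathrm{MAX}_i}\mathrm{Max}_p$. For $m$ in some $\mathrm{MAX}_i$, $m\ne p_1$, let $f_m$ be the face (if any) whose upper path is the parent of $m$, and $\mathrm{se}^m$ its edge among $e^{f_m}_r,e^{f_m}_\ell$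 that lies on $m$; $\mathrm{se}^{p_1}$ is the edge of $p_1$ at its first extremal vertex (none if $p_1$ has no edge). *Step 2.* Set $triple(p_1)=\{1,2,3\}$, $sc(p_1)=1$. For $i=0,1,\dots$ and each $p\in\mathrm{MAX}_i$ do (a) and (b). (a) Choose $c_r,c_\ell\in triple(p)\setminus\{sc(p)\}$, not necessarily distinct, and call $\mathrm{SC}(p,(c_r,c_\ell))$, where the procedures are as follows ("Touch children" are children in $\mathrm{Touch}_p$). * $\mathrm{SC}(q,(c_r,c_\ell))$: set $\mathcal L(q)=sc(p)$. If $q$ has one Touch child $q'$, call $\mathrm{SC}(q',(c_r,c_\ell))$. If it has two and $\mathrm{se}^p\in q_r$, call $\mathrm{SC}(q_r,(c_r,d))$ and $\mathrm{RC}(q_\ell,(c_\ell,sc(p),d))$, where $\{d\}=triple(p)\setminus\{c_\ell,sc(p)\}$; if it has two and $\mathrm{se}^p\notin q_r$ (or $\mathrm{se}^p$ does not exist), call $\mathrm{SC}(q_\ell,(d,c_\ell))$ and $\mathrm{LC}(q_r,(c_r,sc(p),d))$, where $\{d\}=triple(p)\setminus\{c_r,sc(p)\}$. * $\mathrm{RC}(q,(c_1,c_2,c_3))$: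 set $\mathcal L(q)=c_1$. If $q$ has one Touch child $q'$, call $\mathrm{RC}(q',(c_1,c_2,c_3))$; if two, call $\mathrm{RC}(q_r,(c_1,c_3,c_2))$ and $\mathrm{RC}(q_\ell,(c_2,c_1,c_3))$. * $\mathrm{LC}$ is $\mathrm{RC}$ with $q_r$ and $q_\ell$ exchanged. (b) For each pair of siblings $m,m'\in\mathrm{Max}_p$, set $triple(m)=triple(m')=triple(p)$ and let $sc(m)\ne sc(m')$ be two labels of $triple(p)$. Let $\mathrm{Max}^{III}_p$ be the set of $m\in\mathrm{Max}_p$ whose sibling is in $\mathrm{Touch}_p$, and write $m\dashrightarrow m'$ if $m\neq m'$ and $m$ interferes with $f_{m'}$. For each tree $T$ (connected component) of $(\mathrm{Max}^{III}_p,\dashrightarrow)$, let $\Delta$ be a set of two labels of $triple(p)$ that contains the labels of all paths of $\mathrm{Touch}_p$ interfering with $f_m$ for some $m\in T$; split $T$ into two classes $A,B$ without arrows inside a class, with the root in $A$. For $m\in A$ let $sc(m)$ be the label of $\{1,2,3,4\}$ not in $triple(p)$ and $triple(m)=\Delta\cup\{sc(m)\}$; for $m\in B$ let $sc(m)$ be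 the label in $triple(p)\setminus\Delta$ and $triple(m)=triple(p)$. Return the restriction of $\mathcal L$ to $P$. **Theorem.** For every NCS $P$, algorithm FourForests has an execution that runs to completion, and for all choices made in Steps 1 and 2 the labeling $\mathcal L:P\to\{1,2,3,4\}$ that it returns is a forest labeling of $P$; so it uses at most $4$ labels. Moreover $\mathrm{PCFN}(P)\le 4$. -/

import Mathlib

open SimpleGraph

/-! ### Plane graphs -/

/-- A finite connected plane graph (with at least one edge), given by its combinatorial embedding:
the rotation `rot` sends a dart to the next dart around its tail, the orbits of
`d ↦ rot d.symm` are the facial walks, Euler's formula says that the embedding is in the sphere,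
and `outer` is a dart of the facial walk of the external face. -/
structure PlaneGraph (V : Type*) [Finite V] where
  G : SimpleGraph V
  connected : G.Connected
  rot : Equiv.Perm G.Dart
  rot_fst : ∀ d, (rot d).fst = d.fst
  rot_cycle : ∀ d d' : G.Dart, d.fst = d'.fst → rot.SameCycle d d'
  euler : Nat.card V +
      Nat.card (Quotient (Equiv.Perm.SameCycle.setoid
        ((Dart.symm_involutive (G := G)).toPerm.trans rot))) =
      Nat.card G.edgeSet + 2
  outer : G.Dart

namespace PlaneGraph

variable {V : Type*} [Finite V] (M : PlaneGraph V)

/-- The successor of a dart on its facial walk. -/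
def face : Equiv.Perm M.G.Dart := (Dart.symm_involutive (G := M.G)).toPerm.trans M.rot

/-- The dart `d` belongs to the walk around the external face. The corners of the external face
are represented by these darts: `d` stands for the corner at `d.fst` just before `d`. -/
def IsOuterDart (d : M.G.Dart) : Prop := M.face.SameCycle M.outer d

/-- The vertex `v` lies on the external face. -/
def OnOuter (v : V) : Prop := ∃ d, M.IsOuterDart d ∧ d.fst = v

/-- The number of darts (equivalently, of corners) of the walk around the external face. -/
noncomputable def outerLength : ℕ := Nat.card {d : M.G.Dart // M.IsOuterDart d}

/-- For neighbours `o`, `d`, `r` of `v`: turning around `v` from `o` by `rot`, one meets `d`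
strictly after `o` and strictly before `r`. -/
def Between (v o d r : V) : Prop :=
  ∃ (h : M.G.Adj v o) (i : ℕ), 0 < i ∧ ((M.rot ^ i) ⟨(v, o), h⟩).snd = d ∧
    ∀ j ≤ i, ((M.rot ^ j) ⟨(v, o), h⟩).snd ≠ r

end PlaneGraph

/-! ### Paths -/

/-- A (simple) path of `G`, with its two extremal vertices. -/
structure GPath {V : Type*} (G : SimpleGraph V) where
  {x : V}
  {y : V}
  walk : G.Walk x y
  isPath : walk.IsPath

namespace GPath

variable {V : Type*} {G : SimpleGraph V}

def verts (p : GPath G) : Set V := {v | v ∈ p.walk.support}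

def edges (p : GPath G) : Set (Sym2 V) := {e | e ∈ p.walk.edges}

/-- `p` is a shortest path with respect to the edge lengths `len`. -/
def IsShortest (len : Sym2 V → ℝ) (p : GPath G) : Prop :=
  ∀ w : G.Walk p.x p.y, (p.walk.edges.map len).sum ≤ (w.edges.map len).sum

/-- The graph `p ∩ q` is a (possibly empty) path. -/
def SingleTouch (p q : GPath G) : Prop :=
  p.verts ∩ q.verts = ∅ ∨
    ∃ r : GPath G, r.verts = p.verts ∩ q.verts ∧ r.edges = p.edges ∩ q.edges

end GPath

namespace PlaneGraph

variable {V : Type*} [Finite V] (M : PlaneGraph V)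

/-- The paths `p` and `q` have a common subpath, namely
`p (i + 1), …, p (i + 1 + k) = q (j + 1), …, q (j + 1 + k)`, at both ends of which both paths go
on and separate, and `q` reaches it from one side of `p` and leaves it on the other side. -/
def CrossesAlong {a b c d : V} (p : M.G.Walk a b) (q : M.G.Walk c d) : Prop :=
  ∃ i j k : ℕ, i + 1 + k < p.length ∧ j + 1 + k < q.length ∧
    (∀ t ≤ k, p.getVert (i + 1 + t) = q.getVert (j + 1 + t)) ∧
    q.getVert j ≠ p.getVert i ∧ q.getVert j ≠ p.getVert (i + 2) ∧
    q.getVert (j + k + 2) ≠ p.getVert (i + k + 2) ∧ q.getVert (j + k + 2) ≠ p.getVert (i + k) ∧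
    ¬ (M.Between (p.getVert (i + 1)) (p.getVert (i + 2)) (q.getVert j) (p.getVert i) ↔
      M.Between (p.getVert (i + 1 + k)) (p.getVert (i + k + 2)) (q.getVert (j + k + 2))
        (p.getVert (i + k)))

/-- The paths `p` and `q` do not cross; a common subpath may be run through in the same direction
or in opposite directions. -/
def NonCrossing (p q : GPath M.G) : Prop :=
  ¬ M.CrossesAlong p.walk q.walk ∧ ¬ M.CrossesAlong p.walk q.walk.reverse

/-- Terminal positions for a family of paths. Starting at the corner `base`, the corners of the
external face are numbered `0, 1, …, outerLength - 1` along its boundary walk. The extremal vertices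
of `Q i` are placed at the corners `lo i < hi i`, and the arc `γ` of `Q i` consists of the
darts number `lo i, …, hi i - 1`; so no arc contains the last dart `e₁` of the walk.
The arcs are pairwise distinct and the terminal pairs are well-formed. -/
structure Layout {κ : Type*} (Q : κ → GPath M.G) where
  base : M.G.Dart
  base_outer : M.IsOuterDart base
  lo : κ → ℕ
  hi : κ → ℕ
  lo_lt_hi : ∀ i, lo i < hi i
  hi_lt : ∀ i, hi i < M.outerLength
  ends : ∀ i, s(((M.face ^ lo i) base).fst, ((M.face ^ hi i) base).fst) = s((Q i).x, (Q i).y)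
  arcs_distinct : ∀ i j, lo i = lo j → hi i = hi j → i = j
  wellFormed : ∀ i j, (lo j ≤ lo i ∧ hi i ≤ hi j) ∨ (lo i ≤ lo j ∧ hi j ≤ hi i) ∨
    hi i ≤ lo j ∨ hi j ≤ lo i

/-- `P` is a set of non-crossing shortest paths: pairwise single-touch, pairwise non-crossing
shortest paths, with their extremal vertices on the external face and well-formed terminal
pairs. -/
structure IsNCS (len : Sym2 V → ℝ) {ι : Type*} (P : ι → GPath M.G) : Prop where
  ends_ne : ∀ i, (P i).x ≠ (P i).y
  onOuter : ∀ i, M.OnOuter (P i).x ∧ M.OnOuter (P i).y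
  shortest : ∀ i, (P i).IsShortest len
  singleTouch : ∀ i j, (P i).SingleTouch (P j)
  nonCrossing : ∀ i j, i ≠ j → M.NonCrossing (P i) (P j)
  wellFormed : Nonempty (M.Layout P)

end PlaneGraph

/-! ### Forest labelings and the path covering with forests number -/

section Covering

variable {V : Type*} {G : SimpleGraph V} {ι : Type*}

/-- For every label, the union of the paths with that label is a forest. -/
def IsForestLabeling {k : ℕ} (P : ι → GPath G) (L : ι → Fin k) : Prop :=
  ∀ c : Fin k, (SimpleGraph.fromEdgeSet {e | ∃ i, L i = c ∧ e ∈ (P i).edges}).IsAcyclic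

/-- The minimum size of a set of forests (acyclic graphs on the vertex set) such that every path
of `P` is contained in one of them. -/
noncomputable def PCFN (P : ι → GPath G) : ℕ∞ :=
  ⨅ (F : Set (SimpleGraph V))
    (_ : (∀ H ∈ F, H.IsAcyclic) ∧ ∀ i, ∃ H ∈ F, (P i).edges ⊆ H.edgeSet), F.encard

end Covering

/-! ### Binary families, the genealogy tree, and the faces -/

/-- A binary family: pairwise single-touch, non-crossing paths of `M` with terminal positions
such that the genealogy tree (the order by inclusion of arcs) has a root `root` and every path has
no or exactly two children, i.e. maximal proper descendants, with disjoint arcs.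
The members need not be shortest paths. -/
structure BinaryFamily {V : Type*} [Finite V] (M : PlaneGraph V) (κ : Type*) where
  path : κ → GPath M.G
  layout : M.Layout path
  singleTouch : ∀ i j, (path i).SingleTouch (path j)
  nonCrossing : ∀ i j, i ≠ j → M.NonCrossing (path i) (path j)
  root : κ
  le_root : ∀ i, layout.lo root ≤ layout.lo i ∧ layout.hi i ≤ layout.hi root
  binary : ∀ q,
    (∀ i, layout.lo q ≤ layout.lo i → layout.hi i ≤ layout.hi q → i = q) ∨
    ∃ r l, layout.hi r ≤ layout.lo l ∧ ∀ c,
      ((c ≠ q ∧ layout.lo q ≤ layout.lo c ∧ layout.hi c ≤ layout.hi q ∧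
        ∀ i, layout.lo q ≤ layout.lo i → layout.hi i ≤ layout.hi q →
          layout.lo i ≤ layout.lo c → layout.hi c ≤ layout.hi i → i = c ∨ i = q) ↔
        c = r ∨ c = l)

namespace BinaryFamily

variable {V : Type*} [Finite V] {M : PlaneGraph V} {κ : Type*} (B : BinaryFamily M κ)

/-- `i ≼ j`: the arc of `i` is contained in the arc of `j`. -/
def Le (i j : κ) : Prop := B.layout.lo j ≤ B.layout.lo i ∧ B.layout.hi i ≤ B.layout.hi j

/-- `c` is a child of `q` in the genealogy tree. -/
def IsChild (c q : κ) : Prop :=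
  c ≠ q ∧ B.Le c q ∧ ∀ i, B.Le i q → B.Le c i → i = c ∨ i = q

/-- `r` and `l` are the right and the left child of `q`. -/
def Children (q r l : κ) : Prop :=
  B.layout.hi r ≤ B.layout.lo l ∧ ∀ c, B.IsChild c q ↔ c = r ∨ c = l

/-- `C` is the set of edges of the boundary of the face formed by `q` and its two children, the face
with upper path `q`. (Three paths that pairwise meet in paths contain at most one cycle; when
they contain none, there is no face with upper path `q`.) -/
def IsFaceBoundary (q : κ) (C : Set (Sym2 V)) : Prop :=
  ∃ r l, B.Children q r l ∧ C ⊆ (B.path q).edges ∪ (B.path r).edges ∪ (B.path l).edges ∧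
    ∃ (v : V) (c : M.G.Walk v v), c.IsCycle ∧ C = {e | e ∈ c.edges}

/-- `e` is the extremal edge, on the child `c` of `q`, of the lower boundary of the face `f` with
upper path `q`. (If `c` is the right child, `e = e^f_r`; if it is the left one, `e = e^f_ℓ`.) -/
def ExtremalEdge (q c : κ) (e : Sym2 V) : Prop :=
  B.IsChild c q ∧ e ∈ (B.path c).edges ∧
    ∃ C, B.IsFaceBoundary q C ∧ e ∈ C \ (B.path q).edges ∧ ∃ v ∈ e, v ∈ (B.path q).verts

/-- `s` interferes with the face with upper path `q`. -/
def Interferes (s q : κ) : Prop := ∃ c e, B.ExtremalEdge q c e ∧ e ∈ (B.path s).edges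

/-- `q ∈ Touch_p`. -/
def Touch (p q : κ) : Prop := B.Le q p ∧ ((B.path q).verts ∩ (B.path p).verts).Nonempty

/-- `m ∈ Max_p`. -/
def Max (p m : κ) : Prop :=
  B.Le m p ∧ ¬ B.Touch p m ∧ ∀ i, B.Le i p → ¬ B.Touch p i → B.Le m i → i = m

/-- The level `MAX_n`. -/
def MAXLevel : ℕ → Set κ
  | 0 => {B.root}
  | n + 1 => {m | ∃ p ∈ MAXLevel n, B.Max p m}

/-- `e` is the special edge of `p`: the edge of `p` at `x_p` if `p` is the root, and otherwise the
extremal edge on `p` of the lower boundary of the face `f_p` whose upper path is the parent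
of `p`. -/
def SpecialEdge (p : κ) (e : Sym2 V) : Prop :=
  (p = B.root ∧ e ∈ (B.path p).edges ∧
    ((M.face ^ B.layout.lo p) B.layout.base).fst ∈ e) ∨
  (p ≠ B.root ∧ ∃ q, B.ExtremalEdge q p e)

/-- `s` contains the special edge of `p`. -/
def HasSpecialEdge (p s : κ) : Prop := ∃ e, B.SpecialEdge p e ∧ e ∈ (B.path s).edges

/-- `m ∈ Max_p^III`: `m ∈ Max_p` and the sibling of `m` is in `Touch_p`. -/
def MaxIII (p m : κ) : Prop :=
  B.Max p m ∧ ∃ q w, B.IsChild m q ∧ B.IsChild w q ∧ w ≠ m ∧ B.Touch p w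

/-- `m ⇢ m'`: `m` interferes with the face whose upper path is the parent of `m'`. -/
def DashArrow (m m' : κ) : Prop := m ≠ m' ∧ ∃ q, B.IsChild m' q ∧ B.Interferes m q

end BinaryFamily

/-! ### The algorithm FourForests

All variables of the algorithm are written once, so an execution is described by their final values:
`label`, `triple` and `special` (the last two matter on the levels `MAX_n` only). The calls of the procedures
are predicates on these values. -/

/-- The variables of the algorithm. -/
structure Vars (κ : Type*) where
  label : κ → Fin 4
  triple : κ → Finset (Fin 4)
  special : κ → Fin 4

namespace BinaryFamily

variable {V : Type*} [Finite V] {M : PlaneGraph V} {κ : Type*} (B : BinaryFamily M κ) (σ : Vars κ)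

/-- The call `RightColor(p, q, (c₁, c₂, c₃))`. -/
inductive RightColor (p : κ) : κ → Fin 4 → Fin 4 → Fin 4 → Prop
  | none {q c₁ c₂ c₃} : σ.label q = c₁ → (∀ c, B.IsChild c q → ¬ B.Touch p c) →
      RightColor p q c₁ c₂ c₃
  | one {q q' c₁ c₂ c₃} : σ.label q = c₁ → (∀ c, B.IsChild c q ∧ B.Touch p c ↔ c = q') →
      RightColor p q' c₁ c₂ c₃ → RightColor p q c₁ c₂ c₃
  | two {q r l c₁ c₂ c₃} : σ.label q = c₁ → B.Children q r l → B.Touch p r → B.Touch p l →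
      RightColor p r c₁ c₃ c₂ → RightColor p l c₂ c₁ c₃ → RightColor p q c₁ c₂ c₃

/-- The call `LeftColor(p, q, (c₁, c₂, c₃))`. -/
inductive LeftColor (p : κ) : κ → Fin 4 → Fin 4 → Fin 4 → Prop
  | none {q c₁ c₂ c₃} : σ.label q = c₁ → (∀ c, B.IsChild c q → ¬ B.Touch p c) →
      LeftColor p q c₁ c₂ c₃
  | one {q q' c₁ c₂ c₃} : σ.label q = c₁ → (∀ c, B.IsChild c q ∧ B.Touch p c ↔ c = q') →
      LeftColor p q' c₁ c₂ c₃ → LeftColor p q c₁ c₂ c₃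
  | two {q r l c₁ c₂ c₃} : σ.label q = c₁ → B.Children q r l → B.Touch p r → B.Touch p l →
      LeftColor p l c₁ c₃ c₂ → LeftColor p r c₂ c₁ c₃ → LeftColor p q c₁ c₂ c₃

/-- The call `SetColor(p, q, (cr, cl))`. -/
inductive SetColor (p : κ) : κ → Fin 4 → Fin 4 → Prop
  | none {q cr cl} : σ.label q = σ.special p → (∀ c, B.IsChild c q → ¬ B.Touch p c) →
      SetColor p q cr cl
  | one {q q' cr cl} : σ.label q = σ.special p → (∀ c, B.IsChild c q ∧ B.Touch p c ↔ c = q') →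
      SetColor p q' cr cl → SetColor p q cr cl
  | right {q r l cr cl d} : σ.label q = σ.special p → B.Children q r l →
      B.Touch p r → B.Touch p l → B.HasSpecialEdge p r →
      {d} = σ.triple p \ {cl, σ.special p} →
      SetColor p r cr d → B.RightColor σ p l cl (σ.special p) d → SetColor p q cr cl
  | left {q r l cr cl d} : σ.label q = σ.special p → B.Children q r l →
      B.Touch p r → B.Touch p l → ¬ B.HasSpecialEdge p r →
      {d} = σ.triple p \ {cr, σ.special p} →
      SetColor p l d cl → B.LeftColor σ p r cr (σ.special p) d → SetColor p q cr cl

/-- The call `ColorSpecialTouch(p)`: it labels the paths of `Touch_p`. -/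
def ColorSpecialTouch (p : κ) : Prop :=
  ∃ cr ∈ σ.triple p \ {σ.special p}, ∃ cl ∈ σ.triple p \ {σ.special p}, B.SetColor σ p p cr cl

/-- The call `TripleSpecialMax(p)`: it sets `triple` and `special` on `Max_p`. The first part is
the loop over the faces of type II, the second one the loop over the trees of
`(Max_p^III, ⇢)`, where `Δ m` is the set of two labels chosen for the tree of `m`, and `A` is the class
of the bipartition that contains the roots. -/
def TripleSpecialMax (p : κ) : Prop :=
  (∀ q r l, B.Children q r l → B.Max p r → B.Max p l →
    σ.special r ∈ σ.triple p ∧ σ.special l ∈ σ.triple p ∧ σ.special r ≠ σ.special l ∧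
    σ.triple r = σ.triple p ∧ σ.triple l = σ.triple p) ∧
  ∃ (Δ : κ → Finset (Fin 4)) (A : Set κ),
    (∀ m m', B.MaxIII p m → B.MaxIII p m' → B.DashArrow m m' → Δ m = Δ m' ∧ (m ∈ A ↔ m' ∉ A)) ∧
    ∀ m, B.MaxIII p m →
      ((∀ m', B.MaxIII p m' → ¬ B.DashArrow m' m) → m ∈ A) ∧
      Δ m ⊆ σ.triple p ∧ (Δ m).card = 2 ∧
      (∀ q s, B.IsChild m q → B.Touch p s → B.Interferes s q → σ.label s ∈ Δ m) ∧
      (m ∈ A → {σ.special m} = Finset.univ \ σ.triple p ∧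
        σ.triple m = Δ m ∪ {σ.special m}) ∧
      (m ∉ A → {σ.special m} = σ.triple p \ Δ m ∧ σ.triple m = σ.triple p)

/-- The main loop of FourForests on a binary family, after the initialization of `triple` and
`special` at the root. -/
def Run : Prop :=
  σ.triple B.root = {0, 1, 2} ∧ σ.special B.root = 0 ∧
  ∀ n, ∀ p ∈ B.MAXLevel n, B.ColorSpecialTouch σ p ∧ B.TripleSpecialMax σ p

end BinaryFamily

/-- `L` is a possible output of the algorithm FourForests on the family `P`: the family is first
completed to a binary family by auxiliary paths, then the main loop is executed, and
the labels of the members of `P` are returned. -/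
def FourForests {V : Type*} [Finite V] (M : PlaneGraph V) {ι : Type*} (P : ι → GPath M.G)
    (L : ι → Fin 4) : Prop :=
  ∃ (k : ℕ) (B : BinaryFamily M (ι ⊕ Fin k)) (σ : Vars (ι ⊕ Fin k)),
    (∀ i, B.path (Sum.inl i) = P i) ∧ B.Run σ ∧ ∀ i, L i = σ.label (Sum.inl i)

/-! ### Potentials on the faces of a plane graph -/

namespace PlaneGraph

variable {V : Type*} [Finite V] (M : PlaneGraph V)

/-! Planarity enters through homology mod 2. By Euler's formula every even edge set bounds a set of
faces (`exists_face_potential`), so a path between two corners of the external face has a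
well-defined inside (`Region.side`). Regions of single-touch paths over disjoint arcs are disjoint,
and this yields the topological facts that are needed: a path separates what is below it from the
rest; nested paths run through their common vertices in the same direction; among a path `q` and two
side-by-side paths `r`, `l` below it, the contacts along each with the other two come in a fixed
order. These are the axioms of `PathSystem`; the rest is combinatorial and symmetric under `mirror`.

A labeling is a forest labeling as soon as, for every face, a path through one extremal edge and a
path through the other always have different labels. Indeed, a cycle is not contained in the root
path. Take a lowest `q` with a child carrying an edge of the cycle off `q`. Since a cycle has no
leaf, it must contain the edge by which each child of `q` leaves `q` towards the other child
(`exists_exits`).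

The labels differ by `Run.ne_of_exits`. Some path `p` of a level `MAX_n` is touched by `q`. If both
children touch `p`, the interfering paths that matter lie on the chain of leftmost touching
descendants of the right child and on the rightmost chain of the left child (`Exit.chain`); the
procedures use two labels on one of these chains and the third label on the other. If neither
touches, every path through the special edge of a child `m` has label `special m`
(`SetColor.label_of_special`), and siblings have different special labels. If only one touches, the
special label of the other child avoids `Δ` and also the triple of the member of `Max_p` that
interferes on the touching side; this is what the classes `A` and `B` achieve
(`Run.ne_of_touch_max`).

An execution exists because calls propagate down the tree, and because all touching paths
interfering with the faces of one tree of `⇢` lie on a single chain, which carries at most two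
labels. The completion in Step 1 exists because a maximal single-touch family with distinct laminar
arcs is binary: its arcs include all unit arcs, and a path with three or more children would leave
room for a new path glued from two members. -/

instance instFiniteDart : Finite M.G.Dart :=
  Finite.of_injective (fun d : M.G.Dart => d.toProd) fun _ _ h => Dart.ext _ _ h

theorem rot_symm (d : M.G.Dart) : M.face d = M.rot d.symm := rfl

theorem face_symm (d : M.G.Dart) : M.face d.symm = M.rot d := by
  rw [rot_symm, Dart.symm_symm]

theorem face_fst (d : M.G.Dart) : (M.face d).fst = d.snd := by
  rw [rot_symm, M.rot_fst]; rfl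

theorem eq_of_forall_dart_eq {α : Type*} (y : V → α) (h : ∀ d : M.G.Dart, y d.fst = y d.snd)
    (u v : V) : y u = y v := by
  obtain ⟨w⟩ := M.connected.preconnected u v
  induction w with
  | nil => rfl
  | cons hadj _ ih => exact (h ⟨(_, _), hadj⟩).trans ih

/-- A set of darts that is invariant under reversal and along the facial walks is trivial. -/
theorem dart_iff_of_invariant (T : M.G.Dart → Prop) (hs : ∀ d, T d ↔ T d.symm)
    (hf : ∀ d, T (M.face d) ↔ T d) (d d' : M.G.Dart) : T d ↔ T d' := by
  -- A rotation is a reversal followed by a facial step, so `T` is constant on the darts at each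
  -- vertex; connectivity then spreads it over the graph.
  have hrot : ∀ d, T (M.rot d) ↔ T d := fun d => by
    rw [← M.face_symm, hf, ← hs]
  have hcyc : ∀ d d' : M.G.Dart, d.fst = d'.fst → (T d ↔ T d') := by
    intro d d' h
    obtain ⟨i, hi⟩ := (M.rot_cycle d d' h).exists_nat_pow_eq
    rw [← hi]
    clear hi
    induction i with
    | zero => rfl
    | succ n ih => rw [pow_succ', Equiv.Perm.mul_apply, hrot]; exact ih
  have := M.eq_of_forall_dart_eq (fun v => ∃ d : M.G.Dart, d.fst = v ∧ T d) (by
    intro d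
    apply propext
    constructor
    · rintro ⟨e, he, h⟩
      exact ⟨d.symm, rfl, (hs d).1 ((hcyc e d he).1 h)⟩
    · rintro ⟨e, he, h⟩
      exact ⟨d, rfl, (hs d).2 ((hcyc e d.symm he).1 h)⟩) d.fst d'.fst
  have key : ∀ d, T d ↔ ∃ e : M.G.Dart, e.fst = d.fst ∧ T e := fun d =>
    ⟨fun h => ⟨d, rfl, h⟩, fun ⟨e, he, h⟩ => (hcyc e d he).1 h⟩
  rw [key d, key d']
  exact Iff.of_eq this

/-- Bounds two kernels below, that of the transposed incidence map and that of the boundary map on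
faces; connectivity makes both consist of constant functions. -/
theorem finrank_le_one_of_const {α : Type*} [Finite α] (W : Submodule (ZMod 2) (α → ZMod 2))
    (h : ∀ y ∈ W, ∀ a b, y a = y b) : Module.finrank (ZMod 2) W ≤ 1 := by
  classical
  rcases isEmpty_or_nonempty α with hα | ⟨⟨a⟩⟩
  · have : Subsingleton W := ⟨fun x y => Subtype.ext (funext fun a => (hα.false a).elim)⟩
    rw [Module.finrank_zero_of_subsingleton]; exact zero_le_one
  · have hle : W ≤ Submodule.span (ZMod 2) {fun _ => (1 : ZMod 2)} := by
      intro y hy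
      rw [Submodule.mem_span_singleton]
      exact ⟨y a, funext fun b => by simp [h y hy b a]⟩
    exact (Submodule.finrank_mono hle).trans (finrank_span_le_card _ |>.trans (by simp))

open Classical in
/-- A set of edges that has even degree at each vertex is the boundary of a set of faces. -/
theorem exists_face_potential [Fintype M.G.Dart] (c : Sym2 V → ZMod 2)
    (hc : ∀ v, ∑ d : M.G.Dart, (if d.fst = v then c d.edge else 0) = 0) :
    ∃ h : M.G.Dart → ZMod 2, (∀ d, h (M.face d) = h d) ∧ ∀ d, h d + h d.symm = c d.edge := by
  have := Fintype.ofFinite V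
  let Q := Quotient (Equiv.Perm.SameCycle.setoid M.face)
  have : Fintype Q := Fintype.ofFinite Q
  let ed : M.G.Dart → M.G.edgeSet := fun d => ⟨d.edge, d.edge_mem⟩
  -- The incidence matrix mod 2; its kernel is the cycle space.
  let A : Matrix V M.G.edgeSet (ZMod 2) :=
    fun v e => ∑ d : M.G.Dart, if d.fst = v ∧ ed d = e then 1 else 0
  have hA : ∀ (x : M.G.edgeSet → ZMod 2) v,
      A.mulVec x v = ∑ d : M.G.Dart, if d.fst = v then x (ed d) else 0 := by
    intro x v
    simp only [A, Matrix.mulVec, dotProduct, Finset.sum_mul]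
    rw [Finset.sum_comm]
    refine Finset.sum_congr rfl fun d _ => ?_
    by_cases h : d.fst = v <;> simp [h]
  have hAt : ∀ (y : V → ZMod 2) (d : M.G.Dart),
      A.transpose.mulVec y (ed d) = y d.fst + y d.snd := by
    intro y d
    change ∑ v, (∑ e : M.G.Dart, if e.fst = v ∧ ed e = ed d then 1 else 0) * y v = _
    simp only [Finset.sum_mul]
    rw [Finset.sum_comm]
    have : ∀ e : M.G.Dart, (∑ v, (if e.fst = v ∧ ed e = ed d then (1 : ZMod 2) else 0) * y v) =
        if e.edge = d.edge then y e.fst else 0 := by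
      intro e
      have h2 : ed e = ed d ↔ e.edge = d.edge := Subtype.ext_iff
      by_cases h : e.edge = d.edge <;> simp [h, h2]
    have hfib : Finset.univ.filter (fun e : M.G.Dart => e.edge = d.edge) = {d, d.symm} := by
      ext e
      simp [dart_edge_eq_iff]
    rw [Finset.sum_congr rfl fun e _ => this e, ← Finset.sum_filter, hfib,
      Finset.sum_pair d.symm_ne.symm]
    rfl
  have hrank : Fintype.card V ≤ A.rank + 1 := by
    have h1 := LinearMap.finrank_range_add_finrank_ker A.transpose.mulVecLin
    rw [Module.finrank_fintype_fun_eq_card] at h1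
    have h2 : Module.finrank (ZMod 2) (LinearMap.ker A.transpose.mulVecLin) ≤ 1 := by
      apply finrank_le_one_of_const
      intro y hy
      apply M.eq_of_forall_dart_eq
      intro d
      have := congrFun (LinearMap.mem_ker.1 hy) (ed d)
      rw [Matrix.mulVecLin_apply, hAt] at this
      exact CharTwo.add_eq_zero.1 this
    have h3 : A.transpose.rank = A.rank := Matrix.rank_transpose A
    rw [Matrix.rank] at h3
    omega
  let mk : M.G.Dart → Q := fun d => Quotient.mk _ d
  have hmk : ∀ d, mk (M.face d) = mk d := fun d =>
    Quotient.sound (Equiv.Perm.SameCycle.symm ⟨1, by simp⟩)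
  have hrep : ∀ e : M.G.edgeSet, ∃ d : M.G.Dart, ed d = e := by
    rintro ⟨e, he⟩
    induction e with
    | _ u v => exact ⟨⟨(u, v), he⟩, rfl⟩
  choose rep hrep using hrep
  -- The boundary map from sets of faces to sets of edges.
  let δ : (Q → ZMod 2) →ₗ[ZMod 2] (M.G.edgeSet → ZMod 2) :=
    { toFun := fun h e => h (mk (rep e)) + h (mk (rep e).symm)
      map_add' := fun x y => by ext e; simp only [Pi.add_apply]; ring
      map_smul' := fun a x => by
        ext e; simp only [Pi.smul_apply, smul_eq_mul, RingHom.id_apply]; ring }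
  have hδ : ∀ h d, δ h (ed d) = h (mk d) + h (mk d.symm) := by
    intro h d
    have h1 : (rep (ed d)).edge = d.edge := congrArg Subtype.val (hrep (ed d))
    change h (mk (rep (ed d))) + h (mk (rep (ed d)).symm) = _
    rcases (dart_edge_eq_iff _ _).1 h1 with h2 | h2
    · rw [h2]
    · rw [h2, Dart.symm_symm, add_comm]
  have hkerδ : Module.finrank (ZMod 2) (LinearMap.ker δ) ≤ 1 := by
    apply finrank_le_one_of_const
    intro h hh
    have hsym : ∀ d : M.G.Dart, h (mk d) = h (mk d.symm) := by
      intro d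
      have := congrFun (LinearMap.mem_ker.1 hh) (ed d)
      rw [hδ] at this
      exact CharTwo.add_eq_zero.1 this
    intro a b
    induction a using Quotient.inductionOn with | _ a
    induction b using Quotient.inductionOn with | _ b
    have := M.dart_iff_of_invariant (fun d => h (mk d) = h (mk b))
      (fun d => by rw [hsym d]) (fun d => by rw [hmk]) a b
    exact this.2 rfl
  have hle : LinearMap.range δ ≤ LinearMap.ker A.mulVecLin := by
    rintro _ ⟨h, rfl⟩
    rw [LinearMap.mem_ker]
    ext v
    rw [Matrix.mulVecLin_apply, hA]
    have : ∀ d : M.G.Dart, (if d.fst = v then δ h (ed d) else 0) =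
        (if d.fst = v then h (mk d) else 0) +
          (if (M.rot d).fst = v then h (mk (M.rot d)) else 0) := by
      intro d
      rw [hδ, M.rot_fst, ← M.face_symm d, hmk]
      split_ifs <;> simp
    rw [Finset.sum_congr rfl fun d _ => this d, Finset.sum_add_distrib,
      Equiv.sum_comp M.rot (fun d : M.G.Dart => if d.fst = v then h (mk d) else 0)]
    exact CharTwo.add_self_eq_zero _
  -- Boundaries have dimension at least `F - 1` and cycles at most `E - V + 1`. Euler's formula says
  -- that these numbers agree, so the inclusion `hle` is an equality.
  have heq : LinearMap.range δ = LinearMap.ker A.mulVecLin := by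
    apply Submodule.eq_of_le_of_finrank_le hle
    have h1 := LinearMap.finrank_range_add_finrank_ker A.mulVecLin
    have h2 := LinearMap.finrank_range_add_finrank_ker δ
    rw [Module.finrank_fintype_fun_eq_card] at h1 h2
    have h3 := M.euler
    rw [Nat.card_eq_fintype_card, Nat.card_eq_fintype_card (α := M.G.edgeSet)] at h3
    have h4 : Nat.card (Quotient (Equiv.Perm.SameCycle.setoid
        ((Dart.symm_involutive (G := M.G)).toPerm.trans M.rot))) = Fintype.card Q :=
      Nat.card_eq_fintype_card (α := Q)
    rw [h4] at h3
    rw [Matrix.rank] at hrank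
    omega
  have hmem : (fun e : M.G.edgeSet => c e) ∈ LinearMap.range δ := by
    rw [heq, LinearMap.mem_ker]
    ext v
    rw [Matrix.mulVecLin_apply, hA]
    exact hc v
  obtain ⟨h, hh⟩ := hmem
  refine ⟨fun d => h (mk d), fun d => congrArg h (hmk d), fun d => ?_⟩
  rw [← hδ, hh]

end PlaneGraph

/-! ### Paths as sequences of vertices -/

namespace GPath

variable {V : Type*} {G : SimpleGraph V}

/-- The length of a path. -/
def len (p : GPath G) : ℕ := p.walk.length

/-- The vertex number `i` of a path. -/
def vert (p : GPath G) (i : ℕ) : V := p.walk.getVert i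

theorem vert_zero (p : GPath G) : p.vert 0 = p.x := p.walk.getVert_zero

theorem vert_len (p : GPath G) : p.vert p.len = p.y := p.walk.getVert_length

theorem vert_inj (p : GPath G) {i j : ℕ} (hi : i ≤ p.len) (hj : j ≤ p.len)
    (h : p.vert i = p.vert j) : i = j := p.isPath.getVert_injOn hi hj h

theorem mem_verts {p : GPath G} {v : V} : v ∈ p.verts ↔ ∃ i ≤ p.len, p.vert i = v := by
  change v ∈ p.walk.support ↔ _
  rw [Walk.mem_support_iff_exists_getVert]
  exact ⟨fun ⟨n, h1, h2⟩ => ⟨n, h2, h1⟩, fun ⟨n, h1, h2⟩ => ⟨n, h2, h1⟩⟩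

theorem vert_mem (p : GPath G) (i : ℕ) : p.vert i ∈ p.verts := p.walk.getVert_mem_support i

theorem adj (p : GPath G) {i : ℕ} (hi : i < p.len) : G.Adj (p.vert i) (p.vert (i + 1)) :=
  p.walk.adj_getVert_succ hi

theorem mem_walk_edges {u v : V} (w : G.Walk u v) (e : Sym2 V) :
    e ∈ w.edges ↔ ∃ i < w.length, e = s(w.getVert i, w.getVert (i + 1)) := by
  induction w with
  | nil => simp
  | cons h w ih =>
    rw [Walk.edges_cons, List.mem_cons, ih]
    constructor
    · rintro (rfl | ⟨i, hi, rfl⟩)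
      · exact ⟨0, by simp, by simp⟩
      · exact ⟨i + 1, by simpa using hi, by simp [Walk.getVert_cons_succ]⟩
    · rintro ⟨i, hi, rfl⟩
      cases i with
      | zero => left; simp
      | succ i => right; exact ⟨i, by simpa using hi, by simp [Walk.getVert_cons_succ]⟩

theorem mem_edges {p : GPath G} {e : Sym2 V} :
    e ∈ p.edges ↔ ∃ i < p.len, e = s(p.vert i, p.vert (i + 1)) :=
  mem_walk_edges p.walk e

theorem edge_mem (p : GPath G) {i : ℕ} (hi : i < p.len) :
    s(p.vert i, p.vert (i + 1)) ∈ p.edges := mem_edges.2 ⟨i, hi, rfl⟩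

theorem left_mem_verts {p : GPath G} {u v : V} (h : s(u, v) ∈ p.edges) : u ∈ p.verts :=
  p.walk.fst_mem_support_of_mem_edges h

theorem right_mem_verts {p : GPath G} {u v : V} (h : s(u, v) ∈ p.edges) : v ∈ p.verts :=
  p.walk.snd_mem_support_of_mem_edges h

theorem mem_edgeSet {p : GPath G} {e : Sym2 V} (h : e ∈ p.edges) : e ∈ G.edgeSet :=
  p.walk.edges_subset_edgeSet h

theorem edge_vert_iff {p : GPath G} {i : ℕ} (hi : i ≤ p.len) {b : V} :
    s(p.vert i, b) ∈ p.edges ↔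
      (i < p.len ∧ b = p.vert (i + 1)) ∨ (0 < i ∧ b = p.vert (i - 1)) := by
  rw [mem_edges]
  constructor
  · rintro ⟨k, hk, h⟩
    rcases Sym2.eq_iff.1 h with ⟨h1, h2⟩ | ⟨h1, h2⟩
    · obtain rfl := p.vert_inj hi hk.le h1
      exact Or.inl ⟨hk, h2⟩
    · obtain rfl := p.vert_inj hi hk h1
      exact Or.inr ⟨Nat.succ_pos _, by simpa using h2⟩
  · rintro (⟨h, rfl⟩ | ⟨h, rfl⟩)
    · exact ⟨i, h, rfl⟩
    · refine ⟨i - 1, by omega, ?_⟩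
      rw [Nat.sub_add_cancel h, Sym2.eq_swap]

/-- Glued paths are built from their vertex sequences, so that only adjacency and injectivity have
to be checked. -/
theorem exists_of_fun (f : ℕ → V) (n : ℕ) (hadj : ∀ i < n, G.Adj (f i) (f (i + 1)))
    (hinj : ∀ i ≤ n, ∀ j ≤ n, f i = f j → i = j) :
    ∃ p : GPath G, p.len = n ∧ ∀ i ≤ n, p.vert i = f i := by
  have key : ∀ n, (∀ i < n, G.Adj (f i) (f (i + 1))) →
      ∃ w : G.Walk (f 0) (f n), w.length = n ∧ ∀ i ≤ n, w.getVert i = f i := by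
    intro n
    induction n with
    | zero => exact fun _ => ⟨Walk.nil, rfl, fun i hi => by simp [Nat.le_zero.1 hi]⟩
    | succ n ih =>
      intro h
      obtain ⟨w, hw, hv⟩ := ih fun i hi => h i (by omega)
      refine ⟨w.concat (h n (by omega)), by simp [hw], fun i hi => ?_⟩
      rw [Walk.concat_eq_append, Walk.getVert_append, hw]
      split_ifs with hlt
      · exact hv i hlt.le
      · rcases Nat.lt_or_eq_of_le hi with h1 | rfl
        · obtain rfl : i = n := by omega
          simp
        · simp [show n + 1 - n = 1 by omega]
  obtain ⟨w, hw, hv⟩ := key n hadj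
  refine ⟨⟨w, ?_⟩, hw, hv⟩
  rw [Walk.isPath_iff_injective_get_support]
  intro a b hab
  have ha : w.getVert a = w.support.get a := congrFun w.getVert_comp_val_eq_get_support a
  have hb : w.getVert b = w.support.get b := congrFun w.getVert_comp_val_eq_get_support b
  have h1 : (a : ℕ) ≤ n := by have := a.2; have := w.length_support; omega
  have h2 : (b : ℕ) ≤ n := by have := b.2; have := w.length_support; omega
  apply Fin.ext
  apply hinj _ h1 _ h2
  rw [← hv _ h1, ← hv _ h2, ha, hb]
  exact hab

/-- If consecutive edges of `c` lie on `q`, then that part of `c` is a part of `q`, run through in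
one of the two directions. -/
theorem match_of_edges {c q : GPath G} {i n : ℕ} (hn : i + n ≤ c.len)
    (hi : c.vert i ∈ q.verts)
    (h : ∀ k < n, s(c.vert (i + k), c.vert (i + k + 1)) ∈ q.edges) :
    ∃ α ≤ q.len, (α + n ≤ q.len ∧ ∀ k ≤ n, c.vert (i + k) = q.vert (α + k)) ∨
      (n ≤ α ∧ ∀ k ≤ n, c.vert (i + k) = q.vert (α - k)) := by
  induction n with
  | zero =>
    obtain ⟨α, hα, h⟩ := mem_verts.1 hi
    exact ⟨α, hα, Or.inl ⟨hα, fun k hk => by simp [Nat.le_zero.1 hk, h]⟩⟩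
  | succ n ih =>
    obtain ⟨α, hα, ⟨h1, h2⟩ | ⟨h1, h2⟩⟩ := ih (by omega) fun k hk => h k (by omega)
    · have he := h n (by omega)
      rw [h2 n le_rfl, edge_vert_iff h1] at he
      rcases he with ⟨h3, h4⟩ | ⟨h3, h4⟩
      · refine ⟨α, hα, Or.inl ⟨h3, fun k hk => ?_⟩⟩
        rcases Nat.lt_or_eq_of_le hk with h5 | rfl
        · exact h2 k (by omega)
        · exact h4
      -- The new edge goes backwards on `q`. This fixes the direction if nothing has been matched so
      -- far; otherwise `c` would repeat a vertex.
      · rcases Nat.eq_zero_or_pos n with rfl | hpos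
        · refine ⟨α, hα, Or.inr ⟨by omega, fun k hk => ?_⟩⟩
          rcases Nat.lt_or_eq_of_le hk with h5 | rfl
          · obtain rfl : k = 0 := by omega
            exact h2 0 le_rfl
          · exact h4
        · have h5 := h2 (n - 1) (by omega)
          rw [show α + n - 1 = α + (n - 1) by omega, ← h5] at h4
          have := c.vert_inj (by omega) (by omega) h4
          omega
    · have he := h n (by omega)
      rw [h2 n le_rfl, edge_vert_iff (by omega)] at he
      rcases he with ⟨h3, h4⟩ | ⟨h3, h4⟩
      · rcases Nat.eq_zero_or_pos n with rfl | hpos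
        · refine ⟨α, hα, Or.inl ⟨by omega, fun k hk => ?_⟩⟩
          rcases Nat.lt_or_eq_of_le hk with h5 | rfl
          · obtain rfl : k = 0 := by omega
            exact h2 0 le_rfl
          · exact h4
        · have h5 := h2 (n - 1) (by omega)
          rw [show α - n + 1 = α - (n - 1) by omega, ← h5] at h4
          have := c.vert_inj (by omega) (by omega) h4
          omega
      · refine ⟨α, hα, Or.inr ⟨by omega, fun k hk => ?_⟩⟩
        rcases Nat.lt_or_eq_of_le hk with h5 | rfl
        · exact h2 k (by omega)
        · rw [show α - (n + 1) = α - n - 1 by omega]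
          exact h4

/-- Between two vertices of `q`, the path `c` runs along `q`. -/
def Contig (c q : GPath G) : Prop :=
  ∀ i j, i < j → j ≤ c.len → c.vert i ∈ q.verts → c.vert j ∈ q.verts →
    ∀ k, i ≤ k → k < j → s(c.vert k, c.vert (k + 1)) ∈ q.edges

namespace Contig

variable {c q : GPath G}

theorem vert (h : Contig c q) {i j k : ℕ} (hj : j ≤ c.len) (hi : c.vert i ∈ q.verts)
    (hjq : c.vert j ∈ q.verts) (hik : i ≤ k) (hkj : k ≤ j) : c.vert k ∈ q.verts := by
  rcases Nat.lt_or_eq_of_le hkj with h1 | rfl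
  · exact left_mem_verts (h i j (by omega) hj hi hjq k hik h1)
  · exact hjq

theorem edge (h : Contig c q) {u v : V} (he : s(u, v) ∈ c.edges) (hu : u ∈ q.verts)
    (hv : v ∈ q.verts) : s(u, v) ∈ q.edges := by
  obtain ⟨k, hk, he⟩ := mem_edges.1 he
  rw [he]
  rcases Sym2.eq_iff.1 he with ⟨rfl, rfl⟩ | ⟨rfl, rfl⟩
  · exact h k (k + 1) (by omega) hk hu hv k le_rfl (by omega)
  · exact h k (k + 1) (by omega) hk hv hu k le_rfl (by omega)

theorem exists_match (h : Contig c q) {i j : ℕ} (hij : i ≤ j) (hj : j ≤ c.len)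
    (hi : c.vert i ∈ q.verts) (hjq : c.vert j ∈ q.verts) :
    ∃ α ≤ q.len, (α + (j - i) ≤ q.len ∧ ∀ k ≤ j - i, c.vert (i + k) = q.vert (α + k)) ∨
      (j - i ≤ α ∧ ∀ k ≤ j - i, c.vert (i + k) = q.vert (α - k)) :=
  match_of_edges (by omega) hi fun k hk => by
    exact h i j (by omega) hj hi hjq (i + k) (by omega) (by omega)

/-- Between two common vertices the stretch of `c` is matched index by index, forwards or backwards,
with the stretch of `q`. Hence every edge of the latter is an edge of `c`. -/
theorem symm (h : Contig c q) : Contig q c := by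
  have key : ∀ α β, α ≤ q.len → β ≤ q.len → ∀ i j, i < j → j ≤ c.len → c.vert i = q.vert α →
      c.vert j = q.vert β → ∀ k, (α ≤ k ∧ k < β ∨ β ≤ k ∧ k < α) →
        s(q.vert k, q.vert (k + 1)) ∈ c.edges := by
    intro α β hα hβ i j hij hj h1 h2 k hk
    obtain ⟨γ, hγ, ⟨h3, h4⟩ | ⟨h3, h4⟩⟩ := h.exists_match hij.le hj (h1 ▸ q.vert_mem α)
      (h2 ▸ q.vert_mem β)
    · have h5 := h4 0 (by omega)
      have h6 := h4 (j - i) le_rfl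
      rw [show i + (j - i) = j by omega, h2] at h6
      rw [add_zero, add_zero, h1] at h5
      have h7 := q.vert_inj hα hγ h5
      have h8 := q.vert_inj hβ h3 h6
      have h9 := h4 (k - γ) (by omega)
      have h10 := h4 (k - γ + 1) (by omega)
      rw [show γ + (k - γ) = k by omega] at h9
      rw [show γ + (k - γ + 1) = k + 1 by omega] at h10
      rw [← h9, ← h10]
      exact c.edge_mem (by omega)
    · have h5 := h4 0 (by omega)
      have h6 := h4 (j - i) le_rfl
      rw [show i + (j - i) = j by omega, h2] at h6
      rw [add_zero, Nat.sub_zero, h1] at h5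
      have h7 := q.vert_inj hα hγ h5
      have h8 := q.vert_inj hβ (by omega) h6
      have h9 := h4 (γ - k) (by omega)
      have h10 := h4 (γ - k - 1) (by omega)
      rw [show γ - (γ - k) = k by omega] at h9
      rw [show γ - (γ - k - 1) = k + 1 by omega] at h10
      rw [← h9, ← h10, Sym2.eq_swap, show i + (γ - k) = i + (γ - k - 1) + 1 by omega]
      exact c.edge_mem (by omega)
  intro α β hαβ hβ h1 h2 k hk1 hk2
  obtain ⟨i, hi, h3⟩ := mem_verts.1 h1
  obtain ⟨j, hj, h4⟩ := mem_verts.1 h2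
  rcases lt_trichotomy i j with hij | rfl | hij
  · exact key α β (by omega) hβ i j hij hj h3 h4 k (Or.inl ⟨hk1, hk2⟩)
  · have := q.vert_inj (by omega) hβ (h3.symm.trans h4)
    omega
  · exact key β α hβ (by omega) j i hij hi h4 h3 k (Or.inr ⟨hk1, hk2⟩)

/-- All common vertices of `x` and `c` lie on `q`. Between two of them `x` runs along `q`, and that
part of `q` runs along `c`. -/
theorem transit {x : GPath G} (h : Contig x q) (h' : Contig q c)
    (hsub : ∀ v ∈ x.verts, v ∈ c.verts → v ∈ q.verts) : Contig x c := by
  intro i j hij hj h1 h2 k hk1 hk2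
  obtain ⟨γ, hγ, ⟨h3, h4⟩ | ⟨h3, h4⟩⟩ := h.exists_match hij.le hj (hsub _ (x.vert_mem i) h1)
    (hsub _ (x.vert_mem j) h2)
  · have h5 := h4 0 (by omega)
    have h6 := h4 (j - i) le_rfl
    rw [show i + (j - i) = j by omega] at h6
    rw [h6] at h2
    rw [add_zero] at h5
    rw [h5] at h1
    have h9 := h4 (k - i) (by omega)
    have h10 := h4 (k - i + 1) (by omega)
    rw [show i + (k - i) = k by omega] at h9
    rw [show i + (k - i + 1) = k + 1 by omega] at h10
    rw [h9, h10]
    exact h' _ _ (by omega) h3 h1 h2 (γ + (k - i)) (by omega) (by omega)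
  · have h5 := h4 0 (by omega)
    have h6 := h4 (j - i) le_rfl
    rw [show i + (j - i) = j by omega] at h6
    rw [h6] at h2
    rw [add_zero, Nat.sub_zero] at h5
    rw [h5] at h1
    have h9 := h4 (k - i) (by omega)
    have h10 := h4 (k - i + 1) (by omega)
    rw [show i + (k - i) = k by omega] at h9
    rw [show i + (k - i + 1) = k + 1 by omega] at h10
    rw [h9, h10, Sym2.eq_swap, show γ - (k - i) = γ - (k - i + 1) + 1 by omega]
    exact h' _ _ (by omega) hγ h2 h1 (γ - (k - i + 1)) (by omega) (by omega)

theorem refl (c : GPath G) : Contig c c := fun _ _ _ hj _ _ _ _ hk => c.edge_mem (by omega)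

end Contig

theorem exists_sub (p : GPath G) {a b : ℕ} (hab : a ≤ b) (hb : b ≤ p.len) :
    ∃ r : GPath G, r.len = b - a ∧ ∀ i ≤ b - a, r.vert i = p.vert (a + i) :=
  exists_of_fun (fun i => p.vert (a + i)) (b - a) (fun _ _ => p.adj (by omega))
    fun i hi j hj h => by have := p.vert_inj (by omega) (by omega) h; omega

theorem SingleTouch.contig {p q : GPath G} (h : p.SingleTouch q) : Contig p q := by
  intro i j hij hj hi hjq k hik hkj
  rcases h with h | ⟨r, hv, he⟩
  · exact absurd (show p.vert i ∈ p.verts ∩ q.verts from ⟨p.vert_mem i, hi⟩) (by simp [h])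
  have hre : ∀ k < r.len, s(r.vert k, r.vert (k + 1)) ∈ p.edges := fun k hk =>
    (he ▸ r.edge_mem hk : _ ∈ p.edges ∩ q.edges).1
  have hir : p.vert i ∈ r.verts := by rw [hv]; exact ⟨p.vert_mem i, hi⟩
  have hjr : p.vert j ∈ r.verts := by rw [hv]; exact ⟨p.vert_mem j, hjq⟩
  have hrp : Contig r p := fun _ _ _ hj _ _ k _ hk => hre k (by omega)
  have hpr : Contig p r := hrp.symm
  have := hpr i j hij hj hir hjr k hik hkj
  rw [he] at this
  exact this.2

/-- The intersection is the stretch of `p` from its first to its last vertex on `q`. So `Contig` is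
single touch in a form suited to computing with indices. -/
theorem Contig.singleTouch {p q : GPath G} (h : Contig p q) : p.SingleTouch q := by
  classical
  by_cases hne : ∃ i, i ≤ p.len ∧ p.vert i ∈ q.verts
  · right
    have hne' : ∃ n, n ≤ p.len ∧ p.vert (p.len - n) ∈ q.verts := by
      obtain ⟨i, hi, h⟩ := hne
      exact ⟨p.len - i, by omega, by rwa [show p.len - (p.len - i) = i by omega]⟩
    set a := Nat.find hne with ha
    have h1 := Nat.find_spec hne
    set b := p.len - Nat.find hne' with hb
    have h2 := Nat.find_spec hne'
    rw [← ha] at h1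
    rw [← hb] at h2
    have hmin : ∀ i ≤ p.len, p.vert i ∈ q.verts → a ≤ i ∧ i ≤ b := by
      intro i hi hq
      refine ⟨Nat.find_min' hne ⟨hi, hq⟩, ?_⟩
      have := Nat.find_min' hne' (m := p.len - i)
        ⟨by omega, by rwa [show p.len - (p.len - i) = i by omega]⟩
      omega
    have hab : a ≤ b := (hmin b (by omega) h2.2).1
    obtain ⟨r, hr, hrv⟩ := p.exists_sub hab (by omega)
    refine ⟨r, ?_, ?_⟩
    · ext v
      constructor
      · rw [mem_verts]
        rintro ⟨i, hi, rfl⟩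
        rw [hrv i (by omega)]
        exact ⟨p.vert_mem _, h.vert (by omega) h1.2 h2.2 (by omega) (by omega)⟩
      · rintro ⟨hp, hq⟩
        obtain ⟨i, hi, rfl⟩ := mem_verts.1 hp
        have := hmin i hi hq
        rw [mem_verts]
        exact ⟨i - a, by omega, by rw [hrv _ (by omega)]; congr 1; omega⟩
    · ext e
      constructor
      · rw [mem_edges]
        rintro ⟨i, hi, rfl⟩
        rw [hrv i (by omega), hrv (i + 1) (by omega)]
        exact ⟨p.edge_mem (i := a + i) (by omega),
          h a b (by omega) (by omega) h1.2 h2.2 _ (by omega) (by omega)⟩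
      · rintro ⟨hp, hq⟩
        obtain ⟨i, hi, rfl⟩ := mem_edges.1 hp
        have h3 := hmin i hi.le (left_mem_verts hq)
        have h4 := hmin (i + 1) hi (right_mem_verts hq)
        rw [mem_edges]
        refine ⟨i - a, by omega, ?_⟩
        rw [hrv _ (by omega), hrv _ (by omega), show a + (i - a) = i by omega,
          show a + (i - a + 1) = i + 1 by omega]
  · left
    ext v
    simp only [Set.mem_inter_iff, Set.mem_empty_iff_false, iff_false, not_and]
    intro hp hq
    obtain ⟨i, hi, rfl⟩ := mem_verts.1 hp
    exact hne ⟨i, hi, hq⟩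

/-- The reversed path. -/
def rev (p : GPath G) : GPath G := ⟨p.walk.reverse, p.isPath.reverse⟩

theorem rev_len (p : GPath G) : p.rev.len = p.len := p.walk.length_reverse

theorem rev_vert (p : GPath G) (i : ℕ) : p.rev.vert i = p.vert (p.len - i) :=
  p.walk.getVert_reverse i

theorem rev_verts (p : GPath G) : p.rev.verts = p.verts := by
  ext v; simp [verts, rev]

theorem rev_edges (p : GPath G) : p.rev.edges = p.edges := by
  ext v; simp [edges, rev]

theorem Contig.rev_right {c q : GPath G} (h : Contig c q) : Contig c q.rev := by
  unfold Contig
  rw [rev_verts, rev_edges]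
  exact h

theorem Contig.rev_left {c q : GPath G} (h : Contig c q) : Contig c.rev q :=
  h.symm.rev_right.symm

/-- The dart number `i` of a path. -/
def dart (p : GPath G) (i : ℕ) (hi : i < p.len) : G.Dart :=
  ⟨(p.vert i, p.vert (i + 1)), p.adj hi⟩

theorem len_eq_zero_of_x_eq_y {p : GPath G} (h : p.x = p.y) : p.len = 0 :=
  (p.vert_inj (Nat.zero_le _) le_rfl (by rw [vert_zero, vert_len, h])).symm

end GPath

/-! ### Regions cut off by a path with its extremal vertices at corners of the external face -/

/-- If the equivalence failed at `d₀`, then `T` or its complement would be mapped into itself and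
also receive a point from outside, which a permutation of a finite set cannot do. -/
theorem perm_apply_iff {α : Type*} [Finite α] (f : Equiv.Perm α) (T : α → Prop) (d₀ : α)
    (h : ∀ d, d ≠ d₀ → (T (f d) ↔ T d)) : T (f d₀) ↔ T d₀ := by
  constructor
  · intro h1
    by_contra h0
    have hm : Set.MapsTo f {d | T d} {d | T d} := fun d hd =>
      (h d (fun e => h0 (e ▸ hd))).2 hd
    have := Equiv.Perm.perm_symm_mapsTo_of_mapsTo f hm h1
    simp at this
    exact h0 this
  · intro h0
    by_contra h1
    have hm : Set.MapsTo f {d | ¬ T d} {d | ¬ T d} := fun d hd hd' =>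
      hd ((h d (fun e => hd (e ▸ h0))).1 hd')
    have := Equiv.Perm.perm_symm_mapsTo_of_mapsTo f hm h1
    simp at this
    exact this h0

namespace PlaneGraph

variable {V : Type*} [Finite V] (M : PlaneGraph V)

/-- The corner number `t` of the external face. -/
def corner (base : M.G.Dart) (t : ℕ) : M.G.Dart := (M.face ^ t) base

variable {M} {base : M.G.Dart}

theorem corner_zero : M.corner base 0 = base := rfl

theorem corner_succ (t : ℕ) : M.corner base (t + 1) = M.face (M.corner base t) := by
  rw [corner, pow_succ']; rfl

theorem corner_succ_fst (t : ℕ) : (M.corner base (t + 1)).fst = (M.corner base t).snd := by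
  rw [corner_succ, face_fst]

theorem outer_iff (hb : M.IsOuterDart base) (d : M.G.Dart) :
    M.IsOuterDart d ↔ M.face.SameCycle base d :=
  ⟨fun h => hb.symm.trans h, fun h => hb.trans h⟩

theorem corner_outer (hb : M.IsOuterDart base) (t : ℕ) : M.IsOuterDart (M.corner base t) :=
  (outer_iff hb _).2 ⟨t, by simp [corner]⟩

/-- `outerLength` is the minimal period of `face` at `base`, so the corners below it enumerate the
external walk without repetition. -/
theorem exists_period (hb : M.IsOuterDart base) :
    M.corner base M.outerLength = base ∧
    (∀ s < M.outerLength, ∀ t < M.outerLength, M.corner base s = M.corner base t → s = t) ∧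
    (∀ d, M.IsOuterDart d → ∃ t < M.outerLength, M.corner base t = d) := by
  have hc : ∀ t, M.corner base t = M.face^[t] base := fun t => by
    rw [corner, Equiv.Perm.coe_pow]
  set n := Function.minimalPeriod M.face base with hn
  have hper : base ∈ Function.periodicPts M.face :=
    Function.Injective.mem_periodicPts M.face.injective base
  have hpos : 0 < n := Function.minimalPeriod_pos_of_mem_periodicPts hper
  have h1 : M.corner base n = base := by rw [hc]; exact Function.iterate_minimalPeriod
  have h2 : ∀ s < n, ∀ t < n, M.corner base s = M.corner base t → s = t := by
    intro s hs t ht h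
    rw [hc, hc] at h
    exact Function.iterate_injOn_Iio_minimalPeriod hs ht h
  have h3 : ∀ d, M.IsOuterDart d → ∃ t < n, M.corner base t = d := by
    intro d hd
    obtain ⟨i, hi⟩ := ((outer_iff hb d).1 hd).exists_nat_pow_eq
    refine ⟨i % n, Nat.mod_lt _ hpos, ?_⟩
    rw [hc, Function.iterate_mod_minimalPeriod_eq, ← hc]
    exact hi
  have h4 : M.outerLength = n := by
    rw [outerLength, ← Nat.card_fin n]
    symm
    apply Nat.card_eq_of_bijective
      (fun i : Fin n => (⟨M.corner base i, corner_outer hb i⟩ : {d // M.IsOuterDart d}))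
    constructor
    · intro i j h
      exact Fin.ext (h2 i i.2 j j.2 (Subtype.ext_iff.1 h))
    · rintro ⟨d, hd⟩
      obtain ⟨t, ht, h⟩ := h3 d hd
      exact ⟨⟨t, ht⟩, Subtype.ext h⟩
  rw [h4]
  exact ⟨h1, h2, h3⟩

/-- A facial walk of length one would be a loop. -/
theorem two_le_outerLength (hb : M.IsOuterDart base) : 2 ≤ M.outerLength := by
  obtain ⟨h1, h2, h3⟩ := exists_period hb
  obtain ⟨t, ht, -⟩ := h3 base hb
  by_contra h
  have h4 : M.outerLength = 1 := by omega
  rw [h4, show 1 = 0 + 1 from rfl, corner_succ, corner_zero] at h1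
  have := M.face_fst base
  rw [h1] at this
  exact base.fst_ne_snd this

/-- The cyclic interval `[lo, hi)`. -/
def Cyc (lo hi t : ℕ) : Prop := (lo < hi ∧ lo ≤ t ∧ t < hi) ∨ (hi < lo ∧ (lo ≤ t ∨ t < hi))

/-- A path with its extremal vertices placed at two different corners of the external face. -/
structure Region (M : PlaneGraph V) (base : M.G.Dart) where
  path : GPath M.G
  lo : ℕ
  hi : ℕ
  base_outer : M.IsOuterDart base
  lo_lt : lo < M.outerLength
  hi_lt : hi < M.outerLength
  ne : lo ≠ hi
  lo_fst : (M.corner base lo).fst = path.x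
  hi_fst : (M.corner base hi).fst = path.y

/-- The same path in the opposite direction; it cuts off the complementary region. -/
def Region.rev (u : Region M base) : Region M base where
  path := u.path.rev
  lo := u.hi
  hi := u.lo
  base_outer := u.base_outer
  lo_lt := u.hi_lt
  hi_lt := u.lo_lt
  ne := u.ne.symm
  lo_fst := u.hi_fst
  hi_fst := u.lo_fst

theorem Region.rev_rev (u : Region M base) : u.rev.rev = u := by
  obtain ⟨⟨w, hw⟩, _, _⟩ := u
  simp [rev, GPath.rev]

/-- `S` is the set of darts inside the region of `u`. -/
def IsSide (u : Region M base) (S : M.G.Dart → Prop) : Prop :=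
  (∀ d : M.G.Dart, (S d ↔ S d.symm) ↔ d.edge ∉ u.path.edges) ∧
  (∀ d, ¬ M.IsOuterDart d → (S (M.face d) ↔ S d)) ∧
  ∀ t < M.outerLength, (S (M.corner base t) ↔ Cyc u.lo u.hi t)

theorem IsSide.compl {u : Region M base} {S : M.G.Dart → Prop} (h : IsSide u S) :
    IsSide u.rev (fun d => ¬ S d) := by
  refine ⟨fun d => ?_, fun d hd => not_congr (h.2.1 d hd), fun t ht => ?_⟩
  · rw [not_iff_not, h.1 d]
    change _ ↔ d.edge ∉ u.path.rev.edges
    rw [u.path.rev_edges]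
  · change ¬ S _ ↔ _
    rw [h.2.2 t ht]
    have := u.ne
    change ¬ Cyc u.lo u.hi t ↔ Cyc u.hi u.lo t
    unfold Cyc
    omega

open Classical in
theorem sum_dart_edge [Fintype M.G.Dart] {a b v : V} (h : M.G.Adj a b) :
    (∑ d : M.G.Dart, if d.fst = v then (if d.edge = s(a, b) then (1 : ZMod 2) else 0) else 0) =
      (if a = v then 1 else 0) + (if b = v then 1 else 0) := by
  set d₀ : M.G.Dart := ⟨(a, b), h⟩ with hd
  have hfib : Finset.univ.filter (fun e : M.G.Dart => e.edge = s(a, b)) = {d₀, d₀.symm} := by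
    ext e
    rw [show s(a, b) = d₀.edge from rfl]
    simp [dart_edge_eq_iff]
  have : ∀ d : M.G.Dart, (if d.fst = v then (if d.edge = s(a, b) then (1 : ZMod 2) else 0) else 0) =
      if d.edge = s(a, b) then (if d.fst = v then 1 else 0) else 0 := by
    intro d; split_ifs <;> rfl
  rw [Finset.sum_congr rfl fun d _ => this d, ← Finset.sum_filter, hfib,
    Finset.sum_pair d₀.symm_ne.symm]
  rfl

-- Degrees mod 2 along a walk telescope, so only the two ends remain.
open Classical in
theorem sum_dart_walk [Fintype M.G.Dart] (f : ℕ → V) (v : V) {m n : ℕ} (hmn : m ≤ n)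
    (h : ∀ i, m ≤ i → i < n → M.G.Adj (f i) (f (i + 1))) :
    (∑ d : M.G.Dart, if d.fst = v then
        ∑ i ∈ Finset.Ico m n, (if d.edge = s(f i, f (i + 1)) then (1 : ZMod 2) else 0) else 0) =
      (if f m = v then 1 else 0) + (if f n = v then 1 else 0) := by
  induction n, hmn using Nat.le_induction with
  | base => simp [CharTwo.add_self_eq_zero]
  | succ n hmn ih =>
    have h1 := ih fun i hi hi' => h i hi (by omega)
    have h2 := sum_dart_edge (v := v) (h n hmn (by omega))
    have : ∀ d : M.G.Dart, (if d.fst = v then ∑ i ∈ Finset.Ico m (n + 1),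
          (if d.edge = s(f i, f (i + 1)) then (1 : ZMod 2) else 0) else 0) =
        (if d.fst = v then ∑ i ∈ Finset.Ico m n,
          (if d.edge = s(f i, f (i + 1)) then (1 : ZMod 2) else 0) else 0) +
        (if d.fst = v then (if d.edge = s(f n, f (n + 1)) then (1 : ZMod 2) else 0) else 0) := by
      intro d
      rw [Finset.sum_Ico_succ_top hmn]
      split_ifs <;> simp
    rw [Finset.sum_congr rfl fun d _ => this d, Finset.sum_add_distrib, h1, h2]
    rw [add_assoc, ← add_assoc (if f n = v then (1 : ZMod 2) else 0),
      CharTwo.add_self_eq_zero, zero_add]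

/-- The path and the boundary arc between its corners form an even edge set mod 2, hence bound a set
of faces. The external face needs a correction, since its darts are to be split by the arc instead
of lying all on one side. -/
theorem exists_side_of_lt (u : Region M base) (hlt : u.lo < u.hi) : ∃ S, IsSide u S := by
  classical
  have : Fintype M.G.Dart := Fintype.ofFinite _
  obtain ⟨hper, hinj, hex⟩ := exists_period u.base_outer
  set g : ℕ → V := fun t => (M.corner base t).fst with hg
  have hedge : ∀ t, (M.corner base t).edge = s(g t, g (t + 1)) := fun t => by
    rw [hg]; simp only; rw [corner_succ_fst]; rfl
  set c : Sym2 V → ZMod 2 := fun e =>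
    ∑ i ∈ Finset.Ico 0 u.path.len, (if e = s(u.path.vert i, u.path.vert (i + 1)) then 1 else 0) +
    ∑ t ∈ Finset.Ico u.lo u.hi, (if e = s(g t, g (t + 1)) then 1 else 0) with hcdef
  have hpath : ∀ e : Sym2 V, (∑ i ∈ Finset.Ico 0 u.path.len,
      (if e = s(u.path.vert i, u.path.vert (i + 1)) then (1 : ZMod 2) else 0)) =
      if e ∈ u.path.edges then 1 else 0 := by
    intro e
    split_ifs with he
    · obtain ⟨k, hk, rfl⟩ := GPath.mem_edges.1 he
      rw [Finset.sum_eq_single k, if_pos rfl]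
      · intro j hj hjk
        rw [Finset.mem_Ico] at hj
        rw [if_neg]
        intro h
        rcases Sym2.eq_iff.1 h with ⟨h1, -⟩ | ⟨h1, h2⟩
        · exact hjk (u.path.vert_inj hk.le hj.2.le h1).symm
        · have := u.path.vert_inj hk.le hj.2 h1
          have := u.path.vert_inj hk hj.2.le h2
          omega
      · intro h
        exact absurd (Finset.mem_Ico.2 ⟨Nat.zero_le _, hk⟩) h
    · apply Finset.sum_eq_zero
      intro i hi
      rw [if_neg]
      rintro rfl
      exact he (u.path.edge_mem (Finset.mem_Ico.1 hi).2)
  obtain ⟨h, hf, hs⟩ := M.exists_face_potential c (by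
    intro v
    have h1 := sum_dart_walk (M := M) u.path.vert v (Nat.zero_le u.path.len)
      fun i _ hi => u.path.adj hi
    have h2 := sum_dart_walk (M := M) g v hlt.le fun t _ _ => by
      rw [hg]; simp only; rw [corner_succ_fst]; exact (M.corner base t).adj
    have : ∀ d : M.G.Dart, (if d.fst = v then c d.edge else 0) =
        (if d.fst = v then ∑ i ∈ Finset.Ico 0 u.path.len,
          (if d.edge = s(u.path.vert i, u.path.vert (i + 1)) then 1 else 0) else 0) +
        (if d.fst = v then ∑ t ∈ Finset.Ico u.lo u.hi,
          (if d.edge = s(g t, g (t + 1)) then 1 else 0) else 0) := by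
      intro d; rw [hcdef]; split_ifs <;> simp
    have h3 : g u.lo = u.path.vert 0 := by rw [u.path.vert_zero, ← u.lo_fst]
    have h4 : g u.hi = u.path.vert u.path.len := by rw [u.path.vert_len, ← u.hi_fst]
    rw [Finset.sum_congr rfl fun d _ => this d, Finset.sum_add_distrib, h1, h2, h3, h4,
      CharTwo.add_self_eq_zero])
  set k : M.G.Dart → ZMod 2 := fun d =>
    ∑ t ∈ Finset.Ico u.lo u.hi, (if M.corner base t = d then 1 else 0) with hk
  have hkout : ∀ d, ¬ M.IsOuterDart d → k d = 0 := by
    intro d hd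
    apply Finset.sum_eq_zero
    intro t _
    rw [if_neg]
    rintro rfl
    exact hd (corner_outer u.base_outer t)
  have hkc : ∀ t < M.outerLength, k (M.corner base t) = if u.lo ≤ t ∧ t < u.hi then 1 else 0 := by
    intro t ht
    rw [hk]
    simp only
    split_ifs with h1
    · rw [Finset.sum_eq_single t, if_pos rfl]
      · intro s hs hst
        rw [Finset.mem_Ico] at hs
        rw [if_neg]
        intro h2
        exact hst (hinj s (hs.2.trans u.hi_lt) t ht h2)
      · intro h2
        exact absurd (Finset.mem_Ico.2 h1) h2
    · apply Finset.sum_eq_zero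
      intro s hs
      rw [Finset.mem_Ico] at hs
      rw [if_neg]
      intro h2
      rw [hinj s (hs.2.trans u.hi_lt) t ht h2] at hs
      exact h1 hs
  have hksum : ∀ d : M.G.Dart, k d + k d.symm =
      ∑ t ∈ Finset.Ico u.lo u.hi, (if d.edge = s(g t, g (t + 1)) then 1 else 0) := by
    intro d
    rw [hk]
    simp only
    rw [← Finset.sum_add_distrib]
    refine Finset.sum_congr rfl fun t _ => ?_
    rw [← hedge]
    have h3 : d.edge = (M.corner base t).edge ↔
        M.corner base t = d ∨ M.corner base t = d.symm := by
      rw [eq_comm, dart_edge_eq_iff]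
    by_cases h1 : M.corner base t = d
    · have h2 : M.corner base t ≠ d.symm := h1 ▸ d.symm_ne.symm
      rw [if_pos h1, if_neg h2, if_pos (h3.2 (Or.inl h1)), add_zero]
    · by_cases h2 : M.corner base t = d.symm
      · rw [if_neg h1, if_pos h2, if_pos (h3.2 (Or.inr h2)), zero_add]
      · rw [if_neg h1, if_neg h2, if_neg (by tauto), add_zero]
  have hbase : ∀ t, h (M.corner base t) = h base := by
    intro t
    induction t with
    | zero => rfl
    | succ t ih => rw [corner_succ, hf, ih]
  have aux : ∀ x y : ZMod 2, (x = 1 ↔ y = 1) ↔ x + y = 0 := by decide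
  -- Adding `h base` makes the potential vanish on the external face. Adding the indicator `k` of
  -- the arc moves exactly its darts inside, which cancels the arc from the boundary and leaves the
  -- path alone.
  refine ⟨fun d => h d + h base + k d = 1, fun d => ?_, fun d hd => ?_, fun t ht => ?_⟩
  · rw [aux]
    have : h d + h base + k d + (h d.symm + h base + k d.symm) =
        (h d + h d.symm) + (k d + k d.symm) + (h base + h base) := by ring
    rw [this, hs, hksum, CharTwo.add_self_eq_zero, add_zero, hcdef]
    simp only
    rw [hpath, add_assoc, CharTwo.add_self_eq_zero, add_zero]
    split_ifs with h1 <;> simp [h1]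
  · have : ¬ M.IsOuterDart (M.face d) := fun h' => hd (h'.trans ⟨-1, by simp⟩)
    change h _ + _ + k _ = 1 ↔ h _ + _ + k _ = 1
    rw [hf, hkout d hd, hkout _ this]
  · change h _ + _ + k _ = 1 ↔ _
    rw [hbase, CharTwo.add_self_eq_zero, zero_add, hkc t ht]
    unfold Cyc
    split_ifs with h1
    · simp [h1, hlt]
    · simp; omega

theorem exists_side (u : Region M base) : ∃ S, IsSide u S := by
  rcases Nat.lt_or_gt_of_ne u.ne with h | h
  · exact exists_side_of_lt u h
  · obtain ⟨S, hS⟩ := exists_side_of_lt u.rev h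
    exact ⟨_, u.rev_rev ▸ hS.compl⟩

/-- The darts on which both sides agree form a set invariant under reversal and facial steps that
contains the external face. -/
theorem IsSide.unique {u : Region M base} {S S' : M.G.Dart → Prop} (h : IsSide u S)
    (h' : IsSide u S') (d : M.G.Dart) : S d ↔ S' d := by
  obtain ⟨hper, hinj, hex⟩ := exists_period u.base_outer
  have hout : ∀ d, M.IsOuterDart d → (S d ↔ S' d) := by
    intro d hd
    obtain ⟨t, ht, rfl⟩ := hex d hd
    rw [h.2.2 t ht, h'.2.2 t ht]
  refine (M.dart_iff_of_invariant (fun d => (S d ↔ S' d)) (fun d => ?_) (fun d => ?_) d base).2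
    (hout base u.base_outer)
  · have h1 := h.1 d
    have h2 := h'.1 d
    tauto
  · by_cases hd : M.IsOuterDart d
    · have : M.IsOuterDart (M.face d) := hd.trans ⟨1, by simp⟩
      have h1 := hout _ hd
      have h2 := hout _ this
      tauto
    · rw [h.2.1 d hd, h'.2.1 d hd]

namespace Region

/-- The set of darts inside the region of `u`. -/
noncomputable def side (u : Region M base) : M.G.Dart → Prop := (exists_side u).choose

theorem isSide (u : Region M base) : IsSide u u.side := (exists_side u).choose_spec

theorem side_rev (u : Region M base) (d : M.G.Dart) : u.rev.side d ↔ ¬ u.side d :=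
  IsSide.unique u.rev.isSide u.isSide.compl d

theorem side_symm (u : Region M base) {d : M.G.Dart} (h : d.edge ∉ u.path.edges) :
    u.side d ↔ u.side d.symm := (u.isSide.1 d).2 h

theorem side_symm_of_mem (u : Region M base) {d : M.G.Dart} (h : d.edge ∈ u.path.edges) :
    u.side d ↔ ¬ u.side d.symm := by
  have := u.isSide.1 d
  tauto

theorem side_corner (u : Region M base) {t : ℕ} (ht : t < M.outerLength) :
    u.side (M.corner base t) ↔ Cyc u.lo u.hi t := u.isSide.2.2 t ht

theorem side_lo (u : Region M base) : u.side (M.corner base u.lo) := by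
  rw [u.side_corner u.lo_lt]
  have := u.ne
  unfold Cyc
  omega

theorem lo_fst' (u : Region M base) : (M.corner base u.lo).fst = u.path.vert 0 := by
  rw [u.lo_fst, u.path.vert_zero]

theorem hi_fst' (u : Region M base) : (M.corner base u.hi).fst = u.path.vert u.path.len := by
  rw [u.hi_fst, u.path.vert_len]

/-- The dart of the external face before the last corner of `u` is inside the region. -/
theorem exists_pred_hi (u : Region M base) : ∃ t < M.outerLength, Cyc u.lo u.hi t ∧
    (M.corner base t).snd = u.path.vert u.path.len := by
  rcases Nat.eq_zero_or_pos u.hi with h | h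
  · have h2 := two_le_outerLength u.base_outer
    refine ⟨M.outerLength - 1, by omega, ?_, ?_⟩
    · have := u.ne
      have := u.lo_lt
      unfold Cyc
      omega
    · rw [← corner_succ_fst, show M.outerLength - 1 + 1 = M.outerLength by omega,
        (exists_period u.base_outer).1, ← u.hi_fst', h, corner_zero]
  · refine ⟨u.hi - 1, by have := u.hi_lt; omega, ?_, ?_⟩
    · have := u.ne
      unfold Cyc
      omega
    · rw [← corner_succ_fst, show u.hi - 1 + 1 = u.hi by omega, u.hi_fst']

/-- `d.symm` and `rot d` are consecutive on a facial walk, and along facial walks the side changes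
only at the corners `lo` and `hi`. -/
theorem side_rot (u : Region M base) {d : M.G.Dart} (h1 : M.rot d ≠ M.corner base u.lo)
    (h2 : M.rot d ≠ M.corner base u.hi) : u.side (M.rot d) ↔ u.side d.symm := by
  rw [← M.face_symm] at h1 h2 ⊢
  by_cases hd : M.IsOuterDart d.symm
  · obtain ⟨hper, hinj, hex⟩ := exists_period u.base_outer
    obtain ⟨t, ht, hdt⟩ := hex _ hd
    rw [← hdt, ← corner_succ] at h1 h2 ⊢
    rw [u.side_corner ht]
    have hne := u.ne
    have hlo := u.lo_lt
    have hhi := u.hi_lt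
    rcases Nat.lt_or_eq_of_le ht with h3 | h3
    · rw [u.side_corner h3]
      have h4 : t + 1 ≠ u.lo := fun h => h1 (by rw [h])
      have h5 : t + 1 ≠ u.hi := fun h => h2 (by rw [h])
      unfold Cyc
      omega
    · rw [show t + 1 = M.outerLength from h3, hper] at h1 h2 ⊢
      have h4 : 0 ≠ u.lo := fun h => h1 (by rw [← h, corner_zero])
      have h5 : 0 ≠ u.hi := fun h => h2 (by rw [← h, corner_zero])
      have := u.side_corner (t := 0) (by omega)
      rw [corner_zero] at this
      rw [this]
      unfold Cyc
      omega
  · exact u.isSide.2.1 _ hd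

theorem not_side_of_rot_eq_lo (u : Region M base) {d : M.G.Dart}
    (h1 : M.rot d = M.corner base u.lo) : ¬ u.side d.symm := by
  rw [← M.face_symm] at h1
  obtain ⟨hper, hinj, hex⟩ := exists_period u.base_outer
  have hd : M.IsOuterDart d.symm := by
    have : M.IsOuterDart (M.face d.symm) := h1 ▸ corner_outer u.base_outer _
    exact this.trans ⟨-1, by simp⟩
  obtain ⟨t, ht, hdt⟩ := hex _ hd
  rw [← hdt, ← corner_succ] at h1
  rw [← hdt, u.side_corner ht]
  have hne := u.ne
  have hlo := u.lo_lt
  have hhi := u.hi_lt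
  rcases Nat.lt_or_eq_of_le ht with h3 | h3
  · have := hinj _ h3 _ hlo h1
    unfold Cyc
    omega
  · rw [show t + 1 = M.outerLength from h3, hper] at h1
    have := hinj 0 (by omega) _ hlo h1
    unfold Cyc
    omega

end Region

/-- The dart `d` is incident with `v`. -/
def Inc (d : M.G.Dart) (v : V) : Prop := d.fst = v ∨ d.snd = v

/-- The darts at `v` are one orbit of `rot`, and a rotation is a reversal followed by the passage
through a corner. Applied both to a single side and to the agreement of two sides. -/
theorem around (P : M.G.Dart → Prop) (v : V) (h1 : ∀ d : M.G.Dart, d.fst = v → (P d ↔ P d.symm))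
    (h2 : ∀ d : M.G.Dart, d.fst = v → (P d.symm ↔ P (M.rot d))) {d d' : M.G.Dart}
    (hd : Inc d v) (hd' : Inc d' v) : P d ↔ P d' := by
  have key : ∀ d d' : M.G.Dart, d.fst = v → d'.fst = v → (P d ↔ P d') := by
    intro d d' hd hd'
    obtain ⟨i, hi⟩ := (M.rot_cycle d d' (hd.trans hd'.symm)).exists_nat_pow_eq
    have : ∀ i, (((M.rot ^ i) d).fst = v) ∧ (P d ↔ P ((M.rot ^ i) d)) := by
      intro i
      induction i with
      | zero => exact ⟨hd, Iff.rfl⟩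
      | succ n ih =>
        rw [pow_succ', Equiv.Perm.mul_apply]
        refine ⟨by rw [M.rot_fst, ih.1], ?_⟩
        rw [ih.2, h1 _ ih.1, h2 _ ih.1]
    rw [(this i).2, hi]
  have key2 : ∀ d : M.G.Dart, d.snd = v → (P d ↔ P d.symm) := fun d hd => by
    have := h1 d.symm hd
    rw [Dart.symm_symm] at this
    exact this.symm
  rcases hd with hd | hd <;> rcases hd' with hd' | hd'
  · exact key d d' hd hd'
  · rw [key2 d' hd']; exact key _ _ hd hd'
  · rw [key2 d hd]; exact key _ _ hd hd'
  · rw [key2 d hd, key2 d' hd']; exact key _ _ hd hd'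

theorem exists_dart_fst (v : V) : ∃ d : M.G.Dart, d.fst = v := by
  obtain ⟨w⟩ := M.connected.preconnected v M.outer.fst
  by_cases h : v = M.outer.fst
  · exact ⟨M.outer, h.symm⟩
  · cases w with
    | nil => exact absurd rfl h
    | cons hadj _ => exact ⟨⟨(_, _), hadj⟩, rfl⟩

namespace Region

theorem side_const (u : Region M base) {v : V} (hv : v ∉ u.path.verts) {d d' : M.G.Dart}
    (hd : Inc d v) (hd' : Inc d' v) : u.side d ↔ u.side d' := by
  refine around u.side v (fun d h => ?_) (fun d h => ?_) hd hd'
  · exact u.side_symm fun he => hv (h ▸ GPath.left_mem_verts (u := d.fst) (v := d.snd) he)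
  · have hfst : (M.rot d).fst = v := by rw [M.rot_fst, h]
    refine (u.side_rot (fun he => hv ?_) (fun he => hv ?_)).symm
    · rw [← hfst, he, u.lo_fst']; exact u.path.vert_mem _
    · rw [← hfst, he, u.hi_fst']; exact u.path.vert_mem _

/-- The arcs of the regions `a` and `b` share no edge. -/
def Disj (a b : Region M base) : Prop :=
  ∀ t < M.outerLength, Cyc a.lo a.hi t → ¬ Cyc b.lo b.hi t

theorem Disj.symm {a b : Region M base} (h : Disj a b) : Disj b a :=
  fun t ht h1 h2 => h t ht h2 h1

/-- By contiguity the part of `a` before `v` or the part after `v` avoids `b`. Along that part the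
side of `b` does not change, and at its end on the external face it is decided by the disjoint arcs.
-/
theorem not_side_of_disj {a b : Region M base} (h : Disj a b)
    (hc : GPath.Contig a.path b.path) {v : V} (hva : v ∈ a.path.verts) (hvb : v ∉ b.path.verts)
    {d : M.G.Dart} (hd : Inc d v) : ¬ b.side d := by
  obtain ⟨i, hi, rfl⟩ := GPath.mem_verts.1 hva
  have hlo : a.path.vert 0 ∉ b.path.verts → ∀ d : M.G.Dart, Inc d (a.path.vert 0) →
      ¬ b.side d := by
    intro h0 d hd
    rw [b.side_const h0 hd (Or.inl a.lo_fst'), b.side_corner a.lo_lt]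
    refine h _ a.lo_lt ?_
    rw [← a.side_corner a.lo_lt]
    exact a.side_lo
  have hhi : a.path.vert a.path.len ∉ b.path.verts →
      ∀ d : M.G.Dart, Inc d (a.path.vert a.path.len) → ¬ b.side d := by
    intro h0 d hd
    obtain ⟨t, ht, h1, h2⟩ := a.exists_pred_hi
    rw [b.side_const h0 hd (Or.inr h2), b.side_corner ht]
    exact h _ ht h1
  by_cases hex : ∃ k ≤ i, a.path.vert k ∈ b.path.verts
  · obtain ⟨k, hk, hkb⟩ := hex
    have hout : ∀ m, m ≤ a.path.len → i ≤ m → a.path.vert m ∉ b.path.verts := by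
      intro m hm him hmb
      exact hvb (hc.vert hm hkb hmb hk him)
    have : ∀ n, n ≤ a.path.len - i → ∀ d : M.G.Dart, Inc d (a.path.vert (a.path.len - n)) →
        ¬ b.side d := by
      intro n
      induction n with
      | zero => exact fun _ => hhi (hout _ le_rfl hi)
      | succ n ih =>
        intro hn d hd
        have h1 : a.path.len - (n + 1) < a.path.len := by omega
        rw [b.side_const (hout _ (by omega) (by omega)) hd
          (d' := a.path.dart (a.path.len - (n + 1)) h1) (Or.inl rfl)]
        refine ih (by omega) _ (Or.inr ?_)
        change a.path.vert _ = _
        congr 1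
        omega
    refine this (a.path.len - i) le_rfl d ?_
    rwa [show a.path.len - (a.path.len - i) = i by omega]
  · push Not at hex
    have : ∀ n, n ≤ i → ∀ d : M.G.Dart, Inc d (a.path.vert n) → ¬ b.side d := by
      intro n
      induction n with
      | zero => exact fun _ => hlo (hex 0 (Nat.zero_le _))
      | succ n ih =>
        intro hn d hd
        rw [b.side_const (hex _ hn) hd (d' := a.path.dart n (by omega)) (Or.inr rfl)]
        exact ih (by omega) _ (Or.inl rfl)
    exact this i le_rfl d hd

theorem not_side_of_edge {a b : Region M base} (h : Disj a b)
    (hc : GPath.Contig a.path b.path) {d : M.G.Dart} (ha : d.edge ∈ a.path.edges)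
    (hb : d.edge ∉ b.path.edges) : ¬ b.side d := by
  by_cases h1 : d.fst ∈ b.path.verts
  · by_cases h2 : d.snd ∈ b.path.verts
    · exact absurd (hc.edge ha h1 h2) hb
    · exact not_side_of_disj h hc (GPath.right_mem_verts ha) h2 (Or.inr rfl)
  · exact not_side_of_disj h hc (GPath.left_mem_verts ha) h1 (Or.inl rfl)

end Region

/-- A set of darts that is bounded by edges of a path and misses a dart is empty. -/
theorem forall_not_of_flip (T : M.G.Dart → Prop) (p : GPath M.G)
    (hface : ∀ d, T (M.face d) ↔ T d)
    (hflip : ∀ d : M.G.Dart, d.edge ∉ p.edges → (T d ↔ T d.symm)) {d₀ : M.G.Dart} (h₀ : ¬ T d₀)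
    (d : M.G.Dart) : ¬ T d := by
  -- At vertex `i` of `p` the rotation respects `T` at every dart except possibly dart `i`: the
  -- previous edge of `p` is covered by induction, the edges off `p` by `hflip`. By `perm_apply_iff`
  -- it respects `T` there too.
  have hpath : ∀ i, (hi : i < p.len) → (T (p.dart i hi) ↔ T (p.dart i hi).symm) := by
    intro i
    induction i using Nat.strong_induction_on with
    | _ i ih =>
    intro hi
    set v := p.vert i with hv
    have := perm_apply_iff M.rot (fun d => T d ∧ d.fst = v) (p.dart i hi) (by
      intro d hd
      rw [M.rot_fst]
      refine and_congr_left fun hdv => ?_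
      rw [← M.face_symm, hface]
      by_cases he : d.edge ∈ p.edges
      · have he' : s(p.vert i, d.snd) ∈ p.edges := by
          rw [← hv, ← hdv]; exact he
        rcases (GPath.edge_vert_iff hi.le).1 he' with ⟨-, h2⟩ | ⟨h1, h2⟩
        · exact absurd (Dart.ext _ _ (Prod.ext hdv h2)) hd
        · have h3 := ih (i - 1) (by omega) (by omega)
          have h4 : (p.dart (i - 1) (by omega)).symm = d := by
            refine Dart.ext _ _ (Prod.ext ?_ h2.symm)
            change p.vert (i - 1 + 1) = d.fst
            rw [Nat.sub_add_cancel h1, hdv]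
          rw [← h4, Dart.symm_symm]
          exact h3
      · exact (hflip d he).symm)
    rw [M.rot_fst, ← M.face_symm, hface] at this
    have h1 : (p.dart i hi).fst = v := rfl
    tauto
  have hsymm : ∀ d : M.G.Dart, T d ↔ T d.symm := by
    intro d
    by_cases he : d.edge ∈ p.edges
    · obtain ⟨k, hk, h⟩ := GPath.mem_edges.1 he
      rcases (dart_edge_eq_iff d (p.dart k hk)).1 h with rfl | rfl
      · exact hpath k hk
      · rw [Dart.symm_symm]; exact (hpath k hk).symm
    · exact hflip d he
  rw [M.dart_iff_of_invariant T hsymm hface d d₀]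
  exact h₀

namespace Region

/-- The path of `R` has no edge inside `l`, so the intersection of the two regions is bounded by
edges of `l` alone. It misses the external face, and a single path encloses nothing
(`forall_not_of_flip`). -/
theorem not_side_and_side {R l : Region M base} (h : Disj R l)
    (hR : ∀ d : M.G.Dart, d.edge ∈ R.path.edges → d.edge ∉ l.path.edges → ¬ l.side d)
    (d : M.G.Dart) : ¬ (R.side d ∧ l.side d) := by
  have hout : ∀ d, M.IsOuterDart d → ¬ (R.side d ∧ l.side d) := by
    intro d hd
    obtain ⟨t, ht, rfl⟩ := (exists_period R.base_outer).2.2 d hd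
    rw [R.side_corner ht, l.side_corner ht]
    exact fun h' => h t ht h'.1 h'.2
  refine forall_not_of_flip (fun d => R.side d ∧ l.side d) l.path (fun d => ?_) (fun d hd => ?_)
    (hout base R.base_outer) d
  · by_cases hd : M.IsOuterDart d
    · have : M.IsOuterDart (M.face d) := hd.trans ⟨1, by simp⟩
      exact iff_of_false (hout _ this) (hout _ hd)
    · rw [R.isSide.2.1 d hd, l.isSide.2.1 d hd]
  · have h1 := l.side_symm hd
    by_cases he : d.edge ∈ R.path.edges
    · have h2 := hR d he hd
      tauto
    · have h2 := R.side_symm he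
      tauto

theorem side_disj {a b : Region M base} (h : Disj a b) (hc : GPath.Contig a.path b.path)
    (d : M.G.Dart) : ¬ (a.side d ∧ b.side d) :=
  not_side_and_side h (fun _ h1 h2 => not_side_of_edge h hc h1 h2) d

/-- This fixes the orientation: the inside of a path is on the side of its forward darts. If dart
`i` were the first one outside, its reverse would be inside, and the rotation at its tail would map
the inside darts there into themselves while also sending an outside dart, dart `i`, to an inside
one. This is impossible for a permutation of a finite set. -/
theorem side_dart (a : Region M base) : ∀ i, (hi : i < a.path.len) → a.side (a.path.dart i hi) := by
  intro i
  induction i using Nat.strong_induction_on with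
  | _ i ih =>
  intro hi
  by_contra hcon
  set d := a.path.dart i hi with hd
  set v := a.path.vert i with hv
  have hsymm : a.side d.symm := by
    have := a.side_symm_of_mem (d := d) (a.path.edge_mem hi)
    tauto
  have hrot : ∀ d' : M.G.Dart, d'.fst = v → a.side d'.symm → a.side (M.rot d') := by
    intro d' h1 h2
    by_cases h3 : M.rot d' = M.corner base a.lo
    · rw [h3]; exact a.side_lo
    · refine (a.side_rot h3 fun h4 => ?_).2 h2
      have h5 : (M.rot d').fst = v := by rw [M.rot_fst, h1]
      rw [h4, a.hi_fst'] at h5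
      have := a.path.vert_inj le_rfl hi.le h5
      omega
  have hmaps : Set.MapsTo M.rot {d' | d'.fst = v ∧ a.side d'} {d' | d'.fst = v ∧ a.side d'} := by
    rintro d' ⟨h1, h2⟩
    refine ⟨by rw [M.rot_fst, h1], hrot d' h1 ?_⟩
    by_cases he : d'.edge ∈ a.path.edges
    · have he' : s(a.path.vert i, d'.snd) ∈ a.path.edges := by
        rw [← hv, ← h1]; exact he
      rcases (GPath.edge_vert_iff hi.le).1 he' with ⟨-, h3⟩ | ⟨h3, h4⟩
      · have : d' = d := Dart.ext _ _ (Prod.ext h1 h3)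
        exact absurd (this ▸ h2) hcon
      · have h5 := ih (i - 1) (by omega) (by omega)
        have h6 : (a.path.dart (i - 1) (by omega)).symm = d' := by
          refine Dart.ext _ _ (Prod.ext ?_ h4.symm)
          change a.path.vert (i - 1 + 1) = d'.fst
          rw [Nat.sub_add_cancel h3, h1]
        rw [← h6, Dart.symm_symm]
        exact h5
    · exact (a.side_symm he).1 h2
  have := Equiv.Perm.perm_symm_mapsTo_of_mapsTo M.rot hmaps
    (show M.rot d ∈ _ from ⟨by rw [M.rot_fst]; rfl, hrot d rfl hsymm⟩)
  rw [Equiv.symm_apply_apply] at this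
  exact hcon this.2

theorem exists_inc_side (b : Region M base) {v : V} (hv : v ∈ b.path.verts) :
    ∃ d, Inc d v ∧ b.side d := by
  obtain ⟨k, hk, rfl⟩ := GPath.mem_verts.1 hv
  rcases Nat.lt_or_eq_of_le hk with h | rfl
  · exact ⟨b.path.dart k h, Or.inl rfl, b.side_dart k h⟩
  · obtain ⟨t, ht, h1, h2⟩ := b.exists_pred_hi
    exact ⟨_, Or.inr h2, (b.side_corner ht).2 h1⟩

/-- A dart run through forwards by both paths would be inside both regions. -/
theorem not_same_direction {a b : Region M base} (h : Disj a b)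
    (hc : GPath.Contig a.path b.path) {i j : ℕ} (hi : i < a.path.len) (hj : j < b.path.len)
    (h1 : a.path.vert i = b.path.vert j) (h2 : a.path.vert (i + 1) = b.path.vert (j + 1)) :
    False := by
  have : a.path.dart i hi = b.path.dart j hj := Dart.ext _ _ (Prod.ext h1 h2)
  exact side_disj h hc (a.path.dart i hi) ⟨a.side_dart i hi, this ▸ b.side_dart j hj⟩

/-- Disjoint regions run through their common vertices in opposite directions. -/
theorem opposite {a b : Region M base} (h : Disj a b)
    (hc : GPath.Contig a.path b.path) {i j α β : ℕ} (hij : i < j) (hj : j ≤ a.path.len)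
    (hα : α ≤ b.path.len) (hβ : β ≤ b.path.len) (h1 : a.path.vert i = b.path.vert α)
    (h2 : a.path.vert j = b.path.vert β) : β < α := by
  obtain ⟨γ, hγ, ⟨h3, h4⟩ | ⟨h3, h4⟩⟩ := hc.exists_match hij.le hj (h1 ▸ b.path.vert_mem α)
    (h2 ▸ b.path.vert_mem β)
  · exact (not_same_direction h hc (show i < a.path.len by omega) (show γ < b.path.len by omega)
      (h4 0 (by omega)) (h4 1 (by omega))).elim
  · have h5 := h4 0 (by omega)
    have h6 := h4 (j - i) le_rfl
    rw [show i + (j - i) = j by omega, h2] at h6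
    rw [add_zero, Nat.sub_zero, h1] at h5
    have h7 := b.path.vert_inj hα hγ h5
    have h8 := b.path.vert_inj hβ (by omega) h6
    omega

/-- If `q` separates `c` from `r`, then it contains their common vertices. -/
theorem mem_of_separates {c q r : Region M base} (hc : Disj c q.rev) (hr : Disj r q)
    (hcq : GPath.Contig c.path q.path) (hrq : GPath.Contig r.path q.path) {v : V}
    (hvc : v ∈ c.path.verts) (hvr : v ∈ r.path.verts) : v ∈ q.path.verts := by
  by_contra hv
  obtain ⟨d, hd⟩ := exists_dart_fst (M := M) v
  have h1 := not_side_of_disj hr hrq hvr hv (d := d) (Or.inl hd)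
  have h2 := not_side_of_disj hc hcq.rev_right hvc (d := d)
    (by change v ∉ q.path.rev.verts; rwa [q.path.rev_verts]) (Or.inl hd)
  rw [q.side_rev] at h2
  exact h2 h1

end Region

end PlaneGraph

/-! ### Order of contacts along a path, and crossings. -/

namespace PlaneGraph

variable {V : Type*} [Finite V] {M : PlaneGraph V} {base : M.G.Dart}

namespace Region

theorem Disj.lo_ne {a b : Region M base} (h : Disj a b) : a.lo ≠ b.lo := by
  intro he
  have h1 := (a.side_corner a.lo_lt).1 a.side_lo
  refine h _ a.lo_lt h1 ?_
  rw [he, ← b.side_corner b.lo_lt]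
  exact b.side_lo

/-- From the start of `a` along `a` to its last vertex on `c`, and from there back to the
start of `c`. -/
theorem exists_cross {a c : Region M base} (h : Disj a c) (hc : GPath.Contig a.path c.path)
    {j : ℕ} (hj : j ≤ a.path.len) (hjc : a.path.vert j ∈ c.path.verts) :
    ∃ (R : Region M base) (n γ : ℕ), j ≤ n ∧ n ≤ a.path.len ∧ γ ≤ c.path.len ∧
      a.path.vert n = c.path.vert γ ∧ (∀ k, n < k → k ≤ a.path.len → a.path.vert k ∉ c.path.verts) ∧
      (∀ k < γ, c.path.vert k ∉ a.path.verts) ∧ R.lo = a.lo ∧ R.hi = c.lo ∧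
      R.path.len = n + γ ∧ (∀ i ≤ n, R.path.vert i = a.path.vert i) ∧
      ∀ k ≤ γ, R.path.vert (n + k) = c.path.vert (γ - k) := by
  classical
  have hex : ∃ m, m ≤ a.path.len ∧ a.path.vert (a.path.len - m) ∈ c.path.verts :=
    ⟨a.path.len - j, by omega, by rwa [show a.path.len - (a.path.len - j) = j by omega]⟩
  set n := a.path.len - Nat.find hex with hn
  have hn1 := Nat.find_spec hex
  rw [← hn] at hn1
  have hmax : ∀ k, n < k → k ≤ a.path.len → a.path.vert k ∉ c.path.verts := by
    intro k hk hka hkc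
    have := Nat.find_min' hex (m := a.path.len - k)
      ⟨by omega, by rwa [show a.path.len - (a.path.len - k) = k by omega]⟩
    omega
  have hjn : j ≤ n := by
    by_contra hlt
    exact hmax j (by omega) hj hjc
  obtain ⟨γ, hγ, hγn⟩ := GPath.mem_verts.1 hn1.2
  have hnle : n ≤ a.path.len := by omega
  -- `a` and `c` run through common vertices in opposite directions, so a contact earlier on `c`
  -- would be later on `a` than the last one.
  have hca : ∀ k < γ, c.path.vert k ∉ a.path.verts := by
    intro k hk hka
    obtain ⟨m, hm, hmk⟩ := GPath.mem_verts.1 hka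
    have h1 := opposite h.symm hc.symm hk hγ hm hnle hmk.symm hγn
    exact hmax m h1 hm (hmk ▸ c.path.vert_mem k)
  obtain ⟨p, hp, hv⟩ := GPath.exists_of_fun (G := M.G)
    (fun i => if i ≤ n then a.path.vert i else c.path.vert (γ - (i - n))) (n + γ) (by
      intro i hi
      by_cases h1 : i + 1 ≤ n
      · simp only [h1, show i ≤ n by omega, if_true]
        exact a.path.adj (by omega)
      · by_cases h2 : i ≤ n
        · obtain rfl : i = n := by omega
          simp only [h1, le_refl, if_true, if_false]
          rw [← hγn]
          have := (c.path.adj (i := γ - 1) (by omega)).symm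
          rw [show γ - 1 + 1 = γ by omega] at this
          rwa [show γ - (n + 1 - n) = γ - 1 by omega]
        · simp only [h1, h2, if_false]
          have := (c.path.adj (i := γ - (i + 1 - n)) (by omega)).symm
          rwa [show γ - (i + 1 - n) + 1 = γ - (i - n) by omega] at this) (by
      intro i hi k hk
      by_cases h1 : i ≤ n <;> by_cases h2 : k ≤ n <;> simp only [h1, h2, if_true, if_false]
      · exact a.path.vert_inj (by omega) (by omega)
      · intro he
        exact absurd (he ▸ a.path.vert_mem i) (hca (γ - (k - n)) (by omega))
      · intro he
        exact absurd (he ▸ a.path.vert_mem k) (hca (γ - (i - n)) (by omega))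
      · intro he
        have := c.path.vert_inj (by omega) (by omega) he
        omega)
  have hv1 : ∀ i ≤ n, p.vert i = a.path.vert i := fun i hi => by
    rw [hv i (by omega), if_pos hi]
  have hv2 : ∀ k ≤ γ, p.vert (n + k) = c.path.vert (γ - k) := fun k hk => by
    rw [hv (n + k) (by omega)]
    rcases Nat.eq_zero_or_pos k with rfl | h1
    · simp [hγn]
    · rw [if_neg (by omega), show n + k - n = k by omega]
  refine ⟨⟨p, a.lo, c.lo, a.base_outer, a.lo_lt, c.lo_lt, h.lo_ne, ?_, ?_⟩, n, γ, hjn, hnle, hγ,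
    hγn.symm, hmax, hca, rfl, rfl, hp, hv1, hv2⟩
  · rw [a.lo_fst', ← hv1 0 (Nat.zero_le _), p.vert_zero]
  · rw [c.lo_fst', ← p.vert_len, hp, hv2 γ le_rfl, Nat.sub_self]

/-- The order of the intersections with `b` and `c` along `a`, for regions `a`, `b`, `c` that
follow one another around the external face. -/
theorem order {a b c : Region M base} (hab : Disj a b) (hac : Disj a c) (hbc : Disj b c)
    (harc : ∀ t < M.outerLength, Cyc b.lo b.hi t → Cyc a.lo c.lo t)
    (cab : GPath.Contig a.path b.path) (cac : GPath.Contig a.path c.path)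
    (cbc : GPath.Contig b.path c.path) {i j : ℕ} (hi : i ≤ a.path.len)
    (hib : a.path.vert i ∈ b.path.verts) (hj : j ≤ a.path.len)
    (hjc : a.path.vert j ∈ c.path.verts) : j ≤ i := by
  by_contra hlt
  -- Suppose that `a` meets `b` before it meets `c`. The path `R` follows `a` to its last vertex on
  -- `c` and returns to the start of `c`; its arc contains the arc of `b`.
  obtain ⟨R, n, γ, hjn, hna, hγ, hnγ, hmax, hca, hRlo, hRhi, hRlen, hR1, hR2⟩ :=
    exists_cross hac cac hj hjc
  have hRedge : ∀ d : M.G.Dart, d.edge ∈ R.path.edges → d.edge ∈ a.path.edges ∨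
      d.edge ∈ c.path.edges := by
    intro d hd
    obtain ⟨k, hk, he⟩ := GPath.mem_edges.1 hd
    rw [he]
    by_cases h1 : k + 1 ≤ n
    · rw [hR1 k (by omega), hR1 _ h1]
      exact Or.inl (a.path.edge_mem (by omega))
    · right
      have e1 := hR2 (k - n) (by omega)
      have e2 := hR2 (k - n + 1) (by omega)
      rw [show n + (k - n) = k by omega] at e1
      rw [show n + (k - n + 1) = k + 1 by omega] at e2
      rw [e1, e2, Sym2.eq_swap, show γ - (k - n) = γ - (k - n + 1) + 1 by omega]
      exact c.path.edge_mem (by omega)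
  -- `R` is made of edges of `a` and `c`, and these never enter the region of `b`; hence that region
  -- lies inside `R`.
  have hsub : ∀ d, b.side d → R.side d := by
    intro d hd
    have := not_side_and_side (R := R.rev) (l := b) (by
      intro t ht h1 h2
      have h3 := harc t ht h2
      have h4 := R.ne
      change Cyc R.hi R.lo t at h1
      rw [hRlo, hRhi] at h1 h4
      unfold Cyc at h1 h3
      omega) (by
      intro d hd hdb
      change d.edge ∈ R.path.rev.edges at hd
      rw [R.path.rev_edges] at hd
      rcases hRedge d hd with h1 | h1
      · exact not_side_of_edge hab cab h1 hdb
      · exact not_side_of_edge hbc.symm cbc.symm h1 hdb) d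
    rw [R.side_rev] at this
    tauto
  have hin : i < n := by omega
  -- Before index `n` the paths `a` and `R` coincide, so around vertex `i` their sides are equal or
  -- complementary. The forward dart, inside both, rules out the second case. Then a dart of the
  -- region of `b` at this vertex is inside `R`, hence inside `a`: a contradiction.
  have hagree : ∀ d d' : M.G.Dart, Inc d (a.path.vert i) → Inc d' (a.path.vert i) →
      ((R.side d ↔ a.side d) ↔ (R.side d' ↔ a.side d')) := by
    intro d d' hd hd'
    refine around (fun d => (R.side d ↔ a.side d)) (a.path.vert i) (fun d h1 => ?_)
      (fun d h1 => ?_) hd hd'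
    · have he : d.edge ∈ R.path.edges ↔ d.edge ∈ a.path.edges := by
        have e1 : d.edge = s(a.path.vert i, d.snd) := by rw [← h1]; rfl
        rw [e1, GPath.edge_vert_iff hi, ← hR1 i hin.le, GPath.edge_vert_iff (by omega),
          hR1 (i + 1) (by omega), hR1 (i - 1) (by omega)]
        have e2 : i < a.path.len := by omega
        have e3 : i < R.path.len := by omega
        simp only [e2, e3]
      by_cases h2 : d.edge ∈ a.path.edges
      · have := R.side_symm_of_mem (he.2 h2)
        have := a.side_symm_of_mem h2
        tauto
      · have := R.side_symm (fun h => h2 (he.1 h))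
        have := a.side_symm h2
        tauto
    · have hfst : (M.rot d).fst = a.path.vert i := by rw [M.rot_fst, h1]
      have n1 : M.rot d ≠ M.corner base a.hi := by
        intro h2
        rw [h2, a.hi_fst'] at hfst
        have := a.path.vert_inj le_rfl hi hfst
        omega
      have n2 : M.rot d ≠ M.corner base R.hi := by
        intro h2
        rw [h2, R.hi_fst', ← hR1 i hin.le] at hfst
        have := R.path.vert_inj le_rfl (by omega) hfst
        omega
      by_cases h2 : M.rot d = M.corner base a.lo
      · have e1 := a.not_side_of_rot_eq_lo h2
        have e2 := R.not_side_of_rot_eq_lo (d := d) (by rw [hRlo, h2])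
        have e3 := a.side_lo
        have e4 := R.side_lo
        rw [hRlo, ← h2] at e4
        rw [← h2] at e3
        tauto
      · have e1 := a.side_rot h2 n1
        have e2 := R.side_rot (d := d) (by rwa [hRlo]) n2
        tauto
  obtain ⟨d, hd, hdb⟩ := b.exists_inc_side hib
  have h1 := (hagree d (a.path.dart i (by omega)) hd (Or.inl rfl)).2 (by
    have e1 := a.side_dart i (by omega)
    have e2 := R.side_dart i (by omega)
    have e3 : R.path.dart i (by omega) = a.path.dart i (by omega) :=
      Dart.ext _ _ (Prod.ext (hR1 i hin.le) (hR1 (i + 1) hin))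
    rw [e3] at e2
    exact iff_of_true e2 e1)
  exact side_disj hab cab d ⟨h1.1 (hsub d hdb), hdb⟩

/-- Turning around an inner vertex of the path, the side changes only after the forward dart, to the
outside, and after the dart back to the previous vertex, to the inside. -/
theorem between_iff (X : Region M base) {m : ℕ} (h0 : 0 < m) (hm : m < X.path.len) {w : V}
    (hw : M.G.Adj (X.path.vert m) w) (h1 : w ≠ X.path.vert (m + 1))
    (h2 : w ≠ X.path.vert (m - 1)) :
    M.Between (X.path.vert m) (X.path.vert (m + 1)) w (X.path.vert (m - 1)) ↔
      ¬ X.side ⟨(X.path.vert m, w), hw⟩ := by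
  classical
  set o := X.path.dart m hm with ho
  set r := (X.path.dart (m - 1) (by omega)).symm with hr
  have hrfst : r.fst = X.path.vert m := by
    change X.path.vert (m - 1 + 1) = _
    rw [Nat.sub_add_cancel h0]
  have hfst : ∀ n, ((M.rot ^ n) o).fst = X.path.vert m := by
    intro n
    induction n with
    | zero => rfl
    | succ n ih => rw [pow_succ', Equiv.Perm.mul_apply, M.rot_fst, ih]
  have hoside : X.side o := X.side_dart m hm
  have hrside : ¬ X.side r := by
    have := X.side_dart (m - 1) (by omega)
    rwa [X.side_symm_of_mem (d := X.path.dart (m - 1) (by omega))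
      (X.path.edge_mem (by omega))] at this
  have hrot : ∀ d : M.G.Dart, d.fst = X.path.vert m → (X.side (M.rot d) ↔ X.side d.symm) := by
    intro d hd
    have hf : (M.rot d).fst = X.path.vert m := by rw [M.rot_fst, hd]
    apply X.side_rot
    · intro h3
      rw [h3, X.lo_fst'] at hf
      have := X.path.vert_inj (Nat.zero_le _) hm.le hf
      omega
    · intro h3
      rw [h3, X.hi_fst'] at hf
      have := X.path.vert_inj le_rfl hm.le hf
      omega
  have hother : ∀ d : M.G.Dart, d.fst = X.path.vert m → d ≠ o → d ≠ r →
      (X.side (M.rot d) ↔ X.side d) := by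
    intro d hd hdo hdr
    rw [hrot d hd]
    refine (X.side_symm fun he => ?_).symm
    have he' : s(X.path.vert m, d.snd) ∈ X.path.edges := by rw [← hd]; exact he
    rcases (GPath.edge_vert_iff hm.le).1 he' with ⟨-, h3⟩ | ⟨-, h3⟩
    · exact hdo (Dart.ext _ _ (Prod.ext hd h3))
    · exact hdr (Dart.ext _ _ (Prod.ext (hd.trans hrfst.symm) h3))
  constructor
  · rintro ⟨h, i, hi, hiw, hj⟩
    have key : ∀ n, 0 < n → n ≤ i → ¬ X.side ((M.rot ^ n) o) := by
      intro n
      induction n with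
      | zero => exact fun h => absurd h (lt_irrefl _)
      | succ n ih =>
        intro _ hn
        rw [pow_succ', Equiv.Perm.mul_apply]
        rcases Nat.eq_zero_or_pos n with rfl | hpos
        · rw [pow_zero, Equiv.Perm.one_apply, hrot o rfl]
          exact (X.side_symm_of_mem (d := o) (X.path.edge_mem hm)).1 hoside
        · have h3 := ih hpos (by omega)
          rw [hother _ (hfst n) (fun h4 => h3 (by rw [h4]; exact hoside)) (fun h4 => hj n (by omega) ?_)]
          · exact h3
          · change ((M.rot ^ n) o).snd = _
            rw [h4]
            rfl
    have h3 := key i hi le_rfl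
    have h4 : (M.rot ^ i) o = ⟨(X.path.vert m, w), hw⟩ := Dart.ext _ _ (Prod.ext (hfst i) hiw)
    rwa [h4] at h3
  · intro hside
    have hex : ∃ i, (M.rot ^ i) o = ⟨(X.path.vert m, w), hw⟩ :=
      (M.rot_cycle o ⟨(X.path.vert m, w), hw⟩ rfl).exists_nat_pow_eq
    set i := Nat.find hex with hi
    have hispec := Nat.find_spec hex
    rw [← hi] at hispec
    refine ⟨X.path.adj hm, i, ?_, ?_, ?_⟩
    · by_contra h3
      rw [show i = 0 by omega] at hispec
      exact h1 (congrArg (fun d : M.G.Dart => d.snd) hispec).symm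
    · exact congrArg (fun d : M.G.Dart => d.snd) hispec
    · intro j hj hjr
      have hjr' : (M.rot ^ j) o = r := Dart.ext _ _ (Prod.ext ((hfst j).trans hrfst.symm) hjr)
      have hji : j ≠ i := by
        rintro rfl
        rw [hispec] at hjr'
        exact h2 (congrArg (fun d : M.G.Dart => d.snd) hjr')
      have key : ∀ n, j + 1 + n ≤ i → X.side ((M.rot ^ (j + 1 + n)) o) := by
        intro n
        induction n with
        | zero =>
          intro _
          rw [add_zero, pow_succ', Equiv.Perm.mul_apply, hjr', hrot r hrfst, hr,
            Dart.symm_symm]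
          exact X.side_dart _ _
        | succ n ih =>
          intro hn
          have h3 := ih (by omega)
          rw [← add_assoc, pow_succ', Equiv.Perm.mul_apply,
            hother _ (hfst _) (fun h4 => ?_) (fun h4 => hrside (h4 ▸ h3))]
          · exact h3
          · have h5 : i - (j + 1 + n) < i := by omega
            refine Nat.find_min hex (m := i - (j + 1 + n)) h5 ?_
            have h6 : (M.rot ^ (i - (j + 1 + n) + (j + 1 + n))) o =
                (M.rot ^ (i - (j + 1 + n))) o := by
              rw [pow_add, Equiv.Perm.mul_apply, h4]
            rw [← h6, Nat.sub_add_cancel (by omega)]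
            exact hispec
      have h3 := key (i - (j + 1)) (by omega)
      rw [show j + 1 + (i - (j + 1)) = i by omega, hispec] at h3
      exact hside h3

/-- The edges by which `q` arrives at and leaves a common stretch are off `X`, hence on the same
side of it, and `between_iff` translates this. -/
theorem not_crossesAlong (X : Region M base) (q : GPath M.G) (P : Prop)
    (h : ∀ d : M.G.Dart, d.edge ∈ q.edges → d.edge ∉ X.path.edges → (X.side d ↔ P)) :
    ¬ M.CrossesAlong X.path.walk q.walk := by
  rintro ⟨i, j, k, hi, hj, heq, n1, n2, n3, n4, hb⟩
  apply hb
  have hi' : i + 1 + k < X.path.len := hi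
  have hj' : j + 1 + k < q.len := hj
  have heq' : ∀ t ≤ k, X.path.vert (i + 1 + t) = q.vert (j + 1 + t) := heq
  have e1 : X.path.vert (i + 1) = q.vert (j + 1) := heq' 0 (Nat.zero_le _)
  have e2 : X.path.vert (i + 1 + k) = q.vert (j + 1 + k) := heq' k le_rfl
  have a1 : M.G.Adj (X.path.vert (i + 1)) (q.vert j) := by
    rw [e1]; exact (q.adj (by omega)).symm
  have a2 : M.G.Adj (X.path.vert (i + 1 + k)) (q.vert (j + k + 2)) := by
    rw [e2, show j + k + 2 = j + 1 + k + 1 by omega]; exact q.adj hj'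
  have b1 := X.between_iff (m := i + 1) (by omega) (by omega) a1 n2 n1
  have b2 := X.between_iff (m := i + 1 + k) (by omega) hi' a2
    (by rw [show i + 1 + k + 1 = i + k + 2 by omega]; exact n3)
    (by rw [show i + 1 + k - 1 = i + k by omega]; exact n4)
  have c1 := h ⟨(X.path.vert (i + 1), q.vert j), a1⟩ (by
      change s(X.path.vert (i + 1), q.vert j) ∈ _
      rw [e1, Sym2.eq_swap]; exact q.edge_mem (by omega)) (by
      change s(X.path.vert (i + 1), q.vert j) ∉ _
      rw [GPath.edge_vert_iff (by omega)]
      rintro (⟨-, h1⟩ | ⟨-, h1⟩)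
      · exact n2 h1
      · exact n1 h1)
  have c2 := h ⟨(X.path.vert (i + 1 + k), q.vert (j + k + 2)), a2⟩ (by
      change s(X.path.vert (i + 1 + k), q.vert (j + k + 2)) ∈ _
      rw [e2, show j + k + 2 = j + 1 + k + 1 by omega]; exact q.edge_mem hj') (by
      change s(X.path.vert (i + 1 + k), q.vert (j + k + 2)) ∉ _
      rw [GPath.edge_vert_iff (by omega)]
      rintro (⟨-, h1⟩ | ⟨-, h1⟩)
      · exact n3 (by rw [show i + k + 2 = i + 1 + k + 1 by omega]; exact h1)
      · exact n4 (by rw [show i + k = i + 1 + k - 1 by omega]; exact h1))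
  rw [show i + 1 + k + 1 = i + k + 2 by omega, show i + 1 + k - 1 = i + k by omega] at b2
  exact (b1.trans (not_congr c1)).trans (b2.trans (not_congr c2)).symm

/-- Single-touch paths with disjoint or nested regions do not cross. -/
theorem nonCrossing {X Y : Region M base} (hc : GPath.Contig Y.path X.path)
    (h : Disj Y X ∨ Disj Y X.rev ∨ Disj Y.rev X ∨ Disj Y.rev X.rev) : M.NonCrossing X.path Y.path := by
  have key : ∃ P, ∀ d : M.G.Dart, d.edge ∈ Y.path.edges → d.edge ∉ X.path.edges →
      (X.side d ↔ P) := by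
    have aux1 : ∀ Z : Region M base, GPath.Contig Z.path X.path → Z.path.edges = Y.path.edges →
        Disj Z X → ∀ d : M.G.Dart, d.edge ∈ Y.path.edges → d.edge ∉ X.path.edges →
        (X.side d ↔ False) := fun Z hZ he h d h1 h2 =>
      iff_of_false (not_side_of_edge h hZ (he ▸ h1) h2) id
    have aux2 : ∀ Z : Region M base, GPath.Contig Z.path X.path → Z.path.edges = Y.path.edges →
        Disj Z X.rev → ∀ d : M.G.Dart, d.edge ∈ Y.path.edges → d.edge ∉ X.path.edges →
        (X.side d ↔ True) := fun Z hZ he h d h1 h2 => by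
      refine iff_of_true ?_ trivial
      have := not_side_of_edge h hZ.rev_right (he ▸ h1) (d := d)
        (by change _ ∉ X.path.rev.edges; rwa [X.path.rev_edges])
      rw [X.side_rev] at this
      tauto
    rcases h with h | h | h | h
    · exact ⟨_, aux1 Y hc rfl h⟩
    · exact ⟨_, aux2 Y hc rfl h⟩
    · exact ⟨_, aux1 Y.rev hc.rev_left Y.path.rev_edges h⟩
    · exact ⟨_, aux2 Y.rev hc.rev_left Y.path.rev_edges h⟩
  obtain ⟨P, hP⟩ := key
  refine ⟨X.not_crossesAlong Y.path P hP, X.not_crossesAlong Y.path.rev P fun d hd => hP d ?_⟩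
  rwa [Y.path.rev_edges] at hd

end Region

end PlaneGraph

/-! ### Laminar systems of paths -/

/-- A system of pairwise single-touch paths with laminar arcs, with the properties that
planarity implies. -/
structure PathSystem {V : Type*} (G : SimpleGraph V) (κ : Type*) where
  p : κ → GPath G
  -- Integer positions, so that `mirror` can negate them.
  lo : κ → ℤ
  hi : κ → ℤ
  lo_lt_hi : ∀ i, lo i < hi i
  arcs_distinct : ∀ i j, lo i = lo j → hi i = hi j → i = j
  wellFormed : ∀ i j, (lo j ≤ lo i ∧ hi i ≤ hi j) ∨ (lo i ≤ lo j ∧ hi j ≤ hi i) ∨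
    hi i ≤ lo j ∨ hi j ≤ lo i
  contig : ∀ i j, GPath.Contig (p i) (p j)
  mem_of_separates : ∀ c q r, lo q ≤ lo c ∧ hi c ≤ hi q → ¬ (lo q ≤ lo r ∧ hi r ≤ hi q) →
    ∀ v, v ∈ (p c).verts → v ∈ (p r).verts → v ∈ (p q).verts
  same_direction : ∀ c q, lo q ≤ lo c ∧ hi c ≤ hi q → ∀ i j α β, i < j → j ≤ (p c).len →
    α ≤ (p q).len → β ≤ (p q).len → (p c).vert i = (p q).vert α → (p c).vert j = (p q).vert β →
    α < β
  -- With all paths directed from `lo` to `hi`: along `q` contacts with `r` come no later than those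
  -- with `l`, along `r` first `q` and then `l`, along `l` first `r` and then `q`. A vertex common
  -- to all three is allowed.
  order_top : ∀ q r l, lo q ≤ lo r → hi r ≤ lo l → hi l ≤ hi q → ∀ i j, i ≤ (p q).len →
    j ≤ (p q).len → (p q).vert i ∈ (p r).verts → (p q).vert j ∈ (p l).verts → i ≤ j
  order_right : ∀ q r l, lo q ≤ lo r → hi r ≤ lo l → hi l ≤ hi q → ∀ i j, i ≤ (p r).len →
    j ≤ (p r).len → (p r).vert i ∈ (p q).verts → (p r).vert j ∈ (p l).verts → i ≤ j
  order_left : ∀ q r l, lo q ≤ lo r → hi r ≤ lo l → hi l ≤ hi q → ∀ i j, i ≤ (p l).len →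
    j ≤ (p l).len → (p l).vert i ∈ (p r).verts → (p l).vert j ∈ (p q).verts → i ≤ j

/-! ### From terminal positions to path systems. -/

namespace PlaneGraph

variable {V : Type*} [Finite V] {M : PlaneGraph V}

namespace Layout

variable {κ : Type*} {Q : κ → GPath M.G} (L : M.Layout Q)

theorem exists_region (i : κ) : ∃ R : Region M L.base, R.lo = L.lo i ∧ R.hi = L.hi i ∧
    (R.path = Q i ∨ R.path = (Q i).rev) := by
  have h1 := L.lo_lt_hi i
  have h2 := L.hi_lt i
  rcases Sym2.eq_iff.1 (L.ends i) with ⟨e1, e2⟩ | ⟨e1, e2⟩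
  · exact ⟨⟨Q i, L.lo i, L.hi i, L.base_outer, by omega, h2, by omega, e1, e2⟩, rfl, rfl,
      Or.inl rfl⟩
  · exact ⟨⟨(Q i).rev, L.lo i, L.hi i, L.base_outer, by omega, h2, by omega, e1, e2⟩, rfl, rfl,
      Or.inr rfl⟩

/-- The region of a member of the family, with its path directed from `lo` to `hi`. -/
noncomputable def region (i : κ) : Region M L.base := (L.exists_region i).choose

theorem region_lo (i : κ) : (L.region i).lo = L.lo i := (L.exists_region i).choose_spec.1

theorem region_hi (i : κ) : (L.region i).hi = L.hi i := (L.exists_region i).choose_spec.2.1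

theorem region_path (i : κ) : (L.region i).path = Q i ∨ (L.region i).path = (Q i).rev :=
  (L.exists_region i).choose_spec.2.2

theorem region_verts (i : κ) : (L.region i).path.verts = (Q i).verts := by
  rcases L.region_path i with h | h <;> rw [h]
  rw [GPath.rev_verts]

theorem region_edges (i : κ) : (L.region i).path.edges = (Q i).edges := by
  rcases L.region_path i with h | h <;> rw [h]
  rw [GPath.rev_edges]

theorem region_contig (hst : ∀ i j, (Q i).SingleTouch (Q j)) (i j : κ) :
    GPath.Contig (L.region i).path (L.region j).path := by
  have h := (hst i j).contig
  rcases L.region_path i with h1 | h1 <;> rcases L.region_path j with h2 | h2 <;> rw [h1, h2]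
  · exact h
  · exact h.rev_right
  · exact h.rev_left
  · exact h.rev_left.rev_right

theorem disj_of_le {i j : κ} (h : L.hi i ≤ L.lo j) : Region.Disj (L.region i) (L.region j) := by
  intro t _ h1 h2
  have := L.lo_lt_hi i
  have := L.lo_lt_hi j
  rw [L.region_lo, L.region_hi] at h1 h2
  unfold Cyc at h1 h2
  omega

theorem disj_rev_of_nested {i j : κ} (h : L.lo j ≤ L.lo i ∧ L.hi i ≤ L.hi j) :
    Region.Disj (L.region i) (L.region j).rev := by
  intro t _ h1 h2
  have := L.lo_lt_hi i
  have := L.lo_lt_hi j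
  change Cyc (L.region j).hi (L.region j).lo t at h2
  rw [L.region_lo, L.region_hi] at h1 h2
  unfold Cyc at h1 h2
  omega

/-- Regions of different members are disjoint, or nested. -/
theorem disj_cases (i j : κ) : Region.Disj (L.region i) (L.region j) ∨
    Region.Disj (L.region i) (L.region j).rev ∨ Region.Disj (L.region i).rev (L.region j) := by
  rcases L.wellFormed i j with h | h | h | h
  · exact Or.inr (Or.inl (L.disj_rev_of_nested h))
  · exact Or.inr (Or.inr (L.disj_rev_of_nested h).symm)
  · exact Or.inl (L.disj_of_le h)
  · exact Or.inl (L.disj_of_le h).symm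

theorem region_mem_of_separates (hst : ∀ i j, (Q i).SingleTouch (Q j)) (c q r : κ)
    (hc : L.lo q ≤ L.lo c ∧ L.hi c ≤ L.hi q) (hr : ¬ (L.lo q ≤ L.lo r ∧ L.hi r ≤ L.hi q)) (v : V)
    (hvc : v ∈ (L.region c).path.verts) (hvr : v ∈ (L.region r).path.verts) :
    v ∈ (L.region q).path.verts := by
  have h1 := L.region_contig hst c q
  have h2 := L.region_contig hst r q
  rcases L.wellFormed r q with h | h | h | h
  · exact absurd h hr
  · exact Region.mem_of_separates (L.disj_rev_of_nested hc) (L.disj_rev_of_nested h).symm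
      h1 h2.rev_left hvc (by
        change v ∈ (L.region r).path.rev.verts
        rwa [GPath.rev_verts])
  · exact Region.mem_of_separates (L.disj_rev_of_nested hc) (L.disj_of_le h) h1 h2 hvc hvr
  · exact Region.mem_of_separates (L.disj_rev_of_nested hc) (L.disj_of_le h).symm h1 h2 hvc hvr

/-- The path system of a single-touch family with terminal positions. -/
noncomputable def system (hst : ∀ i j, (Q i).SingleTouch (Q j)) : PathSystem M.G κ where
  p i := (L.region i).path
  lo i := L.lo i
  hi i := L.hi i
  lo_lt_hi i := by exact_mod_cast L.lo_lt_hi i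
  arcs_distinct i j h1 h2 := L.arcs_distinct i j (by exact_mod_cast h1) (by exact_mod_cast h2)
  wellFormed i j := by exact_mod_cast L.wellFormed i j
  contig i j := L.region_contig hst i j
  mem_of_separates c q r hc hr := L.region_mem_of_separates hst c q r (by exact_mod_cast hc)
    (by exact_mod_cast hr)
  same_direction c q hc i j α β hij hj hα hβ h1 h2 := by
    have h := Region.opposite (L.disj_rev_of_nested (i := c) (j := q) (by exact_mod_cast hc))
      (L.region_contig hst c q).rev_right hij hj
      (α := (L.region q).path.len - α) (β := (L.region q).path.len - β)
      (by change _ ≤ (L.region q).path.rev.len; rw [GPath.rev_len]; omega)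
      (by change _ ≤ (L.region q).path.rev.len; rw [GPath.rev_len]; omega)
      (by
        change _ = (L.region q).path.rev.vert _
        rw [GPath.rev_vert, h1]; congr 1; omega)
      (by
        change _ = (L.region q).path.rev.vert _
        rw [GPath.rev_vert, h2]; congr 1; omega)
    omega
  order_top q r l h1 h2 h3 i j hi hj hir hjl := by
    have k1 := L.lo_lt_hi r
    have k2 := L.lo_lt_hi l
    have k3 := L.lo_lt_hi q
    norm_cast at h1 h2 h3
    -- The complement of the region of `q` is the region of the reversed path, which together with
    -- `r` and `l` gives three disjoint regions following one another; hence the indices `len - i`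
    -- on `q`.
    have h := Region.order (L.disj_rev_of_nested (i := r) (j := q) ⟨h1, by omega⟩).symm
      (L.disj_rev_of_nested (i := l) (j := q) ⟨by omega, h3⟩).symm (L.disj_of_le h2) (by
        intro t _ ht
        change Cyc (L.region q).hi _ t
        rw [L.region_lo, L.region_hi] at ht
        rw [L.region_lo, L.region_hi]
        unfold Cyc at ht ⊢
        omega) (L.region_contig hst q r).rev_left (L.region_contig hst q l).rev_left
      (L.region_contig hst r l) (i := (L.region q).path.len - i) (j := (L.region q).path.len - j)
      (by change _ ≤ (L.region q).path.rev.len; rw [GPath.rev_len]; omega)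
      (by
        change (L.region q).path.rev.vert _ ∈ _
        rwa [GPath.rev_vert, show (L.region q).path.len - ((L.region q).path.len - i) = i by omega])
      (by change _ ≤ (L.region q).path.rev.len; rw [GPath.rev_len]; omega)
      (by
        change (L.region q).path.rev.vert _ ∈ _
        rwa [GPath.rev_vert, show (L.region q).path.len - ((L.region q).path.len - j) = j by omega])
    omega
  order_right q r l h1 h2 h3 i j hi hj hiq hjl := by
    have k1 := L.lo_lt_hi r
    have k2 := L.lo_lt_hi l
    have k3 := L.lo_lt_hi q
    norm_cast at h1 h2 h3
    exact Region.order (L.disj_of_le h2) (L.disj_rev_of_nested (i := r) (j := q) ⟨h1, by omega⟩)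
      (L.disj_rev_of_nested (i := l) (j := q) ⟨by omega, h3⟩) (by
        intro t _ ht
        change Cyc _ (L.region q).hi t
        rw [L.region_lo, L.region_hi] at ht
        rw [L.region_lo, L.region_hi]
        unfold Cyc at ht ⊢
        omega) (L.region_contig hst r l) (L.region_contig hst r q).rev_right
      (L.region_contig hst l q).rev_right hj hjl hi (by
        change _ ∈ (L.region q).path.rev.verts
        rwa [GPath.rev_verts])
  order_left q r l h1 h2 h3 i j hi hj hir hjq := by
    have k1 := L.lo_lt_hi r
    have k2 := L.lo_lt_hi l
    have k3 := L.lo_lt_hi q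
    norm_cast at h1 h2 h3
    exact Region.order (L.disj_rev_of_nested (i := l) (j := q) ⟨by omega, h3⟩)
      (L.disj_of_le h2).symm
      (L.disj_rev_of_nested (i := r) (j := q) ⟨h1, by omega⟩).symm (by
        intro t _ ht
        change Cyc (L.region q).hi (L.region q).lo t at ht
        rw [L.region_lo, L.region_hi] at ht
        rw [L.region_lo, L.region_lo]
        unfold Cyc at ht ⊢
        omega) (L.region_contig hst l q).rev_right (L.region_contig hst l r)
      (L.region_contig hst q r).rev_left hj (by
        change _ ∈ (L.region q).path.rev.verts
        rwa [GPath.rev_verts]) hi hir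

/-- Paths of a single-touch family with terminal positions do not cross. -/
theorem nonCrossing_of_singleTouch (L : M.Layout Q) (hst : ∀ i j, (Q i).SingleTouch (Q j))
    (i j : κ) : M.NonCrossing (Q i) (Q j) := by
  have hrev : ∀ i, ∃ X : Region M L.base, X.path = Q i ∧ (X = L.region i ∨ X.rev = L.region i) := by
    intro i
    rcases L.region_path i with h1 | h1
    · exact ⟨_, h1, Or.inl rfl⟩
    · refine ⟨(L.region i).rev, ?_, Or.inr (Region.rev_rev _)⟩
      change (L.region i).path.rev = Q i
      rw [h1]
      simp [GPath.rev]
  obtain ⟨X, hX, hXi⟩ := hrev i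
  obtain ⟨Y, hY, hYj⟩ := hrev j
  have h : Region.Disj Y X ∨ Region.Disj Y X.rev ∨ Region.Disj Y.rev X ∨
      Region.Disj Y.rev X.rev := by
    have hc := L.disj_cases j i
    rcases hXi with h1 | h1 <;> rcases hYj with h2 | h2 <;> rw [← h1, ← h2] at hc
    · tauto
    · rw [Region.rev_rev] at hc; tauto
    · rw [Region.rev_rev] at hc; tauto
    · rw [Region.rev_rev, Region.rev_rev] at hc; tauto
  rw [← hX, ← hY]
  exact Region.nonCrossing (by rw [hX, hY]; exact (hst j i).contig) h

end Layout

end PlaneGraph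

/-! ### The genealogy tree and the faces of a path system -/

namespace GPath

variable {V : Type*} {G : SimpleGraph V}

/-- Supplies a leaf of `D`: the initial vertex of its first edge on `x` is in no other edge of `D`.
-/
theorem exists_first_edge {x : GPath G} {D : Set (Sym2 V)} (hD : D ⊆ x.edges) (hne : D.Nonempty) :
    ∃ k < x.len, s(x.vert k, x.vert (k + 1)) ∈ D ∧
      (∀ j < x.len, s(x.vert j, x.vert (j + 1)) ∈ D → k ≤ j) ∧
      ∀ e ∈ D, x.vert k ∈ e → e = s(x.vert k, x.vert (k + 1)) := by
  classical
  have hex : ∃ k, k < x.len ∧ s(x.vert k, x.vert (k + 1)) ∈ D := by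
    obtain ⟨e, he⟩ := hne
    obtain ⟨k, hk, rfl⟩ := mem_edges.1 (hD he)
    exact ⟨k, hk, he⟩
  have hs := Nat.find_spec hex
  have hmin : ∀ j < x.len, s(x.vert j, x.vert (j + 1)) ∈ D → Nat.find hex ≤ j :=
    fun j hj hjD => Nat.find_min' hex ⟨hj, hjD⟩
  refine ⟨Nat.find hex, hs.1, hs.2, hmin, fun e he hv => ?_⟩
  obtain ⟨b, rfl⟩ := Sym2.mem_iff_exists.1 hv
  rcases (edge_vert_iff hs.1.le).1 (hD he) with ⟨-, rfl⟩ | ⟨h0, rfl⟩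
  · rfl
  · have := hmin (Nat.find hex - 1) (by omega) (by
      rw [Nat.sub_add_cancel h0, Sym2.eq_swap]; exact he)
    omega

theorem exists_last_edge {x : GPath G} {D : Set (Sym2 V)} (hD : D ⊆ x.edges) (hne : D.Nonempty) :
    ∃ k < x.len, s(x.vert k, x.vert (k + 1)) ∈ D ∧
      (∀ j < x.len, s(x.vert j, x.vert (j + 1)) ∈ D → j ≤ k) ∧
      ∀ e ∈ D, x.vert (k + 1) ∈ e → e = s(x.vert k, x.vert (k + 1)) := by
  obtain ⟨k, hk, h1, h2, h3⟩ := exists_first_edge (x := x.rev) (by rwa [rev_edges]) hne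
  rw [rev_len] at hk h2
  simp only [rev_vert] at h1 h2 h3
  have e1 : x.len - k = x.len - (k + 1) + 1 := by omega
  rw [e1, Sym2.eq_swap] at h1
  rw [e1] at h3
  refine ⟨x.len - (k + 1), by omega, h1, fun j hj hjD => ?_, fun e he hv => ?_⟩
  · have := h2 (x.len - (j + 1)) (by omega) (by
      rwa [show x.len - (x.len - (j + 1)) = j + 1 by omega,
        show x.len - (x.len - (j + 1) + 1) = j by omega, Sym2.eq_swap])
    omega
  · rw [Sym2.eq_swap]; exact h3 e he hv

/-- A set of edges of a path `x` that avoids `q` has an edge with an endpoint outside `q` that is in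
no other edge of the set. -/
theorem exists_leaf {x q : GPath G} (hc : Contig x q) {D : Set (Sym2 V)} (hD : D ⊆ x.edges)
    (hDq : ∀ e ∈ D, e ∉ q.edges) (hne : D.Nonempty) :
    ∃ e ∈ D, ∃ v ∈ e, v ∉ q.verts ∧ ∀ e' ∈ D, v ∈ e' → e' = e := by
  obtain ⟨k, hk, h1, h2, h3⟩ := exists_first_edge hD hne
  obtain ⟨m, hm, h4, h5, h6⟩ := exists_last_edge hD hne
  by_cases hkq : x.vert k ∈ q.verts
  · by_cases hmq : x.vert (m + 1) ∈ q.verts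
    · have := h2 m hm h4
      exact absurd (hc k (m + 1) (by omega) hm hkq hmq k le_rfl (by omega)) (hDq _ h1)
    · exact ⟨_, h4, _, Sym2.mem_mk_right _ _, hmq, h6⟩
  · exact ⟨_, h1, _, Sym2.mem_mk_left _ _, hkq, h3⟩

end GPath

/-- A set of edges in which every endpoint of an edge is also in another edge. -/
def NoLeaf {V : Type*} (C : Set (Sym2 V)) : Prop := ∀ e ∈ C, ∀ v ∈ e, ∃ e' ∈ C, e' ≠ e ∧ v ∈ e'

theorem SimpleGraph.Walk.IsCycle.noLeaf {V : Type*} {G : SimpleGraph V} {v : V}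
    {c : G.Walk v v} (hc : c.IsCycle) : NoLeaf {e | e ∈ c.edges} := by
  intro e he u hu
  obtain ⟨w, rfl⟩ := Sym2.mem_iff_exists.1 hu
  have h2 := hc.ncard_neighborSet_toSubgraph_eq_two (c.fst_mem_support_of_mem_edges he)
  obtain ⟨a, b, hab, hset⟩ := Set.ncard_eq_two.1 h2
  have hmem : ∀ x, x ∈ c.toSubgraph.neighborSet u ↔ s(u, x) ∈ c.edges := by
    intro x
    rw [Subgraph.mem_neighborSet, ← Subgraph.mem_edgeSet, Walk.mem_edges_toSubgraph]
  have ha : s(u, a) ∈ c.edges := by rw [← hmem, hset]; simp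
  have hb : s(u, b) ∈ c.edges := by rw [← hmem, hset]; simp
  by_cases h : a = w
  · refine ⟨s(u, b), hb, ?_, Sym2.mem_mk_left _ _⟩
    rw [Ne, Sym2.congr_right, ← h]
    exact hab.symm
  · refine ⟨s(u, a), ha, ?_, Sym2.mem_mk_left _ _⟩
    rwa [Ne, Sym2.congr_right]

theorem NoLeaf.not_subset_path {V : Type*} {G : SimpleGraph V} {C : Set (Sym2 V)} (hC : NoLeaf C)
    (hne : C.Nonempty) (x : GPath G) : ¬ C ⊆ x.edges := by
  intro h
  obtain ⟨k, hk, h1, -, h3⟩ := GPath.exists_first_edge h hne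
  obtain ⟨e', he', hne', hv⟩ := hC _ h1 _ (Sym2.mem_mk_left _ _)
  exact hne' (h3 e' he' hv)

namespace PathSystem

variable {V : Type*} {G : SimpleGraph V} {κ : Type*} (S : PathSystem G κ)

/-- `i ≼ j`: the arc of `i` is contained in the arc of `j`. -/
def Le (i j : κ) : Prop := S.lo j ≤ S.lo i ∧ S.hi i ≤ S.hi j

/-- `c` is a child of `q`. -/
def IsChild (c q : κ) : Prop := c ≠ q ∧ S.Le c q ∧ ∀ i, S.Le i q → S.Le c i → i = c ∨ i = q

/-- `r` and `l` are the right and the left child of `q`. -/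
def Kids (q r l : κ) : Prop := S.hi r ≤ S.lo l ∧ ∀ c, S.IsChild c q ↔ c = r ∨ c = l

/-- The mirror image of a path system. -/
def mirror : PathSystem G κ where
  p i := (S.p i).rev
  lo i := - S.hi i
  hi i := - S.lo i
  lo_lt_hi i := by have := S.lo_lt_hi i; omega
  arcs_distinct i j h1 h2 := S.arcs_distinct i j (by omega) (by omega)
  wellFormed i j := by have := S.wellFormed i j; omega
  contig i j := (S.contig i j).rev_left.rev_right
  mem_of_separates c q r hc hr v := by
    rw [GPath.rev_verts, GPath.rev_verts, GPath.rev_verts]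
    exact S.mem_of_separates c q r (by omega) (by omega) v
  same_direction c q hc i j α β hij hj hα hβ h1 h2 := by
    rw [GPath.rev_len] at hj hα hβ
    rw [GPath.rev_vert, GPath.rev_vert] at h1 h2
    have := S.same_direction c q (by omega) _ _ _ _ (by omega) (by omega) (by omega) (by omega)
      h2 h1
    omega
  order_top q r l h1 h2 h3 i j hi hj hir hjl := by
    rw [GPath.rev_len] at hi hj
    rw [GPath.rev_vert, GPath.rev_verts] at hir hjl
    have := S.order_top q l r (by omega) (by omega) (by omega) _ _ (by omega) (by omega) hjl hir
    omega
  order_right q r l h1 h2 h3 i j hi hj hiq hjl := by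
    rw [GPath.rev_len] at hi hj
    rw [GPath.rev_vert, GPath.rev_verts] at hiq hjl
    have := S.order_left q l r (by omega) (by omega) (by omega) _ _ (by omega) (by omega) hjl hiq
    omega
  order_left q r l h1 h2 h3 i j hi hj hir hjq := by
    rw [GPath.rev_len] at hi hj
    rw [GPath.rev_vert, GPath.rev_verts] at hir hjq
    have := S.order_right q l r (by omega) (by omega) (by omega) _ _ (by omega) (by omega) hjq hir
    omega

theorem mirror_verts (i : κ) : (S.mirror.p i).verts = (S.p i).verts := GPath.rev_verts _

theorem mirror_edges (i : κ) : (S.mirror.p i).edges = (S.p i).edges := GPath.rev_edges _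

theorem mirror_le {i j : κ} : S.mirror.Le i j ↔ S.Le i j := by
  change (- S.hi j ≤ - S.hi i ∧ - S.lo i ≤ - S.lo j) ↔ S.lo j ≤ S.lo i ∧ S.hi i ≤ S.hi j
  omega

theorem mirror_isChild {i j : κ} : S.mirror.IsChild i j ↔ S.IsChild i j := by
  simp only [IsChild, mirror_le]

variable {S}

theorem Kids.mirror {q r l : κ} (h : S.Kids q r l) : S.mirror.Kids q l r := by
  refine ⟨?_, fun c => ?_⟩
  · have := h.1
    change - S.lo l ≤ - S.hi r
    omega
  · rw [mirror_isChild, h.2, or_comm]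

theorem Le.refl (i : κ) : S.Le i i := ⟨le_rfl, le_rfl⟩

theorem Le.trans {i j k : κ} (h1 : S.Le i j) (h2 : S.Le j k) : S.Le i k :=
  ⟨h2.1.trans h1.1, h1.2.trans h2.2⟩

theorem Le.antisymm {i j : κ} (h1 : S.Le i j) (h2 : S.Le j i) : i = j :=
  S.arcs_distinct i j (le_antisymm h2.1 h1.1) (le_antisymm h1.2 h2.2)

theorem Le.total {c q q' : κ} (h1 : S.Le c q) (h2 : S.Le c q') : S.Le q q' ∨ S.Le q' q := by
  have := S.wellFormed q q'
  have := S.lo_lt_hi c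
  unfold Le at *
  omega

variable (S)

/-- The length of the arc. -/
def size (i : κ) : ℕ := (S.hi i - S.lo i).toNat

variable {S}

theorem Le.size_lt {i j : κ} (h : S.Le i j) (hne : i ≠ j) : S.size i < S.size j := by
  by_contra hlt
  apply hne
  have := S.lo_lt_hi i
  have := S.lo_lt_hi j
  unfold size at hlt
  unfold Le at h
  exact S.arcs_distinct i j (by omega) (by omega)

theorem sep {c q r : κ} (hc : S.Le c q) (hr : ¬ S.Le r q) {v : V} (h1 : v ∈ (S.p c).verts)
    (h2 : v ∈ (S.p r).verts) : v ∈ (S.p q).verts := S.mem_of_separates c q r hc hr v h1 h2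

/-- A common vertex of `c ≼ q` and `r`, where `q ≼ r`, lies on `q`. -/
theorem sep_le {c q r : κ} (hc : S.Le c q) (hr : S.Le q r) {v : V} (h1 : v ∈ (S.p c).verts)
    (h2 : v ∈ (S.p r).verts) : v ∈ (S.p q).verts := by
  by_cases h : S.Le r q
  · rwa [hr.antisymm h]
  · exact sep hc h h1 h2

theorem edge_of_verts {c q : κ} {e : Sym2 V} (he : e ∈ (S.p c).edges)
    (hv : ∀ v ∈ e, v ∈ (S.p q).verts) : e ∈ (S.p q).edges := by
  induction e with
  | _ u v => exact (S.contig c q).edge he (hv u (by simp)) (hv v (by simp))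

theorem mem_verts_of_mem {x : GPath G} {e : Sym2 V} (he : e ∈ x.edges) {v : V} (hv : v ∈ e) :
    v ∈ x.verts := by
  obtain ⟨w, rfl⟩ := Sym2.mem_iff_exists.1 hv
  exact GPath.left_mem_verts he

theorem sep_edge {c q r : κ} (hc : S.Le c q) (hr : ¬ S.Le r q) {e : Sym2 V}
    (h1 : e ∈ (S.p c).edges) (h2 : e ∈ (S.p r).edges) : e ∈ (S.p q).edges :=
  edge_of_verts h1 fun _ hv => sep hc hr (mem_verts_of_mem h1 hv) (mem_verts_of_mem h2 hv)

theorem sep_le_edge {c q r : κ} (hc : S.Le c q) (hr : S.Le q r) {e : Sym2 V}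
    (h1 : e ∈ (S.p c).edges) (h2 : e ∈ (S.p r).edges) : e ∈ (S.p q).edges :=
  edge_of_verts h1 fun _ hv => sep_le hc hr (mem_verts_of_mem h1 hv) (mem_verts_of_mem h2 hv)

/-- The later end of a common edge would be a contact of `q` with `r`, the earlier end one with `l`,
against `order_top`. -/
theorem no_common_edge_aux {q r l : κ} (hr : S.Le r q) (hl : S.Le l q) (h : S.hi r ≤ S.lo l)
    {e : Sym2 V} (h1 : e ∈ (S.p q).edges) (h2 : e ∈ (S.p r).edges) (h3 : e ∈ (S.p l).edges) :
    False := by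
  obtain ⟨k, hk, rfl⟩ := GPath.mem_edges.1 h1
  have := S.order_top q r l hr.1 h hl.2 (k + 1) k hk hk.le (GPath.right_mem_verts h2)
    (GPath.left_mem_verts h3)
  omega

/-- Two incomparable paths below `q` have no common edge on `q`. -/
theorem no_common_edge {q r l : κ} (hr : S.Le r q) (hl : S.Le l q) (h : ¬ S.Le r l)
    (h' : ¬ S.Le l r) {e : Sym2 V} (h1 : e ∈ (S.p q).edges) (h2 : e ∈ (S.p r).edges)
    (h3 : e ∈ (S.p l).edges) : False := by
  rcases S.wellFormed r l with h4 | h4 | h4 | h4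
  · exact h h4
  · exact h' h4
  · exact no_common_edge_aux hr hl h4 h1 h2 h3
  · exact no_common_edge_aux hl hr h4 h1 h3 h2

namespace Kids

variable {q r l : κ}

theorem right (h : S.Kids q r l) : S.IsChild r q := (h.2 r).2 (Or.inl rfl)

theorem left (h : S.Kids q r l) : S.IsChild l q := (h.2 l).2 (Or.inr rfl)

theorem right_le (h : S.Kids q r l) : S.Le r q := h.right.2.1

theorem left_le (h : S.Kids q r l) : S.Le l q := h.left.2.1

theorem not_le (h : S.Kids q r l) {s : κ} (h1 : S.Le s r) (h2 : S.Le s l) : False := by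
  have := h.1
  have := S.lo_lt_hi s
  unfold Le at h1 h2
  omega

theorem ne (h : S.Kids q r l) : r ≠ l := fun he => h.not_le (Le.refl r) (he ▸ Le.refl r)

theorem unique {r' l' : κ} (h : S.Kids q r l) (h' : S.Kids q r' l') : r = r' ∧ l = l' := by
  have h1 := S.lo_lt_hi r
  have h2 := S.lo_lt_hi l
  have h3 := h.1
  have h4 := h'.1
  rcases (h'.2 r).1 h.right with rfl | rfl <;> rcases (h'.2 l).1 h.left with rfl | rfl
  · omega
  · exact ⟨rfl, rfl⟩
  · omega
  · omega

end Kids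

theorem IsChild.parent_unique {c q q' : κ} (h : S.IsChild c q) (h' : S.IsChild c q') : q = q' := by
  rcases h.2.1.total h'.2.1 with h1 | h1
  · rcases h'.2.2 q h1 h.2.1 with h2 | h2
    · exact absurd h2.symm h.1
    · exact h2
  · rcases h.2.2 q' h1 h'.2.1 with h2 | h2
    · exact absurd h2.symm h'.1
    · exact h2.symm

theorem exists_max (S : PathSystem G κ) [Finite κ] (P : κ → Prop) (h : ∃ i, P i) :
    ∃ m, P m ∧ ∀ i, P i → S.size i ≤ S.size m := by
  have hne : {i | P i}.Nonempty := h
  obtain ⟨m, hm, hmax⟩ := Set.exists_max_image {i | P i} S.size (Set.toFinite _) hne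
  exact ⟨m, hm, hmax⟩

theorem exists_min (S : PathSystem G κ) [Finite κ] (P : κ → Prop) (h : ∃ i, P i) :
    ∃ m, P m ∧ ∀ i, P i → S.size m ≤ S.size i := by
  have hne : {i | P i}.Nonempty := h
  obtain ⟨m, hm, hmax⟩ := Set.exists_min_image {i | P i} S.size (Set.toFinite _) hne
  exact ⟨m, hm, hmax⟩

theorem exists_parent [Finite κ] {m p : κ} (h : S.Le m p) (hne : m ≠ p) :
    ∃ q, S.IsChild m q ∧ S.Le q p := by
  obtain ⟨q, ⟨h1, h2, h3⟩, hmin⟩ := S.exists_min (fun q => S.Le m q ∧ m ≠ q ∧ S.Le q p)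
    ⟨p, h, hne, Le.refl p⟩
  refine ⟨q, ⟨h2, h1, fun i hiq hmi => ?_⟩, h3⟩
  by_cases him : i = m
  · exact Or.inl him
  · right
    by_contra hne
    have := hmin i ⟨hmi, Ne.symm him, hiq.trans h3⟩
    have := hiq.size_lt hne
    omega

theorem exists_child_ge [Finite κ] {s q : κ} (h : S.Le s q) (hne : s ≠ q) :
    ∃ c, S.IsChild c q ∧ S.Le s c := by
  obtain ⟨c, ⟨h1, h2, h3⟩, hmax⟩ := S.exists_max (fun c => S.Le s c ∧ c ≠ q ∧ S.Le c q)
    ⟨s, Le.refl s, hne, h⟩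
  refine ⟨c, ⟨h2, h3, fun i hiq hci => ?_⟩, h1⟩
  by_cases hic : i = q
  · exact Or.inr hic
  · left
    by_contra hne
    have := hmax i ⟨h1.trans hci, hic, hiq⟩
    have := hci.size_lt (Ne.symm hne)
    omega

theorem Kids.le_or_le [Finite κ] {q r l s : κ} (h : S.Kids q r l) (hs : S.Le s q) (hne : s ≠ q) :
    S.Le s r ∨ S.Le s l := by
  obtain ⟨c, hc, hsc⟩ := exists_child_ge hs hne
  rcases (h.2 c).1 hc with rfl | rfl
  · exact Or.inl hsc
  · exact Or.inr hsc

/-- The parent of a path `s ≺ p` is below the children of `p` or `p` itself. -/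
theorem IsChild.le_of_lt {m q p : κ} (h : S.IsChild m q) (hm : S.Le m p) (hne : m ≠ p) :
    S.Le q p := by
  rcases h.2.1.total hm with h1 | h1
  · exact h1
  · rcases h.2.2 p h1 hm with h2 | h2
    · exact absurd h2.symm hne
    · exact h2 ▸ Le.refl p

variable (S)

/-- `e` is the edge with which `r` leaves `q` towards `l`, not on `q`. -/
def Exit (q r l : κ) (e : Sym2 V) : Prop :=
  ∃ k < (S.p r).len, e = s((S.p r).vert k, (S.p r).vert (k + 1)) ∧
    (S.p r).vert k ∈ (S.p q).verts ∧ e ∉ (S.p q).edges ∧ (S.p r).vert k ∉ (S.p l).verts ∧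
    ∃ m ≤ (S.p r).len, k < m ∧ (S.p r).vert m ∈ (S.p l).verts

variable {S}

/-- Between two vertices on `q` the path `r` stays on `q`, so it can leave `q` only once. -/
theorem Exit.unique {q r l : κ} {e e' : Sym2 V} (h : S.Exit q r l e) (h' : S.Exit q r l e') :
    e = e' := by
  obtain ⟨k, hk, rfl, h1, h2, -⟩ := h
  obtain ⟨k', hk', rfl, h1', h2', -⟩ := h'
  rcases lt_trichotomy k k' with h | rfl | h
  · exact absurd (S.contig r q k k' h hk'.le h1 h1' k le_rfl h) h2
  · rfl
  · exact absurd (S.contig r q k' k h hk.le h1' h1 k' le_rfl h) h2'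

/-- A set of edges on the lower paths of a possible face whose only leaves are on the upper path
contains the first edge of `r` after `q`. -/
theorem exit_of_leaves {q r l : κ} (h1 : S.lo q ≤ S.lo r) (h2 : S.hi r ≤ S.lo l)
    (h3 : S.hi l ≤ S.hi q) {D : Set (Sym2 V)}
    (hD : ∀ e ∈ D, e ∈ (S.p r).edges ∨ e ∈ (S.p l).edges) (hDq : ∀ e ∈ D, e ∉ (S.p q).edges)
    (hleaf : ∀ e ∈ D, ∀ v ∈ e, v ∉ (S.p q).verts → ∃ e' ∈ D, e' ≠ e ∧ v ∈ e')
    (hne : D.Nonempty) :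
    ∃ e ∈ D, S.Exit q r l e ∧ ∃ k < (S.p r).len,
      e = s((S.p r).vert k, (S.p r).vert (k + 1)) ∧ (S.p r).vert k ∈ (S.p q).verts ∧
      ∀ j < (S.p r).len, s((S.p r).vert j, (S.p r).vert (j + 1)) ∈ D → k ≤ j := by
  -- A part of the single path `l` off `q` would have a leaf outside `q`.
  have hnotl : ¬ D ⊆ (S.p l).edges := by
    intro h
    obtain ⟨e, he, v, hv, hvq, hu⟩ := GPath.exists_leaf (S.contig l q) h hDq hne
    obtain ⟨e', he', hne', hv'⟩ := hleaf e he v hv hvq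
    exact hne' (hu e' he' hv')
  set D' : Set (Sym2 V) := {e | e ∈ D ∧ e ∈ (S.p r).edges} with hD'
  have hne' : D'.Nonempty := by
    by_contra hemp
    refine hnotl fun e he => (hD e he).resolve_left fun hr => hemp ⟨e, he, hr⟩
  obtain ⟨k, hk, k1, k2, k3⟩ := GPath.exists_first_edge (x := S.p r) (fun e he => he.2) hne'
  obtain ⟨m, hm, m1, m2, m3⟩ := GPath.exists_last_edge (x := S.p r) (fun e he => he.2) hne'
  have hkm := k2 m hm m1
  have hmeets : ∀ e ∈ D', ∀ v ∈ e, v ∉ (S.p q).verts → (∀ e' ∈ D', v ∈ e' → e' = e) →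
      v ∈ (S.p l).verts := by
    intro e he v hv hvq hu
    obtain ⟨e', he', hne, hv'⟩ := hleaf e he.1 v hv hvq
    rcases hD e' he' with h | h
    · exact absurd (hu e' ⟨he', h⟩ hv') hne
    · exact mem_verts_of_mem h hv'
  -- If both ends of the part of `r` used by `D` were on `l`, contiguity would put all of `D` on
  -- `l`.
  have hfalse : (S.p r).vert k ∈ (S.p l).verts → (S.p r).vert (m + 1) ∈ (S.p l).verts →
      False := by
    intro hkl hml
    refine hnotl fun e he => (hD e he).elim (fun h => ?_) id
    obtain ⟨j, hj, rfl⟩ := GPath.mem_edges.1 h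
    exact S.contig r l k (m + 1) (by omega) hm hkl hml j (k2 j hj ⟨he, h⟩)
      (Nat.lt_succ_of_le (m2 j hj ⟨he, h⟩))
  -- An end off `q` must continue on `l`. If the first end did, the last end would have to be on
  -- `q`, and then `r` would meet `l` before `q`.
  have hkq : (S.p r).vert k ∈ (S.p q).verts := by
    by_contra hkq
    have hkl := hmeets _ k1 _ (Sym2.mem_mk_left _ _) hkq k3
    refine hfalse hkl (hmeets _ m1 _ (Sym2.mem_mk_right _ _) ?_ m3)
    intro hmq
    have := S.order_right q r l h1 h2 h3 (m + 1) k hm hk.le hmq hkl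
    omega
  have hmq : (S.p r).vert (m + 1) ∉ (S.p q).verts := fun hmq =>
    hDq _ k1.1 (S.contig r q k (m + 1) (by omega) hm hkq hmq k le_rfl (by omega))
  have hml := hmeets _ m1 _ (Sym2.mem_mk_right _ _) hmq m3
  exact ⟨_, k1.1, ⟨k, hk, rfl, hkq, hDq _ k1.1, fun h => hfalse h hml, m + 1, hm, by omega, hml⟩,
    k, hk, rfl, hkq, fun j hj hjD => k2 j hj ⟨hjD, (S.p r).edge_mem hj⟩⟩

/-- Both extremal edges of the lower boundary of a face are on every cycle-like set of edges that
uses the lower paths. -/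
theorem exits_of_noLeaf {q r l : κ} (hr : S.Le r q) (hl : S.Le l q) (hrl : S.hi r ≤ S.lo l)
    {C : Set (Sym2 V)} (hC : NoLeaf C)
    (hloc : ∀ e ∈ C, ∀ v ∈ e, v ∉ (S.p q).verts → (v ∈ (S.p r).verts ∨ v ∈ (S.p l).verts) →
      e ∈ (S.p r).edges ∨ e ∈ (S.p l).edges)
    {e₀ : Sym2 V} (h₀ : e₀ ∈ C) (h₀' : e₀ ∈ (S.p r).edges ∨ e₀ ∈ (S.p l).edges)
    (h₀q : e₀ ∉ (S.p q).edges) :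
    ∃ e ∈ C, S.Exit q r l e ∧ (∃ k < (S.p r).len,
      e = s((S.p r).vert k, (S.p r).vert (k + 1)) ∧ (S.p r).vert k ∈ (S.p q).verts ∧
      ∀ j < (S.p r).len, s((S.p r).vert j, (S.p r).vert (j + 1)) ∈ C →
        s((S.p r).vert j, (S.p r).vert (j + 1)) ∉ (S.p q).edges → k ≤ j) := by
  obtain ⟨e, he, hx, k, hk, h1, h2, h3⟩ := S.exit_of_leaves (D := {e | e ∈ C ∧
      (e ∈ (S.p r).edges ∨ e ∈ (S.p l).edges) ∧ e ∉ (S.p q).edges}) hr.1 hrl hl.2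
    (fun e he => he.2.1) (fun e he => he.2.2) (fun e he v hv hvq => by
      obtain ⟨e', he', hne, hv'⟩ := hC e he.1 v hv
      refine ⟨e', ⟨he', hloc e' he' v hv' hvq ?_, fun h => hvq (mem_verts_of_mem h hv')⟩, hne, hv'⟩
      exact he.2.1.imp (fun h => mem_verts_of_mem h hv) (fun h => mem_verts_of_mem h hv))
    ⟨e₀, h₀, h₀', h₀q⟩
  exact ⟨e, he.1, hx, k, hk, h1, h2, fun j hj hjC hjq =>
    h3 j hj ⟨hjC, Or.inl ((S.p r).edge_mem hj), hjq⟩⟩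

variable (S)

/-- `C` is a cycle in the union of `q`, `r` and `l`. -/
def IsCycleOn (q r l : κ) (C : Set (Sym2 V)) : Prop :=
  C ⊆ (S.p q).edges ∪ (S.p r).edges ∪ (S.p l).edges ∧
    ∃ (v : V) (c : G.Walk v v), c.IsCycle ∧ C = {e | e ∈ c.edges}

variable {S}

theorem IsCycleOn.mirror {q r l : κ} {C : Set (Sym2 V)} (h : S.IsCycleOn q r l C) :
    S.mirror.IsCycleOn q l r C := by
  refine ⟨?_, h.2⟩
  rw [mirror_edges, mirror_edges, mirror_edges, Set.union_right_comm]
  exact h.1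

theorem IsCycleOn.noLeaf {q r l : κ} {C : Set (Sym2 V)} (h : S.IsCycleOn q r l C) : NoLeaf C := by
  obtain ⟨-, v, c, hc, rfl⟩ := h
  exact hc.noLeaf

theorem IsCycleOn.nonempty {q r l : κ} {C : Set (Sym2 V)} (h : S.IsCycleOn q r l C) :
    C.Nonempty := by
  obtain ⟨-, v, c, hc, rfl⟩ := h
  cases c with
  | nil => exact absurd rfl hc.ne_nil
  | cons h c => exact ⟨_, by simp; exact Or.inl rfl⟩

theorem IsCycleOn.exit {q r l : κ} (hr : S.Le r q) (hl : S.Le l q) (hrl : S.hi r ≤ S.lo l)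
    {C : Set (Sym2 V)} (h : S.IsCycleOn q r l C) :
    ∃ e ∈ C, S.Exit q r l e ∧ (∃ k < (S.p r).len,
      e = s((S.p r).vert k, (S.p r).vert (k + 1)) ∧ (S.p r).vert k ∈ (S.p q).verts ∧
      ∀ j < (S.p r).len, s((S.p r).vert j, (S.p r).vert (j + 1)) ∈ C →
        s((S.p r).vert j, (S.p r).vert (j + 1)) ∉ (S.p q).edges → k ≤ j) := by
  have hn := h.noLeaf.not_subset_path h.nonempty (S.p q)
  rw [Set.not_subset] at hn
  obtain ⟨e₀, h1, h2⟩ := hn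
  refine exits_of_noLeaf hr hl hrl h.noLeaf (fun e he v hv hvq _ => ?_) h1 ?_ h2
  · rcases h.1 he with (h3 | h3) | h3
    · exact absurd (mem_verts_of_mem h3 hv) hvq
    · exact Or.inl h3
    · exact Or.inr h3
  · rcases h.1 h1 with (h3 | h3) | h3
    · exact absurd h3 h2
    · exact Or.inl h3
    · exact Or.inr h3

/-- The extremal edge of the lower boundary on `r` is the exit edge. -/
theorem IsCycleOn.exit_of_mem {q r l : κ} (hr : S.Le r q) (hl : S.Le l q) (hrl : S.hi r ≤ S.lo l)
    {C : Set (Sym2 V)} (h : S.IsCycleOn q r l C) {e : Sym2 V} (he : e ∈ C)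
    (her : e ∈ (S.p r).edges) (heq : e ∉ (S.p q).edges) {v : V} (hv : v ∈ e)
    (hvq : v ∈ (S.p q).verts) : S.Exit q r l e := by
  obtain ⟨e₀, h1, h2, k, hk, rfl, hkq, hmin⟩ := h.exit hr hl hrl
  obtain ⟨j, hj, rfl⟩ := GPath.mem_edges.1 her
  have hkj := hmin j hj he heq
  rcases Nat.lt_or_eq_of_le hkj with h3 | rfl
  · exfalso
    have h2q : s((S.p r).vert k, (S.p r).vert (k + 1)) ∉ (S.p q).edges := by
      obtain ⟨_, _, _, _, h, _⟩ := h2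
      exact h
    rcases Sym2.mem_iff.1 hv with rfl | rfl
    · exact h2q (S.contig r q k j h3 hj.le hkq hvq k le_rfl h3)
    · exact h2q (S.contig r q k (j + 1) (by omega) hj hkq hvq k le_rfl (by omega))
  · exact h2

theorem reachable_of_edges {H : SimpleGraph V} (x : GPath G) {i j : ℕ} (hij : i ≤ j)
    (h : ∀ k, i ≤ k → k < j → H.Adj (x.vert k) (x.vert (k + 1))) :
    H.Reachable (x.vert i) (x.vert j) := by
  induction j, hij using Nat.le_induction with
  | base => exact Reachable.refl _
  | succ n hn ih =>
    exact (ih fun k h1 h2 => h k h1 (by omega)).trans (h n hn (by omega)).reachable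

theorem reachable_of_path {H : SimpleGraph V} (x : GPath G)
    (h : ∀ k < x.len, H.Adj (x.vert k) (x.vert (k + 1))) {u v : V} (hu : u ∈ x.verts)
    (hv : v ∈ x.verts) : H.Reachable u v := by
  have key : ∀ v ∈ x.verts, H.Reachable (x.vert 0) v := by
    intro v hv
    obtain ⟨i, hi, rfl⟩ := GPath.mem_verts.1 hv
    exact reachable_of_edges x (Nat.zero_le _) fun k _ hk => h k (by omega)
  exact (key u hu).symm.trans (key v hv)

/-- Three paths with exit edges on both sides contain a cycle through these edges. -/
theorem exists_cycleOn {q r l : κ} (hr : S.Le r q) (hl : S.Le l q) (hrl : S.hi r ≤ S.lo l)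
    {e e' : Sym2 V} (he : S.Exit q r l e) (he' : S.mirror.Exit q l r e') :
    ∃ C, S.IsCycleOn q r l C ∧ e ∈ C ∧ e' ∈ C := by
  -- Any cycle in the union contains exit edges on both sides, and these are unique.
  suffices hex : ∃ C, S.IsCycleOn q r l C by
    obtain ⟨C, hC⟩ := hex
    refine ⟨C, hC, ?_, ?_⟩
    · obtain ⟨e₁, h1, h2, -⟩ := hC.exit hr hl hrl
      rwa [he.unique h2]
    · obtain ⟨e₁, h1, h2, -⟩ := hC.mirror.exit (mirror_le S |>.2 hl) (mirror_le S |>.2 hr)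
        (by change - S.lo l ≤ - S.hi r; omega)
      rwa [he'.unique h2]
  set E : Set (Sym2 V) := (S.p q).edges ∪ (S.p r).edges ∪ (S.p l).edges with hE
  have hEG : E ⊆ G.edgeSet := by
    rintro e ((h | h) | h) <;> exact GPath.mem_edgeSet h
  set H := fromEdgeSet E with hH
  have hHG : H ≤ G := by
    intro u v huv
    exact hEG ((fromEdgeSet_adj E).1 huv).1
  -- The exit edge of `r` is not a bridge: its ends remain joined along `q`, then `l`, then the part
  -- of `r` after the exit edge.
  have hnot : ¬ H.IsAcyclic := by
    intro hac
    obtain ⟨k, hk, rfl, hkq, hnq, hkl, m, hm, hkm, hml⟩ := he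
    obtain ⟨k', hk', -, hkq', -⟩ := he'
    rw [mirror_verts] at hkq'
    have hl' : (S.mirror.p l).vert k' ∈ (S.p l).verts := by
      rw [← mirror_verts]; exact GPath.vert_mem _ _
    set a := (S.p r).vert k with ha
    set b := (S.p r).vert (k + 1) with hb
    have hadj : H.Adj a b := (fromEdgeSet_adj E).2
      ⟨Or.inl (Or.inr ((S.p r).edge_mem hk)), ((S.p r).adj hk).ne⟩
    have hbridge := isAcyclic_iff_forall_isBridge.1 hac (e := s(a, b)) hadj
    rw [isBridge_iff] at hbridge
    apply hbridge
    have hadj' : ∀ u v, G.Adj u v → s(u, v) ∈ E → s(u, v) ≠ s(a, b) →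
        (H \ fromEdgeSet {s(a, b)}).Adj u v := by
      intro u v h1 h2 h3
      rw [sdiff_adj, fromEdgeSet_adj, fromEdgeSet_adj]
      exact ⟨⟨h2, h1.ne⟩, fun h => h3 h.1⟩
    have r1 : (H \ fromEdgeSet {s(a, b)}).Reachable a ((S.mirror.p l).vert k') :=
      reachable_of_path (S.p q) (fun i hi => hadj' _ _ ((S.p q).adj hi)
        (Or.inl (Or.inl ((S.p q).edge_mem hi)))
        (fun h => hnq (h ▸ (S.p q).edge_mem hi))) hkq hkq'
    have r2 : (H \ fromEdgeSet {s(a, b)}).Reachable ((S.mirror.p l).vert k') ((S.p r).vert m) :=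
      reachable_of_path (S.p l) (fun i hi => hadj' _ _ ((S.p l).adj hi)
        (Or.inr ((S.p l).edge_mem hi))
        (fun h => hkl (GPath.left_mem_verts (h ▸ (S.p l).edge_mem hi)))) hl' hml
    have r3 : (H \ fromEdgeSet {s(a, b)}).Reachable b ((S.p r).vert m) :=
      reachable_of_edges (S.p r) hkm fun i h1 h2 => hadj' _ _ ((S.p r).adj (by omega))
        (Or.inl (Or.inr ((S.p r).edge_mem (by omega)))) (by
          rw [ha, hb]
          intro h
          rcases Sym2.eq_iff.1 h with ⟨h, -⟩ | ⟨-, h⟩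
          · have := (S.p r).vert_inj (by omega) (by omega) h
            omega
          · have := (S.p r).vert_inj (by omega) (by omega) h
            omega)
    exact (r1.trans r2).trans r3.symm
  unfold IsAcyclic at hnot
  push Not at hnot
  obtain ⟨v, c, hc⟩ := hnot
  refine ⟨{e | e ∈ c.edges}, fun e he => ?_, v, c.mapLe hHG, hc.mapLe hHG, ?_⟩
  · have := c.edges_subset_edgeSet he
    rw [hH, edgeSet_fromEdgeSet] at this
    exact this.1
  · simp

variable (S)

/-- `root` is the greatest element, and every path has no or exactly two children. -/
structure Binary (root : κ) : Prop where
  le_root : ∀ i, S.Le i root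
  binary : ∀ q, (∀ i, S.Le i q → i = q) ∨ ∃ r l, S.Kids q r l

variable {S}

theorem Binary.mirror {root : κ} (h : S.Binary root) : S.mirror.Binary root := by
  refine ⟨fun i => (mirror_le S).2 (h.le_root i), fun q => ?_⟩
  rcases h.binary q with h1 | ⟨r, l, h1⟩
  · exact Or.inl fun i hi => h1 i ((mirror_le S).1 hi)
  · exact Or.inr ⟨l, r, h1.mirror⟩

theorem Binary.exists_kids {root q c : κ} (h : S.Binary root) (hc : S.IsChild c q) :
    ∃ r l, S.Kids q r l := by
  rcases h.binary q with h1 | h1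
  · exact absurd (h1 c hc.2.1) hc.1
  · exact h1

/-- Every cycle in the union of the paths contains both extremal edges of the lower boundary of
a face. -/
theorem exists_exits [Finite κ] {root : κ} (hB : S.Binary root) {C : Set (Sym2 V)}
    (hC : NoLeaf C) (hne : C.Nonempty) (hsub : ∀ e ∈ C, ∃ i, e ∈ (S.p i).edges) :
    ∃ q r l, S.Kids q r l ∧ (∃ e ∈ C, S.Exit q r l e) ∧ ∃ e ∈ C, S.mirror.Exit q l r e := by
  -- On the way up from `s` to `t` there is a last path containing `e`; its parent no longer does.
  have hclimb : ∀ (e : Sym2 V) (s t : κ), e ∈ (S.p s).edges → S.Le s t → e ∉ (S.p t).edges →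
      ∃ m q, S.IsChild m q ∧ S.Le q t ∧ e ∈ (S.p m).edges ∧ e ∉ (S.p q).edges := by
    intro e s t hs hst ht
    obtain ⟨m, ⟨m1, m2⟩, hmax⟩ := S.exists_max (fun m => S.Le m t ∧ e ∈ (S.p m).edges) ⟨s, hst, hs⟩
    have hmt : m ≠ t := by rintro rfl; exact ht m2
    obtain ⟨q, hq, hqt⟩ := exists_parent m1 hmt
    refine ⟨m, q, hq, hqt, m2, fun h => ?_⟩
    have := hmax q ⟨hqt, h⟩
    have := hq.2.1.size_lt hq.1
    omega
  have hn := hC.not_subset_path hne (S.p root)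
  rw [Set.not_subset] at hn
  obtain ⟨e₁, he₁, he₁r⟩ := hn
  obtain ⟨s₁, hs₁⟩ := hsub e₁ he₁
  obtain ⟨m₁, q₁, h1, -, h2, h3⟩ := hclimb e₁ s₁ root hs₁ (hB.le_root s₁) he₁r
  -- A lowest place at which the cycle loses an edge in passing from a child to its parent.
  obtain ⟨q, ⟨m, e, hmq, heC, hem, heq⟩, hmin⟩ := S.exists_min (fun q => ∃ m e, S.IsChild m q ∧
    e ∈ C ∧ e ∈ (S.p m).edges ∧ e ∉ (S.p q).edges) ⟨q₁, m₁, e₁, h1, he₁, h2, h3⟩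
  obtain ⟨r, l, hk⟩ := hB.exists_kids hmq
  -- By separation such an edge belongs to a path strictly below `q`, and by minimality it survives
  -- the climb to the child of `q`. So off `q`, as seen from the children, the cycle stays on the
  -- children.
  have hloc : ∀ e ∈ C, ∀ v ∈ e, v ∉ (S.p q).verts → (v ∈ (S.p r).verts ∨ v ∈ (S.p l).verts) →
      e ∈ (S.p r).edges ∨ e ∈ (S.p l).edges := by
    intro e he v hv hvq hvrl
    obtain ⟨s, hs⟩ := hsub e he
    have hvs := mem_verts_of_mem hs hv
    have hsq : S.Le s q := by
      by_contra hsq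
      rcases hvrl with h | h
      · exact hvq (sep hk.right_le hsq h hvs)
      · exact hvq (sep hk.left_le hsq h hvs)
    have hne : s ≠ q := by rintro rfl; exact hvq hvs
    have key : ∀ c, S.IsChild c q → S.Le s c → e ∈ (S.p c).edges := by
      intro c hc hsc
      by_contra hcon
      obtain ⟨m', q', h1, h2, h3, h4⟩ := hclimb e s c hs hsc hcon
      have h5 := hmin q' ⟨m', e, h1, he, h3, h4⟩
      have h6 : S.size q' ≤ S.size c := by
        by_cases h7 : q' = c
        · rw [h7]
        · exact (h2.size_lt h7).le
      have h8 := hc.2.1.size_lt hc.1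
      omega
    rcases hk.le_or_le hsq hne with h | h
    · exact Or.inl (key r hk.right h)
    · exact Or.inr (key l hk.left h)
  have hem' : e ∈ (S.p r).edges ∨ e ∈ (S.p l).edges := by
    rcases (hk.2 m).1 hmq with rfl | rfl
    · exact Or.inl hem
    · exact Or.inr hem
  refine ⟨q, r, l, hk, ?_, ?_⟩
  · obtain ⟨e', h1, h2, -⟩ := exits_of_noLeaf hk.right_le hk.left_le hk.1 hC hloc heC hem' heq
    exact ⟨e', h1, h2⟩
  · obtain ⟨e', h1, h2, -⟩ := exits_of_noLeaf (S := S.mirror) hk.mirror.right_le hk.mirror.left_le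
      hk.mirror.1 hC (fun e he v hv hvq hvrl => by
        rw [mirror_verts] at hvq hvrl
        rw [mirror_verts] at hvrl
        rw [mirror_edges, mirror_edges]
        exact (hloc e he v hv hvq hvrl.symm).symm) heC
      (by rw [mirror_edges, mirror_edges]; exact hem'.symm) (by rwa [mirror_edges])
    exact ⟨e', h1, h2⟩

/-- Every path through the exit edge of `r` is below `r`. -/
theorem Exit.le [Finite κ] {q r l s : κ} {e : Sym2 V} (hk : S.Kids q r l) (he : S.Exit q r l e)
    (hs : e ∈ (S.p s).edges) : S.Le s r := by
  obtain ⟨k, hk', rfl, h1, h2, h3, -⟩ := he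
  have her := (S.p r).edge_mem hk'
  have hsq : S.Le s q := by
    by_contra hsq
    exact h2 (sep_edge hk.right_le hsq her hs)
  have hne : s ≠ q := by rintro rfl; exact h2 hs
  rcases hk.le_or_le hsq hne with h | h
  · exact h
  · exfalso
    exact h3 (sep h (fun h' => hk.not_le (Le.refl r) h') (GPath.left_mem_verts hs)
      (GPath.vert_mem _ _))

end PathSystem

/-! ### The paths touching a given path -/

namespace PathSystem

variable {V : Type*} {G : SimpleGraph V} {κ : Type*} (S : PathSystem G κ)

/-- `q ≼ p` has a common vertex with `p`. -/
def Touch (p q : κ) : Prop := S.Le q p ∧ ((S.p q).verts ∩ (S.p p).verts).Nonempty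

/-- `s` is the leftmost one of the children of `t` that touch `p`. -/
def LStep (p t s : κ) : Prop :=
  S.IsChild s t ∧ S.Touch p s ∧ ∀ c, S.IsChild c t → S.Touch p c → c ≠ s → S.hi c ≤ S.lo s

variable {S}

theorem mirror_touch {p q : κ} : S.mirror.Touch p q ↔ S.Touch p q := by
  rw [Touch, Touch, mirror_le, mirror_verts, mirror_verts]

theorem Touch.refl (p : κ) : S.Touch p p := by
  refine ⟨Le.refl p, ?_⟩
  rw [Set.inter_self]
  exact ⟨_, GPath.vert_mem (S.p p) 0⟩

theorem Touch.of_mem {p q : κ} (h : S.Le q p) {v : V} (h1 : v ∈ (S.p q).verts)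
    (h2 : v ∈ (S.p p).verts) : S.Touch p q := ⟨h, v, h1, h2⟩

theorem Touch.of_edge {p q : κ} (h : S.Le q p) {e : Sym2 V} (h1 : e ∈ (S.p q).edges)
    (h2 : e ∈ (S.p p).edges) : S.Touch p q := by
  induction e with
  | _ u v => exact .of_mem h (GPath.left_mem_verts h1) (GPath.left_mem_verts h2)

/-- A contact of `s` with `p` lies on every path between them. -/
theorem Touch.mono {p q s : κ} (h : S.Touch p s) (h1 : S.Le s q) (h2 : S.Le q p) :
    S.Touch p q := by
  obtain ⟨-, v, hv, hvp⟩ := h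
  exact ⟨h2, v, sep_le h1 h2 hv hvp, hvp⟩

theorem LStep.eq_of_one {p t s c : κ} (h : S.LStep p t s)
    (hc : ∀ i, S.IsChild i t ∧ S.Touch p i ↔ i = c) : s = c := (hc s).1 ⟨h.1, h.2.1⟩

theorem LStep.eq_left {p t s r l : κ} (h : S.LStep p t s) (hk : S.Kids t r l)
    (hl : S.Touch p l) : s = l := by
  rcases (hk.2 s).1 h.1 with rfl | rfl
  · have h1 := h.2.2 l hk.left hl hk.ne.symm
    have h2 := hk.1
    have h3 := S.lo_lt_hi s
    have h4 := S.lo_lt_hi l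
    omega
  · rfl

/-- A path touching `p` through an edge of `t` that comes after `p` on `t` is reached from `t` by
going to the leftmost touching children. -/
theorem chain_of_edge [Finite κ] {root p : κ} (hB : S.Binary root) :
    ∀ (n : ℕ) (t s : κ), S.size t ≤ n → S.Le t p → S.Le s t → S.Touch p s →
      ∀ j < (S.p t).len, s((S.p t).vert j, (S.p t).vert (j + 1)) ∈ (S.p s).edges →
      (∀ i ≤ (S.p t).len, (S.p t).vert i ∈ (S.p p).verts → i ≤ j) →
      Relation.ReflTransGen (S.LStep p) t s := by
  intro n
  induction n with
  | zero =>
    intro t s hn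
    have := S.lo_lt_hi t
    unfold size at hn
    omega
  | succ n ih =>
    intro t s hn htp hst hs j hj hjs hafter
    by_cases hne : s = t
    · rw [hne]
    obtain ⟨c, hc, hsc⟩ := exists_child_ge hst hne
    have hcp := hc.2.1.trans htp
    have hcT := hs.mono hsc hcp
    have hjc := sep_le_edge hsc hc.2.1 hjs ((S.p t).edge_mem hj)
    obtain ⟨k, hk, hkj⟩ := GPath.mem_edges.1 hjc
    have hdir : (S.p c).vert k = (S.p t).vert j ∧ (S.p c).vert (k + 1) = (S.p t).vert (j + 1) := by
      rcases Sym2.eq_iff.1 hkj with ⟨h1, h2⟩ | ⟨h1, h2⟩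
      · exact ⟨h1.symm, h2.symm⟩
      · have := S.same_direction c t hc.2.1 k (k + 1) _ _ (by omega) hk hj hj.le h2.symm h1.symm
        omega
    -- Contacts of `c` with `p` lie on `t`, and `c` and `t` agree in direction, so the edge still
    -- comes after `p` on `c`.
    have hafter' : ∀ i ≤ (S.p c).len, (S.p c).vert i ∈ (S.p p).verts → i ≤ k := by
      intro i hi hip
      by_contra hlt
      obtain ⟨i', hi', hii⟩ := GPath.mem_verts.1 (sep_le hc.2.1 htp (GPath.vert_mem _ i) hip)
      have h1 := hafter i' hi' (hii ▸ hip)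
      have h2 := S.same_direction c t hc.2.1 k i j i' (by omega) hi hj.le hi' hdir.1 hii.symm
      omega
    refine Relation.ReflTransGen.head ⟨hc, hcT, fun c' hc' hc'T hne' => ?_⟩
      (ih c s (by have := hc.2.1.size_lt hc.1; omega) hcp hsc hs k hk (by rwa [← hkj]) hafter')
    obtain ⟨r, l, hkids⟩ := hB.exists_kids hc
    rcases (hkids.2 c).1 hc with rfl | rfl <;> rcases (hkids.2 c').1 hc' with rfl | rfl
    · exact absurd rfl hne'
    -- Were `c` the right child, a contact of the left child with `p` would be on `t` at or before
    -- vertex `j`, while `c` contains vertex `j + 1`: this contradicts `order_top`.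
    · exfalso
      obtain ⟨-, v, hv, hvp⟩ := hc'T
      obtain ⟨i, hi, rfl⟩ := GPath.mem_verts.1 (sep_le hc'.2.1 htp hv hvp)
      have h1 := hafter i hi hvp
      have h2 := S.order_top t c c' hc.2.1.1 hkids.1 hc'.2.1.2 (j + 1) i hj hi
        (hdir.2 ▸ GPath.vert_mem _ _) hv
      omega
    · exact hkids.1
    · exact absurd rfl hne'

/-- The paths that interfere at the right end with a face between touching paths touch. -/
theorem Exit.chain [Finite κ] {root p q r l s : κ} (hB : S.Binary root) (hk : S.Kids q r l)
    (hq : S.Le q p) {e : Sym2 V} (he : S.Exit q r l e) (hs : S.Touch p s)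
    (hes : e ∈ (S.p s).edges) : Relation.ReflTransGen (S.LStep p) r s := by
  have hsr := he.le hk hes
  obtain ⟨k, hk', rfl, h1, h2, -⟩ := he
  refine chain_of_edge hB _ r s le_rfl (hk.right_le.trans hq) hsr hs k hk' hes fun i hi hip => ?_
  by_contra hlt
  exact h2 (S.contig r q k i (by omega) hi h1 (sep_le hk.right_le hq (GPath.vert_mem _ i) hip) k
    le_rfl (by omega))

/-- On `q` the exit vertex lies between a contact of `r` with `p` and a contact of `l` with `p`.
Both are on `q`, so `p` runs along `q` between them and contains the exit vertex. -/
theorem Exit.touch [Finite κ] {p q r l s : κ} (hk : S.Kids q r l) (hq : S.Le q p)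
    (hr : S.Touch p r) (hl : S.Touch p l) {e : Sym2 V} (he : S.Exit q r l e)
    (hes : e ∈ (S.p s).edges) : S.Touch p s := by
  have hsr := he.le hk hes
  obtain ⟨k, hk', rfl, h1, h2, -⟩ := he
  refine Touch.of_mem ((hsr.trans hk.right_le).trans hq) (GPath.left_mem_verts hes) ?_
  obtain ⟨-, u, hu, hup⟩ := hr
  obtain ⟨-, w, hw, hwp⟩ := hl
  have huq := sep_le hk.right_le hq hu hup
  have hwq := sep_le hk.left_le hq hw hwp
  obtain ⟨i, hi, rfl⟩ := GPath.mem_verts.1 hu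
  obtain ⟨a, ha, hai⟩ := GPath.mem_verts.1 huq
  obtain ⟨b, hb, rfl⟩ := GPath.mem_verts.1 hwq
  obtain ⟨x, hx, hxk⟩ := GPath.mem_verts.1 h1
  have hik : i ≤ k := by
    by_contra hlt
    exact h2 (S.contig r q k i (by omega) hi h1 huq k le_rfl (by omega))
  have hxb : x ≤ b := S.order_top q r l hk.right_le.1 hk.1 hk.left_le.2 x b hx hb
    (hxk ▸ GPath.vert_mem _ _) hw
  have hax : a ≤ x := by
    rcases hik.eq_or_lt with rfl | hlt
    · exact ((S.p q).vert_inj ha hx (hai.trans hxk.symm)).le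
    · exact (S.same_direction r q hk.right_le i k a x hlt hk'.le ha hx hai.symm hxk.symm).le
  rw [← hxk]
  rcases hxb.eq_or_lt with rfl | hlt
  · exact hwp
  · exact (S.contig q p).vert hb (by rwa [hai]) hwp hax hxb

end PathSystem

/-! ### Binary families as path systems -/

namespace BinaryFamily

variable {V : Type*} [Finite V] {M : PlaneGraph V} {κ : Type*} (B : BinaryFamily M κ)

/-- The path system of a binary family. -/
noncomputable def system : PathSystem M.G κ := B.layout.system B.singleTouch

theorem system_verts (i : κ) : (B.system.p i).verts = (B.path i).verts := B.layout.region_verts i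

theorem system_edges (i : κ) : (B.system.p i).edges = (B.path i).edges := B.layout.region_edges i

theorem system_le {i j : κ} : B.system.Le i j ↔ B.Le i j := by
  change ((B.layout.lo j : ℤ) ≤ B.layout.lo i ∧ (B.layout.hi i : ℤ) ≤ B.layout.hi j) ↔ _
  rw [Int.ofNat_le, Int.ofNat_le]
  exact Iff.rfl

theorem system_isChild {c q : κ} : B.system.IsChild c q ↔ B.IsChild c q := by
  simp only [PathSystem.IsChild, IsChild, system_le]

theorem system_kids {q r l : κ} : B.system.Kids q r l ↔ B.Children q r l := by
  simp only [PathSystem.Kids, Children, system_isChild]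
  change (B.layout.hi r : ℤ) ≤ B.layout.lo l ∧ _ ↔ _
  rw [Int.ofNat_le]

theorem system_touch {p q : κ} : B.system.Touch p q ↔ B.Touch p q := by
  rw [PathSystem.Touch, Touch, system_le, system_verts, system_verts]

theorem system_binary : B.system.Binary B.root := by
  refine ⟨fun i => B.system_le.2 (B.le_root i), fun q => ?_⟩
  rcases B.binary q with h | ⟨r, l, h1, h2⟩
  · exact Or.inl fun i hi => h i (B.system_le.1 hi).1 (B.system_le.1 hi).2
  · refine Or.inr ⟨r, l, B.system_kids.2 ⟨h1, fun c => ?_⟩⟩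
    rw [← h2]
    simp only [IsChild, Le, and_imp, and_assoc]

variable {B}

/-- Replaces extremal edges, which refer to a face cycle, by exit edges, which refer to the three
paths only; `extremalEdge_of_exits` is the converse. -/
theorem ExtremalEdge.cases {q c : κ} {e : Sym2 V} (h : B.ExtremalEdge q c e) :
    ∃ r l, B.system.Kids q r l ∧
      (c = r ∧ B.system.Exit q r l e ∨ c = l ∧ B.system.mirror.Exit q l r e) := by
  obtain ⟨h1, h2, C, ⟨r, l, h3, h4, h5⟩, h6, v, hv, hvq⟩ := h
  have hk := B.system_kids.2 h3
  have hC : B.system.IsCycleOn q r l C := by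
    refine ⟨?_, h5⟩
    rw [system_edges, system_edges, system_edges]
    exact h4
  rw [← system_edges] at h2 h6
  rw [← system_verts] at hvq
  refine ⟨r, l, hk, ?_⟩
  rcases (hk.2 c).1 (B.system_isChild.2 h1) with rfl | rfl
  · exact Or.inl ⟨rfl, hC.exit_of_mem hk.right_le hk.left_le hk.1 h6.1 h2 h6.2 hv hvq⟩
  · exact Or.inr ⟨rfl, hC.mirror.exit_of_mem hk.mirror.right_le hk.mirror.left_le hk.mirror.1 h6.1
      (by rwa [PathSystem.mirror_edges]) (by rw [PathSystem.mirror_edges]; exact h6.2) hv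
      (by rwa [PathSystem.mirror_verts])⟩

theorem extremalEdge_of_exits {q r l : κ} (hk : B.system.Kids q r l) {e e' : Sym2 V}
    (he : B.system.Exit q r l e) (he' : B.system.mirror.Exit q l r e') :
    B.ExtremalEdge q r e ∧ B.ExtremalEdge q l e' := by
  obtain ⟨C, hC, heC, heC'⟩ := PathSystem.exists_cycleOn hk.right_le hk.left_le hk.1 he he'
  have hface : B.IsFaceBoundary q C := by
    refine ⟨r, l, B.system_kids.1 hk, ?_, hC.2⟩
    have := hC.1
    rwa [system_edges, system_edges, system_edges] at this
  obtain ⟨k, hk1, rfl, hkq, hnq, -⟩ := he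
  obtain ⟨k', hk1', rfl, hkq', hnq', -⟩ := he'
  rw [PathSystem.mirror_verts, system_verts] at hkq'
  rw [PathSystem.mirror_edges, system_edges] at hnq'
  rw [system_verts] at hkq
  rw [system_edges] at hnq
  refine ⟨⟨B.system_isChild.1 hk.right, ?_, C, hface, ⟨heC, hnq⟩, _, Sym2.mem_mk_left _ _, hkq⟩,
    ⟨B.system_isChild.1 hk.left, ?_, C, hface, ⟨heC', hnq'⟩, _, Sym2.mem_mk_left _ _, hkq'⟩⟩
  · rw [← system_edges]
    exact GPath.edge_mem _ hk1
  · rw [← system_edges, ← PathSystem.mirror_edges]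
    exact GPath.edge_mem _ hk1'

theorem ExtremalEdge.le [Finite κ] {q c s : κ} {e : Sym2 V} (h : B.ExtremalEdge q c e)
    (hs : e ∈ (B.path s).edges) : B.system.Le s c := by
  obtain ⟨r, l, hk, ⟨rfl, he⟩ | ⟨rfl, he⟩⟩ := h.cases
  · exact he.le hk (by rwa [system_edges])
  · exact (PathSystem.mirror_le _).1
      (he.le hk.mirror (by rwa [PathSystem.mirror_edges, system_edges]))

theorem ExtremalEdge.unique {q q' c : κ} {e e' : Sym2 V} (h : B.ExtremalEdge q c e)
    (h' : B.ExtremalEdge q' c e') : e = e' := by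
  obtain rfl := (B.system_isChild.2 h.1).parent_unique (B.system_isChild.2 h'.1)
  obtain ⟨r, l, hk, h1⟩ := h.cases
  obtain ⟨r', l', hk', h1'⟩ := h'.cases
  obtain ⟨rfl, rfl⟩ := hk.unique hk'
  rcases h1 with ⟨rfl, he⟩ | ⟨rfl, he⟩ <;> rcases h1' with ⟨h2, he'⟩ | ⟨h2, he'⟩
  · exact he.unique he'
  · exact absurd h2 hk.ne
  · exact absurd h2.symm hk.ne
  · exact he.unique he'

theorem Max.ne {p m : κ} (h : B.Max p m) : m ≠ p := by
  rintro rfl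
  exact h.2.1 (B.system_touch.1 (PathSystem.Touch.refl m))

theorem Max.ne_root {p m : κ} (h : B.Max p m) : m ≠ B.root := by
  rintro rfl
  exact h.ne ((B.system_le.2 h.1).antisymm (B.system_binary.le_root p))

theorem Max.exists_ge [Finite κ] {p s : κ} (h : B.Le s p) (hs : ¬ B.Touch p s) :
    ∃ m, B.Max p m ∧ B.Le s m := by
  obtain ⟨m, ⟨h1, h2, h3⟩, hmax⟩ := B.system.exists_max
    (fun m => B.Le s m ∧ B.Le m p ∧ ¬ B.Touch p m) ⟨s, B.system_le.1 (PathSystem.Le.refl s), h, hs⟩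
  refine ⟨m, ⟨h2, h3, fun i hip hi hmi => ?_⟩, h1⟩
  by_contra hne
  have h4 := (B.system_le.2 hmi).size_lt (Ne.symm hne)
  have h5 := hmax i ⟨B.system_le.1 ((B.system_le.2 h1).trans (B.system_le.2 hmi)), hip, hi⟩
  omega

/-- Touching is inherited by ancestors below `p`, so every path strictly between `m` and `p` touches
`p`. -/
theorem Max.of_isChild {p q m : κ} (hq : B.Touch p q) (hm : B.IsChild m q)
    (hmt : ¬ B.Touch p m) : B.Max p m := by
  have hm' := B.system_isChild.2 hm
  have hq' := B.system_touch.2 hq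
  refine ⟨B.system_le.1 (hm'.2.1.trans hq'.1), hmt, fun i hip hi hmi => ?_⟩
  rw [← system_le] at hmi hip
  rcases hmi.total hm'.2.1 with h1 | h1
  · rcases hm'.2.2 i h1 hmi with h2 | h2
    · exact h2
    · exact absurd hq (h2 ▸ hi)
  · exact absurd (B.system_touch.1 (hq'.mono h1 hip)) hi

theorem Max.touch_parent [Finite κ] {p q m : κ} (h : B.Max p m) (hm : B.IsChild m q) :
    B.Touch p q := by
  by_contra hq
  have hqp := (B.system_isChild.2 hm).le_of_lt (B.system_le.2 h.1) h.ne
  exact hm.1 (h.2.2 q (B.system_le.1 hqp) hq hm.2.1).symm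

/-- Two members of `Max_p` below `q ≼ p` that share an edge of `q` coincide. -/
theorem Max.eq_of_edge {p q m m' : κ} (h : B.Max p m) (h' : B.Max p m') (hm : B.Le m q)
    (hm' : B.Le m' q) {e : Sym2 V} (he : e ∈ (B.path m).edges) (he' : e ∈ (B.path m').edges)
    (heq : e ∈ (B.path q).edges) : m = m' := by
  by_contra hne
  rw [← system_edges] at he he' heq
  refine PathSystem.no_common_edge (B.system_le.2 hm) (B.system_le.2 hm') (fun h1 => hne ?_)
    (fun h1 => hne ?_) heq he he'
  · exact (h.2.2 m' h'.1 h'.2.1 (B.system_le.1 h1)).symm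
  · exact h'.2.2 m h.1 h.2.1 (B.system_le.1 h1)

/-- Every path touches some path of some level. -/
theorem exists_level_touch [Finite κ] (s : κ) : ∃ n, ∃ p ∈ B.MAXLevel n, B.Touch p s := by
  obtain ⟨p, ⟨⟨n, hn⟩, hsp⟩, hmin⟩ := B.system.exists_min
    (fun p => (∃ n, p ∈ B.MAXLevel n) ∧ B.Le s p) ⟨B.root, ⟨0, rfl⟩, B.le_root s⟩
  refine ⟨n, p, hn, ?_⟩
  by_contra hs
  -- Otherwise the next level has a smaller path still above `s`.
  obtain ⟨m, hm, hsm⟩ := Max.exists_ge hsp hs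
  have h1 := hmin m ⟨⟨n + 1, p, hn, hm⟩, hsm⟩
  have h2 := (B.system_le.2 hm.1).size_lt hm.ne
  omega

/-! ### The labels given by the procedures -/

variable {σ : Vars κ}

open Relation

/-- The call for the left child exchanges `c₁` and `c₂`, the call for the right child keeps `c₁`.
Thus leftmost chains carry at most these two labels and rightmost chains only `c₁`. -/
theorem RightColor.chain {p q : κ} {c₁ c₂ c₃ : Fin 4} (h : B.RightColor σ p q c₁ c₂ c₃) :
    (∀ s, ReflTransGen (B.system.LStep p) q s → σ.label s = c₁ ∨ σ.label s = c₂) ∧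
    ∀ s, ReflTransGen (B.system.mirror.LStep p) q s → σ.label s = c₁ := by
  induction h with
  | none h1 h2 =>
    refine ⟨fun s hs => ?_, fun s hs => ?_⟩ <;> rcases hs.cases_head with rfl | ⟨t, ht, -⟩
    · exact Or.inl h1
    · exact absurd (B.system_touch.1 ht.2.1) (h2 t (B.system_isChild.1 ht.1))
    · exact h1
    · exact absurd (B.system_touch.1 (PathSystem.mirror_touch.1 ht.2.1))
        (h2 t (B.system_isChild.1 ((PathSystem.mirror_isChild _).1 ht.1)))
  | one h1 h2 _ ih =>
    refine ⟨fun s hs => ?_, fun s hs => ?_⟩ <;> rcases hs.cases_head with rfl | ⟨t, ht, hts⟩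
    · exact Or.inl h1
    · obtain rfl := ht.eq_of_one (by simpa only [system_isChild, system_touch] using h2)
      exact ih.1 s hts
    · exact h1
    · obtain rfl := ht.eq_of_one (by simpa only [PathSystem.mirror_isChild,
        PathSystem.mirror_touch, system_isChild, system_touch] using h2)
      exact ih.2 s hts
  | two h1 hk hr hl _ _ ihr ihl =>
    have hk' := B.system_kids.2 hk
    refine ⟨fun s hs => ?_, fun s hs => ?_⟩ <;> rcases hs.cases_head with rfl | ⟨t, ht, hts⟩
    · exact Or.inl h1
    · obtain rfl := ht.eq_left hk' (B.system_touch.2 hl)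
      exact (ihl.1 s hts).symm
    · exact h1
    · obtain rfl := ht.eq_left hk'.mirror (PathSystem.mirror_touch.2 (B.system_touch.2 hr))
      exact ihr.2 s hts

theorem LeftColor.chain {p q : κ} {c₁ c₂ c₃ : Fin 4} (h : B.LeftColor σ p q c₁ c₂ c₃) :
    (∀ s, ReflTransGen (B.system.LStep p) q s → σ.label s = c₁) ∧
    ∀ s, ReflTransGen (B.system.mirror.LStep p) q s → σ.label s = c₁ ∨ σ.label s = c₂ := by
  induction h with
  | none h1 h2 =>
    refine ⟨fun s hs => ?_, fun s hs => ?_⟩ <;> rcases hs.cases_head with rfl | ⟨t, ht, -⟩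
    · exact h1
    · exact absurd (B.system_touch.1 ht.2.1) (h2 t (B.system_isChild.1 ht.1))
    · exact Or.inl h1
    · exact absurd (B.system_touch.1 (PathSystem.mirror_touch.1 ht.2.1))
        (h2 t (B.system_isChild.1 ((PathSystem.mirror_isChild _).1 ht.1)))
  | one h1 h2 _ ih =>
    refine ⟨fun s hs => ?_, fun s hs => ?_⟩ <;> rcases hs.cases_head with rfl | ⟨t, ht, hts⟩
    · exact h1
    · obtain rfl := ht.eq_of_one (by simpa only [system_isChild, system_touch] using h2)
      exact ih.1 s hts
    · exact Or.inl h1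
    · obtain rfl := ht.eq_of_one (by simpa only [PathSystem.mirror_isChild,
        PathSystem.mirror_touch, system_isChild, system_touch] using h2)
      exact ih.2 s hts
  | two h1 hk hr hl _ _ ihl ihr =>
    have hk' := B.system_kids.2 hk
    refine ⟨fun s hs => ?_, fun s hs => ?_⟩ <;> rcases hs.cases_head with rfl | ⟨t, ht, hts⟩
    · exact h1
    · obtain rfl := ht.eq_left hk' (B.system_touch.2 hl)
      exact ihl.1 s hts
    · exact Or.inl h1
    · obtain rfl := ht.eq_left hk'.mirror (PathSystem.mirror_touch.2 (B.system_touch.2 hr))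
      exact (ihr.2 s hts).symm

/-- Going left, the parameter `cl` is kept until a possible `RightColor` call with `(cl, special p,
d)`, whose leftmost chains use just `cl` and `special p`; symmetrically on the right. -/
theorem SetColor.chain {p q : κ} {cr cl : Fin 4} (h : B.SetColor σ p q cr cl) :
    (∀ s, ReflTransGen (B.system.LStep p) q s → σ.label s = σ.special p ∨ σ.label s = cl) ∧
    ∀ s, ReflTransGen (B.system.mirror.LStep p) q s →
      σ.label s = σ.special p ∨ σ.label s = cr := by
  induction h with
  | none h1 h2 =>
    refine ⟨fun s hs => ?_, fun s hs => ?_⟩ <;> rcases hs.cases_head with rfl | ⟨t, ht, -⟩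
    · exact Or.inl h1
    · exact absurd (B.system_touch.1 ht.2.1) (h2 t (B.system_isChild.1 ht.1))
    · exact Or.inl h1
    · exact absurd (B.system_touch.1 (PathSystem.mirror_touch.1 ht.2.1))
        (h2 t (B.system_isChild.1 ((PathSystem.mirror_isChild _).1 ht.1)))
  | one h1 h2 _ ih =>
    refine ⟨fun s hs => ?_, fun s hs => ?_⟩ <;> rcases hs.cases_head with rfl | ⟨t, ht, hts⟩
    · exact Or.inl h1
    · obtain rfl := ht.eq_of_one (by simpa only [system_isChild, system_touch] using h2)
      exact ih.1 s hts
    · exact Or.inl h1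
    · obtain rfl := ht.eq_of_one (by simpa only [PathSystem.mirror_isChild,
        PathSystem.mirror_touch, system_isChild, system_touch] using h2)
      exact ih.2 s hts
  | right h1 hk hr hl _ _ _ hright ih =>
    have hk' := B.system_kids.2 hk
    refine ⟨fun s hs => ?_, fun s hs => ?_⟩ <;> rcases hs.cases_head with rfl | ⟨t, ht, hts⟩
    · exact Or.inl h1
    · obtain rfl := ht.eq_left hk' (B.system_touch.2 hl)
      exact (hright.chain.1 s hts).symm
    · exact Or.inl h1
    · obtain rfl := ht.eq_left hk'.mirror (PathSystem.mirror_touch.2 (B.system_touch.2 hr))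
      exact ih.2 s hts
  | left h1 hk hr hl _ _ _ hleft ih =>
    have hk' := B.system_kids.2 hk
    refine ⟨fun s hs => ?_, fun s hs => ?_⟩ <;> rcases hs.cases_head with rfl | ⟨t, ht, hts⟩
    · exact Or.inl h1
    · obtain rfl := ht.eq_left hk' (B.system_touch.2 hl)
      exact ih.1 s hts
    · exact Or.inl h1
    · obtain rfl := ht.eq_left hk'.mirror (PathSystem.mirror_touch.2 (B.system_touch.2 hr))
      exact (hleft.chain.2 s hts).symm

/-- The paths through the special edge of `p` get the label `special p`. -/
theorem SetColor.label_of_special [Finite κ] {p q : κ} {cr cl : Fin 4}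
    (h : B.SetColor σ p q cr cl) (hp : p ≠ B.root) (hq : B.Le q p) {e : Sym2 V}
    (he : B.SpecialEdge p e) (hep : e ∈ (B.path p).edges) {s : κ} (hs : B.Le s q)
    (hes : e ∈ (B.path s).edges) : σ.label s = σ.special p := by
  have htouch : ∀ c, B.system.Le s c → B.system.Le c p → B.Touch p c := fun c h1 h2 =>
    B.system_touch.1 (.of_edge h2 (PathSystem.sep_le_edge h1 h2 (by rwa [system_edges])
      (by rwa [system_edges])) (by rwa [system_edges]))
  have hedge : ∀ c, B.system.Le s c → B.system.Le c p → e ∈ (B.system.p c).edges := fun c h1 h2 =>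
    PathSystem.sep_le_edge h1 h2 (by rwa [system_edges]) (by rwa [system_edges])
  have huniq : ∀ e', B.SpecialEdge p e' → e' = e := by
    intro e' he'
    obtain ⟨h1, -⟩ | ⟨-, q, hq⟩ := he
    · exact absurd h1 hp
    obtain ⟨h1, -⟩ | ⟨-, q', hq'⟩ := he'
    · exact absurd h1 hp
    exact hq'.unique hq
  induction h with
  | @none q cr cl h1 h2 =>
    by_cases hsq : s = q
    · rw [hsq, h1]
    obtain ⟨c, hc, hsc⟩ := PathSystem.exists_child_ge (B.system_le.2 hs) hsq
    exact absurd (htouch c hsc (hc.2.1.trans (B.system_le.2 hq))) (h2 c (B.system_isChild.1 hc))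
  | @one q q' cr cl h1 h2 _ ih =>
    by_cases hsq : s = q
    · rw [hsq, h1]
    obtain ⟨c, hc, hsc⟩ := PathSystem.exists_child_ge (B.system_le.2 hs) hsq
    have hcp := hc.2.1.trans (B.system_le.2 hq)
    obtain rfl := (h2 c).1 ⟨B.system_isChild.1 hc, htouch c hsc hcp⟩
    exact ih (B.system_le.1 hcp) (B.system_le.1 hsc)
  | @right q r l cr cl d h1 hk hr hl hsp _ _ _ ih =>
    by_cases hsq : s = q
    · rw [hsq, h1]
    have hk' := B.system_kids.2 hk
    have hq' := B.system_le.2 hq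
    rcases hk'.le_or_le (B.system_le.2 hs) hsq with hsc | hsc
    · exact ih (B.system_le.1 (hk'.right_le.trans hq')) (B.system_le.1 hsc)
    -- The special edge lies on the right child, so a path below the left child containing it would
    -- put it on both children and on `p`.
    · exfalso
      obtain ⟨e', he', her⟩ := hsp
      rw [huniq e' he', ← system_edges] at her
      exact PathSystem.no_common_edge (hk'.right_le.trans hq') (hk'.left_le.trans hq')
        (fun h => hk'.not_le (.refl _) h) (fun h => hk'.not_le h (.refl _))
        (by rwa [system_edges]) her (hedge l hsc (hk'.left_le.trans hq'))
  | @left q r l cr cl d h1 hk hr hl hsp _ _ _ ih =>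
    by_cases hsq : s = q
    · rw [hsq, h1]
    have hk' := B.system_kids.2 hk
    have hq' := B.system_le.2 hq
    rcases hk'.le_or_le (B.system_le.2 hs) hsq with hsc | hsc
    · refine absurd ⟨e, he, ?_⟩ hsp
      rw [← system_edges]
      exact hedge r hsc (hk'.right_le.trans hq')
    · exact ih (B.system_le.1 (hk'.left_le.trans hq')) (B.system_le.1 hsc)

variable (B σ)

/-- There is a call of one of the three procedures for `q`, with labels of `triple p`. -/
def Called (p q : κ) : Prop :=
  (∃ cr ∈ σ.triple p \ {σ.special p}, ∃ cl ∈ σ.triple p \ {σ.special p},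
    B.SetColor σ p q cr cl) ∨
  ∃ c₁ c₂ c₃, c₁ ≠ c₂ ∧ c₁ ≠ c₃ ∧ c₂ ≠ c₃ ∧ σ.triple p = {c₁, c₂, c₃} ∧
    (B.RightColor σ p q c₁ c₂ c₃ ∨ B.LeftColor σ p q c₁ c₂ c₃)

variable {B σ}

theorem third_label {T : Finset (Fin 4)} (hT : T.card = 3) {a b d : Fin 4} (ha : a ∈ T \ {b})
    (hb : b ∈ T) (hd : {d} = T \ {a, b}) :
    a ≠ b ∧ a ≠ d ∧ b ≠ d ∧ T = {a, b, d} := by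
  have h : d ∈ T \ {a, b} := hd ▸ Finset.mem_singleton_self d
  simp only [Finset.mem_sdiff, Finset.mem_singleton, Finset.mem_insert, not_or] at h ha
  refine ⟨ha.2, Ne.symm h.2.1, Ne.symm h.2.2, (Finset.eq_of_subset_of_card_le ?_ ?_).symm⟩
  · intro x hx
    simp only [Finset.mem_insert, Finset.mem_singleton] at hx
    rcases hx with rfl | rfl | rfl
    exacts [ha.1, hb, h.1]
  · rw [hT, Finset.card_insert_of_notMem, Finset.card_pair (Ne.symm h.2.2)]
    simp [ha.2, Ne.symm h.2.1]

/-- Nested calls only permute the labels of the triple, so the distinctness of the parameters is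
passed down. -/
theorem Called.child {p q c : κ} (hT : (σ.triple p).card = 3) (hsp : σ.special p ∈ σ.triple p)
    (h : B.Called σ p q) (hc : B.IsChild c q) (hcp : B.Touch p c) : B.Called σ p c := by
  rcases h with ⟨cr, hcr, cl, hcl, h⟩ | ⟨c₁, c₂, c₃, h1, h2, h3, h4, h | h⟩
  · cases h with
    | none _ h => exact absurd hcp (h c hc)
    | one _ h h' => exact Or.inl ⟨cr, hcr, cl, hcl, (h c).1 ⟨hc, hcp⟩ ▸ h'⟩
    | right _ hk _ _ _ hd h' h'' =>
      obtain ⟨k1, k2, k3, k4⟩ := third_label hT hcl hsp hd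
      rcases (hk.2 c).1 hc with rfl | rfl
      · refine Or.inl ⟨cr, hcr, _, ?_, h'⟩
        rw [k4]
        simp [Ne.symm k3]
      · exact Or.inr ⟨_, _, _, k1, k2, k3, k4, Or.inl h''⟩
    | left _ hk _ _ _ hd h' h'' =>
      obtain ⟨k1, k2, k3, k4⟩ := third_label hT hcr hsp hd
      rcases (hk.2 c).1 hc with rfl | rfl
      · exact Or.inr ⟨_, _, _, k1, k2, k3, k4, Or.inr h''⟩
      · refine Or.inl ⟨_, ?_, cl, hcl, h'⟩
        rw [k4]
        simp [Ne.symm k3]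
  · cases h with
    | none _ h => exact absurd hcp (h c hc)
    | one _ h h' => exact Or.inr ⟨c₁, c₂, c₃, h1, h2, h3, h4, Or.inl ((h c).1 ⟨hc, hcp⟩ ▸ h')⟩
    | two _ hk _ _ h' h'' =>
      rcases (hk.2 c).1 hc with rfl | rfl
      · exact Or.inr ⟨_, _, _, h2, h1, h3.symm, by rw [h4, Finset.pair_comm], Or.inl h'⟩
      · exact Or.inr ⟨_, _, _, h1.symm, h3, h2, by rw [h4, Finset.insert_comm], Or.inl h''⟩
  · cases h with
    | none _ h => exact absurd hcp (h c hc)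
    | one _ h h' => exact Or.inr ⟨c₁, c₂, c₃, h1, h2, h3, h4, Or.inr ((h c).1 ⟨hc, hcp⟩ ▸ h')⟩
    | two _ hk _ _ h' h'' =>
      rcases (hk.2 c).1 hc with rfl | rfl
      · exact Or.inr ⟨_, _, _, h1.symm, h3, h2, by rw [h4, Finset.insert_comm], Or.inr h''⟩
      · exact Or.inr ⟨_, _, _, h2, h1, h3.symm, by rw [h4, Finset.pair_comm], Or.inr h'⟩

theorem Called.label_mem {p q : κ} (hsp : σ.special p ∈ σ.triple p) (h : B.Called σ p q) :
    σ.label q ∈ σ.triple p := by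
  rcases h with ⟨cr, hcr, cl, hcl, h⟩ | ⟨c₁, c₂, c₃, h1, h2, h3, h4, h | h⟩
  · have : σ.label q = σ.special p := by cases h <;> assumption
    rwa [this]
  · rw [h.chain.2 q .refl, h4]; simp
  · rw [h.chain.1 q .refl, h4]; simp

/-- The labels on the two sides of a face between touching paths are different. -/
theorem Called.chain_ne {p q r l s t : κ} (hT : (σ.triple p).card = 3)
    (hsp : σ.special p ∈ σ.triple p) (h : B.Called σ p q) (hk : B.system.Kids q r l)
    (hr : B.Touch p r) (hl : B.Touch p l) (hs : ReflTransGen (B.system.LStep p) r s)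
    (ht : ReflTransGen (B.system.mirror.LStep p) l t) : σ.label s ≠ σ.label t := by
  have hone : ∀ c, ¬ ∀ i, B.IsChild i q ∧ B.Touch p i ↔ i = c := fun c h =>
    hk.ne (((h r).1 ⟨B.system_isChild.1 hk.right, hr⟩).trans
      ((h l).1 ⟨B.system_isChild.1 hk.left, hl⟩).symm)
  rcases h with ⟨cr, hcr, cl, hcl, h⟩ | ⟨c₁, c₂, c₃, h1, h2, h3, h4, h | h⟩
  · cases h with
    | none _ h => exact absurd hr (h r (B.system_isChild.1 hk.right))
    | one _ h => exact absurd h (hone _)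
    | right _ hk' _ _ _ hd h' h'' =>
      obtain ⟨rfl, rfl⟩ := hk.unique (B.system_kids.2 hk')
      obtain ⟨k1, k2, k3, k4⟩ := third_label hT hcl hsp hd
      -- The rightmost chain of the left child is constantly `cl`, while the leftmost chain of the
      -- right child avoids `cl`, since it carries `special p` and the third label `d`.
      rw [h''.chain.2 t ht]
      rcases h'.chain.1 s hs with h5 | h5 <;> rw [h5]
      exacts [k1.symm, k2.symm]
    | left _ hk' _ _ _ hd h' h'' =>
      obtain ⟨rfl, rfl⟩ := hk.unique (B.system_kids.2 hk')
      obtain ⟨k1, k2, k3, k4⟩ := third_label hT hcr hsp hd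
      rw [h''.chain.1 s hs]
      rcases h'.chain.2 t ht with h5 | h5 <;> rw [h5]
      exacts [k1, k2]
  · cases h with
    | none _ h => exact absurd hr (h r (B.system_isChild.1 hk.right))
    | one _ h => exact absurd h (hone _)
    | two _ hk' _ _ h' h'' =>
      obtain ⟨rfl, rfl⟩ := hk.unique (B.system_kids.2 hk')
      rw [h''.chain.2 t ht]
      rcases h'.chain.1 s hs with h5 | h5 <;> rw [h5]
      exacts [h1, h3.symm]
  · cases h with
    | none _ h => exact absurd hr (h r (B.system_isChild.1 hk.right))
    | one _ h => exact absurd h (hone _)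
    | two _ hk' _ _ h' h'' =>
      obtain ⟨rfl, rfl⟩ := hk.unique (B.system_kids.2 hk')
      rw [h''.chain.1 s hs]
      rcases h'.chain.2 t ht with h5 | h5 <;> rw [h5]
      exacts [h1.symm, h3]

theorem ColorSpecialTouch.called [Finite κ] {p : κ} (hT : (σ.triple p).card = 3)
    (hsp : σ.special p ∈ σ.triple p) (h : B.ColorSpecialTouch σ p) :
    ∀ (n : ℕ) (q : κ), B.system.size p ≤ n + B.system.size q → B.Touch p q → B.Called σ p q := by
  intro n
  induction n with
  | zero =>
    intro q hn hq
    by_cases hqp : q = p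
    · rw [hqp]; exact Or.inl h
    have := (B.system_le.2 hq.1).size_lt hqp
    omega
  | succ n ih =>
    intro q hn hq
    by_cases hqp : q = p
    · rw [hqp]; exact Or.inl h
    obtain ⟨t, ht, htp⟩ := PathSystem.exists_parent (B.system_le.2 hq.1) hqp
    have h1 := ht.2.1.size_lt ht.1
    exact (ih t (by omega) (B.system_touch.1 ((B.system_touch.2 hq).mono ht.2.1 htp))).child hT hsp
      (B.system_isChild.1 ht) hq

end BinaryFamily

/-! ### Every run yields a forest labeling -/

namespace BinaryFamily

variable {V : Type*} [Finite V] {M : PlaneGraph V} {κ : Type*} {B : BinaryFamily M κ} {σ : Vars κ}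

theorem Max.sibling_cases {p q r l m : κ} (hm : B.Max p m) (hk : B.system.Kids q r l)
    (hq : B.Touch p q) (hmq : B.IsChild m q) : B.Max p r ∧ B.Max p l ∨ B.MaxIII p m := by
  have hmrl := (hk.2 m).1 (B.system_isChild.2 hmq)
  have hr := B.system_isChild.1 hk.right
  have hl := B.system_isChild.1 hk.left
  by_cases h1 : B.Touch p r <;> by_cases h2 : B.Touch p l
  · exact absurd (by rcases hmrl with rfl | rfl <;> assumption) hm.2.1
  · refine Or.inr ⟨hm, q, r, hmq, hr, ?_, h1⟩
    rintro rfl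
    exact hm.2.1 h1
  · refine Or.inr ⟨hm, q, l, hmq, hl, ?_, h2⟩
    rintro rfl
    exact hm.2.1 h2
  · exact Or.inl ⟨.of_isChild hq hr h1, .of_isChild hq hl h2⟩

theorem TripleSpecialMax.invariant [Finite κ] {p m : κ} (h : B.TripleSpecialMax σ p)
    (hT : (σ.triple p).card = 3) (hm : B.Max p m) :
    (σ.triple m).card = 3 ∧ σ.special m ∈ σ.triple m := by
  obtain ⟨q, hmq, hqp⟩ := PathSystem.exists_parent (B.system_le.2 hm.1) hm.ne
  have hmq' := B.system_isChild.1 hmq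
  obtain ⟨r, l, hk⟩ := B.system_binary.exists_kids hmq
  have hq := hm.touch_parent hmq'
  obtain ⟨h2, Δ, A, -, h3⟩ := h
  rcases hm.sibling_cases hk hq hmq' with ⟨hr, hl⟩ | h4
  · obtain ⟨k1, k2, k3, k4, k5⟩ := h2 q r l (B.system_kids.1 hk) hr hl
    rcases (hk.2 m).1 hmq with rfl | rfl
    · rw [k4]; exact ⟨hT, k1⟩
    · rw [k5]; exact ⟨hT, k2⟩
  · obtain ⟨-, k1, k2, -, k3, k4⟩ := h3 m h4
    by_cases hA : m ∈ A
    · obtain ⟨k5, k6⟩ := k3 hA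
      have hs : σ.special m ∈ Finset.univ \ σ.triple p := k5 ▸ Finset.mem_singleton_self _
      rw [k6]
      refine ⟨?_, by simp⟩
      rw [Finset.card_union_of_disjoint, k2, Finset.card_singleton]
      rw [Finset.disjoint_singleton_right]
      exact fun h => (Finset.mem_sdiff.1 hs).2 (k1 h)
    · obtain ⟨k5, k6⟩ := k4 hA
      have hs : σ.special m ∈ σ.triple p \ Δ m := k5 ▸ Finset.mem_singleton_self _
      rw [k6]
      exact ⟨hT, (Finset.mem_sdiff.1 hs).1⟩

theorem Run.invariant [Finite κ] (h : B.Run σ) :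
    ∀ n, ∀ p ∈ B.MAXLevel n, (σ.triple p).card = 3 ∧ σ.special p ∈ σ.triple p := by
  intro n
  induction n with
  | zero =>
    rintro p rfl
    rw [h.1, h.2.1]
    decide
  | succ n ih =>
    rintro m ⟨p, hp, hm⟩
    exact (h.2.2 n p hp).2.invariant (ih p hp).1 hm

theorem Run.called [Finite κ] (h : B.Run σ) {n : ℕ} {p q : κ} (hp : p ∈ B.MAXLevel n)
    (hq : B.Touch p q) : B.Called σ p q :=
  (h.2.2 n p hp).1.called (h.invariant n p hp).1 (h.invariant n p hp).2 _ q
    (Nat.le_add_right _ _) hq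

/-- A path that interferes at the edge of `m` with the face above `m ∈ Max_p` has the
label `special m`. -/
theorem Run.label_of_extremalEdge [Finite κ] (h : B.Run σ) {n : ℕ} {p q m s : κ}
    (hp : p ∈ B.MAXLevel n) (hm : B.Max p m) {e : Sym2 V} (he : B.ExtremalEdge q m e)
    (hs : e ∈ (B.path s).edges) : σ.label s = σ.special m := by
  obtain ⟨cr, -, cl, -, hc⟩ := (h.2.2 (n + 1) m ⟨p, hp, hm⟩).1
  exact hc.label_of_special hm.ne_root (B.system_le.1 (PathSystem.Le.refl m))
    (Or.inr ⟨hm.ne_root, q, he⟩) he.2.1 (B.system_le.1 (he.le hs)) hs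

/-- A member of `Max_p` interferes with the face above another one at the edge of its sibling. -/
theorem DashArrow.exists_edge [Finite κ] {p q m w m' : κ} (hm : B.Max p m) (hm' : B.Max p m')
    (h1 : B.IsChild m q) (h2 : B.IsChild w q) (hne : w ≠ m) (h : B.DashArrow m' m) :
    ∃ e, B.ExtremalEdge q w e ∧ e ∈ (B.path m').edges := by
  obtain ⟨hne', q'', hq'', c, e, hc, hce⟩ := h
  obtain rfl := (B.system_isChild.2 hq'').parent_unique (B.system_isChild.2 h1)
  obtain ⟨r, l, hk⟩ := B.system_binary.exists_kids (B.system_isChild.2 h1)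
  have hcase : c = m ∨ c = w := by
    rcases (hk.2 m).1 (B.system_isChild.2 h1) with rfl | rfl <;>
    rcases (hk.2 w).1 (B.system_isChild.2 h2) with rfl | rfl <;>
    rcases (hk.2 c).1 (B.system_isChild.2 hc.1) with rfl | rfl <;> tauto
  rcases hcase with rfl | rfl
  · exact absurd (hm'.2.2 c hm.1 hm.2.1 (B.system_le.1 (hc.le hce))).symm hne'
  · exact ⟨e, hc, hce⟩

/-- Both interfere at the extremal edge on the touching sibling of `m`, and distinct members of
`Max_p` below that sibling cannot share one of its edges. -/
theorem DashArrow.unique [Finite κ] {p m m' m'' : κ} (hm : B.MaxIII p m) (hm' : B.Max p m')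
    (hm'' : B.Max p m'') (h : B.DashArrow m' m) (h' : B.DashArrow m'' m) : m' = m'' := by
  obtain ⟨hmax, q, w, h1, h2, hne, -⟩ := hm
  obtain ⟨e, he, hem⟩ := h.exists_edge hmax hm' h1 h2 hne
  obtain ⟨e', he', hem'⟩ := h'.exists_edge hmax hm'' h1 h2 hne
  obtain rfl := he.unique he'
  exact hm'.eq_of_edge hm'' (B.system_le.1 (he.le hem)) (B.system_le.1 (he.le hem')) hem hem' he.2.1

/-- The labels on the two sides of a face with lower paths `m ∈ Max_p` and `w ∈ Touch_p` are
different. -/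
theorem Run.ne_of_touch_max [Finite κ] (h : B.Run σ) {n : ℕ} {p q m w s t : κ}
    (hp : p ∈ B.MAXLevel n) (hm : B.Max p m) (hw : B.Touch p w) {e e' : Sym2 V}
    (he : B.ExtremalEdge q m e) (he' : B.ExtremalEdge q w e') (hs : e ∈ (B.path s).edges)
    (ht : e' ∈ (B.path t).edges) : σ.label s ≠ σ.label t := by
  rw [h.label_of_extremalEdge hp hm he hs]
  have hwm : w ≠ m := by rintro rfl; exact hm.2.1 hw
  have hmIII : B.MaxIII p m := ⟨hm, q, w, he.1, he'.1, hwm, hw⟩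
  obtain ⟨h2, Δ, A, harr, h3⟩ := (h.2.2 n p hp).2
  obtain ⟨k1, k2, k3, k4, k5, k6⟩ := h3 m hmIII
  -- In class `A` the special label is outside `triple p`, otherwise it is the third label beside `Δ
  -- m`.
  have hΔ : σ.special m ∉ Δ m := by
    by_cases hA : m ∈ A
    · have := (k5 hA).1 ▸ Finset.mem_singleton_self (σ.special m)
      exact fun h => (Finset.mem_sdiff.1 this).2 (k2 h)
    · have := (k6 hA).1 ▸ Finset.mem_singleton_self (σ.special m)
      exact (Finset.mem_sdiff.1 this).2
  have htw := he'.le ht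
  have hwp := B.system_touch.2 hw
  -- A touching `t` has its label in `Δ m`. Otherwise `t` is below some `m'` in `Max_p` with `m' ⇢
  -- m`, and its label is in `triple m'`.
  by_cases htp : B.Touch p t
  · intro heq
    exact hΔ (heq ▸ k4 q t he.1 htp ⟨w, e', he', ht⟩)
  obtain ⟨m', hm', htm'⟩ := Max.exists_ge (B.system_le.1 (htw.trans hwp.1)) htp
  have hm'w : B.system.Le m' w := by
    rcases (B.system_le.2 htm').total htw with h1 | h1
    · exact h1
    · exact absurd (B.system_touch.1 (hwp.mono h1 (B.system_le.2 hm'.1))) hm'.2.1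
  have hem' : e' ∈ (B.path m').edges := by
    rw [← system_edges]
    exact PathSystem.sep_le_edge (B.system_le.2 htm') hm'w (by rwa [system_edges])
      (by rw [system_edges]; exact he'.2.1)
  have hmm' : m' ≠ m := by
    rintro rfl
    have h1 := (B.system_isChild.2 he.1).2.2 w (B.system_isChild.2 he'.1).2.1 hm'w
    exact h1.elim hwm he'.1.1
  have hint : B.Interferes m' q := ⟨w, e', he', hem'⟩
  have harrow : B.DashArrow m' m := ⟨hmm', q, he.1, hint⟩
  have hlabel : σ.label t ∈ σ.triple m' :=
    (h.called (n := n + 1) ⟨p, hp, hm'⟩ (B.system_touch.1 (.of_edge (B.system_le.2 htm')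
      (by rwa [system_edges]) (by rwa [system_edges])))).label_mem
      (h.invariant (n + 1) m' ⟨p, hp, hm'⟩).2
  suffices hnot : σ.special m ∉ σ.triple m' from fun heq => hnot (heq ▸ hlabel)
  -- If `m` is in `A`, then `special m` is outside `triple p`, and `m'` has the triple of `p`: it is
  -- of type II or in the other class.
  by_cases hA : m ∈ A
  · have hsp : σ.special m ∉ σ.triple p := by
      have := (k5 hA).1 ▸ Finset.mem_singleton_self (σ.special m)
      exact (Finset.mem_sdiff.1 this).2
    suffices heq : σ.triple m' = σ.triple p by rwa [heq]
    obtain ⟨q', hmq', -⟩ := PathSystem.exists_parent (B.system_le.2 hm'.1) hm'.ne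
    have hmq'' := B.system_isChild.1 hmq'
    obtain ⟨r, l, hk⟩ := B.system_binary.exists_kids hmq'
    rcases hm'.sibling_cases hk (hm'.touch_parent hmq'') hmq'' with ⟨hr, hl⟩ | h4
    · obtain ⟨-, -, -, j1, j2⟩ := h2 q' r l (B.system_kids.1 hk) hr hl
      rcases (hk.2 m').1 hmq' with rfl | rfl <;> assumption
    · obtain ⟨-, -, -, -, -, j6⟩ := h3 m' h4
      have := (harr m' m h4 hmIII harrow).2
      exact (j6 fun h => this.1 h hA).2
  -- Outside `A`, `m` is not a root, so its unique predecessor `m'` is of type III and in `A`. Then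
  -- `triple m'` is the common `Δ` plus a label outside `triple p`, and `special m` is neither in
  -- `Δ` nor outside `triple p`.
  · have hne := mt k1 hA
    push Not at hne
    obtain ⟨m'', hm'', harr''⟩ := hne
    have hmm : m'' = m' := harr''.unique hmIII hm''.1 hm' harrow
    rw [hmm] at hm'' harr''
    obtain ⟨j1, j2⟩ := harr m' m hm'' hmIII harr''
    obtain ⟨-, -, -, -, j5, -⟩ := h3 m' hm''
    obtain ⟨j6, j7⟩ := j5 (j2.2 hA)
    have hsp : σ.special m ∈ σ.triple p := by
      have := (k6 hA).1 ▸ Finset.mem_singleton_self (σ.special m)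
      exact (Finset.mem_sdiff.1 this).1
    have hsp' : σ.special m' ∉ σ.triple p := by
      have := j6 ▸ Finset.mem_singleton_self (σ.special m')
      exact (Finset.mem_sdiff.1 this).2
    rw [j7, Finset.mem_union, Finset.mem_singleton, not_or, j1]
    refine ⟨hΔ, fun heq => hsp' (heq ▸ hsp)⟩

/-- The labels on the two sides of a face are different. -/
theorem Run.ne_of_exits [Finite κ] (h : B.Run σ) {q r l s t : κ} (hk : B.system.Kids q r l)
    {e e' : Sym2 V} (he : B.system.Exit q r l e) (he' : B.system.mirror.Exit q l r e')
    (hs : e ∈ (B.path s).edges) (ht : e' ∈ (B.path t).edges) : σ.label s ≠ σ.label t := by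
  obtain ⟨n, p, hp, hq⟩ := B.exists_level_touch q
  obtain ⟨hx, hx'⟩ := extremalEdge_of_exits hk he he'
  have hqp := (B.system_touch.2 hq).1
  rw [← system_edges] at hs ht
  -- Faces with both, exactly one, or none of the lower paths touching `p`.
  by_cases hr : B.Touch p r <;> by_cases hl : B.Touch p l
  · have hr' := B.system_touch.2 hr
    have hl' := B.system_touch.2 hl
    rw [← PathSystem.mirror_edges] at ht
    have hs1 := he.touch hk hqp hr' hl' hs
    have ht1 := he'.touch hk.mirror ((PathSystem.mirror_le _).2 hqp)
      (PathSystem.mirror_touch.2 hl') (PathSystem.mirror_touch.2 hr') ht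
    exact (h.called hp hq).chain_ne (h.invariant n p hp).1 (h.invariant n p hp).2 hk hr hl
      (he.chain B.system_binary hk hqp hs1 hs)
      (he'.chain B.system_binary.mirror hk.mirror ((PathSystem.mirror_le _).2 hqp) ht1 ht)
  · rw [system_edges] at hs ht
    exact (h.ne_of_touch_max hp (.of_isChild hq (B.system_isChild.1 hk.left) hl) hr hx' hx ht
      hs).symm
  · rw [system_edges] at hs ht
    exact h.ne_of_touch_max hp (.of_isChild hq (B.system_isChild.1 hk.right) hr) hl hx hx' hs ht
  · rw [system_edges] at hs ht
    have hrm := Max.of_isChild hq (B.system_isChild.1 hk.right) hr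
    have hlm := Max.of_isChild hq (B.system_isChild.1 hk.left) hl
    rw [h.label_of_extremalEdge hp hrm hx hs, h.label_of_extremalEdge hp hlm hx' ht]
    exact ((h.2.2 n p hp).2.1 q r l (B.system_kids.1 hk) hrm hlm).2.2.1

/-- A monochromatic cycle contains both exit edges of some pair of siblings, and two paths with that
label supplying them contradict `Run.ne_of_exits`. -/
theorem Run.isForestLabeling [Finite κ] (h : B.Run σ) : IsForestLabeling B.path σ.label := by
  intro c
  by_contra hnot
  unfold IsAcyclic at hnot
  push Not at hnot
  obtain ⟨v, w, hw⟩ := hnot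
  have hsub : ∀ e ∈ {e | e ∈ w.edges}, ∃ i, σ.label i = c ∧ e ∈ (B.path i).edges := by
    intro e he
    have := w.edges_subset_edgeSet he
    rw [edgeSet_fromEdgeSet] at this
    exact this.1
  have hne : {e | e ∈ w.edges}.Nonempty := by
    cases w with
    | nil => exact absurd rfl hw.ne_nil
    | cons h w => exact ⟨_, by simp; exact Or.inl rfl⟩
  obtain ⟨q, r, l, hk, ⟨e, he, hx⟩, e', he', hx'⟩ := PathSystem.exists_exits B.system_binary
    hw.noLeaf hne fun e he => by
      obtain ⟨i, -, hi⟩ := hsub e he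
      exact ⟨i, by rwa [system_edges]⟩
  obtain ⟨s, hs, hes⟩ := hsub e he
  obtain ⟨t, ht, het⟩ := hsub e' he'
  exact h.ne_of_exits hk hx hx' hes het (hs.trans ht.symm)

end BinaryFamily

theorem FourForests.isForestLabeling {V : Type*} [Finite V] {M : PlaneGraph V} {ι : Type*}
    [Finite ι] {P : ι → GPath M.G} {L : ι → Fin 4} (h : FourForests M P L) :
    IsForestLabeling P L := by
  obtain ⟨k, B, σ, hB, hσ, hL⟩ := h
  intro c
  refine (hσ.isForestLabeling c).anti (fromEdgeSet_mono ?_)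
  rintro e ⟨i, hi, he⟩
  exact ⟨Sum.inl i, by rw [← hL, hi], by rwa [hB]⟩

theorem IsForestLabeling.pcfn_le {V : Type*} {G : SimpleGraph V} {ι : Type*} {k : ℕ}
    {P : ι → GPath G} {L : ι → Fin k} (h : IsForestLabeling P L) : PCFN P ≤ k := by
  refine (iInf₂_le (Set.range fun c : Fin k => fromEdgeSet {e | ∃ i, L i = c ∧ e ∈ (P i).edges})
    ⟨?_, fun i => ⟨_, ⟨L i, rfl⟩, fun e he => ?_⟩⟩).trans ?_
  · rw [← Set.image_univ]
    refine (Set.encard_image_le _ _).trans ?_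
    simp
  · rintro _ ⟨c, rfl⟩
    exact h c
  · change e ∈ (fromEdgeSet _).edgeSet
    rw [edgeSet_fromEdgeSet]
    exact ⟨⟨i, rfl, he⟩, G.not_isDiag_of_mem_edgeSet (GPath.mem_edgeSet he)⟩

/-! ### Executions of the main loop -/

namespace PathSystem

variable {V : Type*} {G : SimpleGraph V} {κ : Type*} {S : PathSystem G κ}

/-- Data propagated from `q` to its descendants. -/
theorem Binary.exists_propagation [Finite κ] {root : κ} {α : Type*} (hB : S.Binary root)
    (step : κ → κ → κ → α → α × α) :
    ∀ (n : ℕ) (q : κ) (a : α), S.size q ≤ n → ∃ f : κ → α, f q = a ∧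
      ∀ t r l, S.Le t q → S.Kids t r l → f r = (step t r l (f t)).1 ∧ f l = (step t r l (f t)).2 := by
  classical
  intro n
  induction n with
  | zero =>
    intro q _ hn
    have := S.lo_lt_hi q
    unfold size at hn
    omega
  | succ n ih =>
    intro q a hn
    rcases hB.binary q with h | ⟨r, l, hk⟩
    · refine ⟨fun _ => a, rfl, fun t r l ht hk => ?_⟩
      obtain rfl := h t ht
      exact absurd (h r hk.right_le) hk.right.1
    · have h1 := hk.right_le.size_lt hk.right.1
      have h2 := hk.left_le.size_lt hk.left.1
      obtain ⟨f, hf, hf'⟩ := ih r (step q r l a).1 (by omega)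
      obtain ⟨g, hg, hg'⟩ := ih l (step q r l a).2 (by omega)
      have hqr : ¬ S.Le q r := fun h => hk.right.1 (hk.right_le.antisymm h)
      have hql : ¬ S.Le q l := fun h => hk.left.1 (hk.left_le.antisymm h)
      set F : κ → α := fun x => if S.Le x r then f x else if S.Le x l then g x else a with hF
      have hFr : ∀ x, S.Le x r → F x = f x := fun x hx => if_pos hx
      have hFl : ∀ x, S.Le x l → F x = g x := fun x hx => by
        rw [hF]
        simp only
        rw [if_neg fun h => hk.not_le h hx, if_pos hx]
      have hFq : F q = a := by
        rw [hF]
        simp only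
        rw [if_neg hqr, if_neg hql]
      refine ⟨F, hFq, fun t r' l' ht hk' => ?_⟩
      by_cases htq : t = q
      · subst htq
        obtain ⟨rfl, rfl⟩ := hk.unique hk'
        rw [hFr _ (Le.refl _), hFl _ (Le.refl _), hf, hg, hFq]
        exact ⟨rfl, rfl⟩
      · rcases hk.le_or_le ht htq with h | h
        · rw [hFr _ (hk'.right_le.trans h), hFr _ (hk'.left_le.trans h), hFr _ h]
          exact hf' t r' l' h hk'
        · rw [hFl _ (hk'.right_le.trans h), hFl _ (hk'.left_le.trans h), hFl _ h]
          exact hg' t r' l' h hk'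

open Relation

/-- The labels on the chain of leftmost touching children through `w`. -/
def chainLabels (S : PathSystem G κ) (p : κ) (label : κ → Fin 4) (w : κ) : Set (Fin 4) :=
  {c | ∃ u s, S.Touch p u ∧ ReflTransGen (S.LStep p) u w ∧ ReflTransGen (S.LStep p) u s ∧
    label s = c}

/-- Parents are unique, so two chains with the same lower end are comparable. -/
theorem LStep.total {p u u' w : κ} (h : ReflTransGen (S.LStep p) u w)
    (h' : ReflTransGen (S.LStep p) u' w) :
    ReflTransGen (S.LStep p) u u' ∨ ReflTransGen (S.LStep p) u' u := by
  have hU : Relator.RightUnique (Function.swap (S.LStep p)) :=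
    fun a b c hab hac => hab.1.parent_unique hac.1
  rcases ReflTransGen.total_of_right_unique hU h.swap h'.swap with h1 | h1
  · exact Or.inr (by rw [← reflTransGen_swap]; exact h1)
  · exact Or.inl (by rw [← reflTransGen_swap]; exact h1)

theorem chainLabels_eq {p w w' : κ} (label : κ → Fin 4) (hw : S.Touch p w)
    (h : ReflTransGen (S.LStep p) w w') :
    S.chainLabels p label w' = S.chainLabels p label w := by
  ext c
  constructor
  · rintro ⟨u, s, h1, h2, h3, h4⟩
    rcases LStep.total h2 h with h5 | h5
    · exact ⟨u, s, h1, h5, h3, h4⟩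
    · exact ⟨w, s, hw, .refl, h5.trans h3, h4⟩
  · rintro ⟨u, s, h1, h2, h3, h4⟩
    exact ⟨u, s, h1, h2.trans h, h3, h4⟩

theorem LStep.le {p u s : κ} (h : ReflTransGen (S.LStep p) u s) : S.Le s u := by
  induction h with
  | refl => exact Le.refl _
  | tail _ h ih => exact h.1.2.1.trans ih

/-- All labels in question occur below the topmost start of a chain through `w`, so the call made
for that one path controls them. -/
theorem chainLabels_top [Finite κ] {p w : κ} (label : κ → Fin 4) (hw : S.Touch p w) :
    ∃ u, S.Touch p u ∧ ∀ c ∈ S.chainLabels p label w, ∃ s, ReflTransGen (S.LStep p) u s ∧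
      label s = c := by
  obtain ⟨u, ⟨h1, h2⟩, hmax⟩ := S.exists_max
    (fun u => S.Touch p u ∧ ReflTransGen (S.LStep p) u w) ⟨w, hw, .refl⟩
  refine ⟨u, h1, ?_⟩
  rintro c ⟨u', s, h3, h4, h5, h6⟩
  refine ⟨s, ?_, h6⟩
  rcases LStep.total h2 h4 with h7 | h7
  · exact h7.trans h5
  · by_cases hne : u = u'
    · rwa [hne]
    have h8 := (LStep.le h7).size_lt hne
    have h9 := hmax u' ⟨h3, h4⟩
    omega

/-- If a non-touching path `m'` with a touching sibling interferes with the face above `w`, then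
`m'` is on the same side of its sibling as the face of `w`. -/
theorem Exit.same_side [Finite κ] {root p q w m q' w' m' : κ} (hB : S.Binary root)
    (hk : S.Kids q w m) (hq : S.Le q p) (hw : S.Touch p w) {e : Sym2 V} (he : S.Exit q w m e)
    (hm' : e ∈ (S.p m').edges) (hmt : ¬ S.Touch p m') (h1 : S.IsChild m' q') (h2 : S.IsChild w' q')
    (hne : w' ≠ m') (hw' : S.Touch p w') :
    S.Kids q' w' m' ∧ ReflTransGen (S.LStep p) w w' := by
  have hm'w := he.le hk hm'
  have hwm' : m' ≠ w := by rintro rfl; exact hmt hw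
  have hq'w := h1.le_of_lt hm'w hwm'
  have hwp := hk.right_le.trans hq
  have hew : e ∈ (S.p w).edges := by
    obtain ⟨k, hk', rfl, -⟩ := he
    exact (S.p w).edge_mem hk'
  have hq't : S.Touch p q' := hw'.mono h2.2.1 (hq'w.trans hwp)
  have hchain := he.chain hB hk hq hq't (sep_le_edge h1.2.1 hq'w hm' hew)
  have hkids : S.Kids q' w' m' := by
    obtain ⟨r, l, hk'⟩ := hB.exists_kids h1
    rcases (hk'.2 m').1 h1 with rfl | rfl <;> rcases (hk'.2 w').1 h2 with rfl | rfl
    · exact absurd rfl hne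
    · exfalso
      obtain ⟨k, hkw, rfl, h3, h4, -⟩ := he
      obtain ⟨-, v, hv, hvp⟩ := hw'
      have hvw := sep_le (h2.2.1.trans hq'w) hwp hv hvp
      obtain ⟨i, hi, rfl⟩ := GPath.mem_verts.1 hvw
      have h5 : i ≤ k := by
        by_contra hlt
        exact h4 (S.contig w q k i (by omega) hi h3 (sep_le hk.right_le hq hvw hvp) k le_rfl
          (by omega))
      have h6 := S.order_top w m' w' hm'w.1 hk'.1 (h2.2.1.trans hq'w).2 (k + 1) i hkw hi
        (GPath.right_mem_verts hm') hv
      omega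
    · exact hk'
    · exact absurd rfl hne
  refine ⟨hkids, hchain.tail ⟨h2, hw', fun c hc hct hcne => ?_⟩⟩
  rcases (hkids.2 c).1 hc with rfl | rfl
  · exact absurd rfl hcne
  · exact absurd hct hmt

/-- The labels that the faces above `m` have to avoid. -/
def sideLabels (S : PathSystem G κ) (p : κ) (label : κ → Fin 4) (m : κ) : Set (Fin 4) :=
  {c | ∃ q w, S.Kids q w m ∧ S.Touch p w ∧ c ∈ S.chainLabels p label w}

theorem mirror_mirror : S.mirror.mirror = S := by
  obtain ⟨⟩ := S
  simp [mirror, GPath.rev]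

/-- A path is a left or a right child but not both, so one of the two sets is empty. Their union
lets `Δ` be defined without distinguishing sides. -/
theorem sideLabels_eq {p q w m : κ} (label : κ → Fin 4) (hk : S.Kids q w m) (hw : S.Touch p w) :
    S.sideLabels p label m ∪ S.mirror.sideLabels p label m = S.chainLabels p label w := by
  ext c
  constructor
  · rintro (⟨q', w', hk', hw', hc⟩ | ⟨q', w', hk', hw', hc⟩)
    · obtain rfl := hk.left.parent_unique hk'.left
      obtain ⟨rfl, -⟩ := hk.unique hk'
      exact hc
    · exfalso
      have hk3 := hk'.mirror
      rw [mirror_mirror] at hk3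
      obtain rfl := hk.left.parent_unique hk3.right
      obtain ⟨rfl, -⟩ := hk.unique hk3
      exact hk.ne rfl
  · exact fun hc => Or.inl ⟨q, w, hk, hw, hc⟩

end PathSystem

/-! ### Executing the loops. -/

namespace BinaryFamily

variable {V : Type*} [Finite V] {M : PlaneGraph V} {κ : Type*} {B : BinaryFamily M κ} {σ : Vars κ}

open Relation

/-- The parameters of a call. -/
inductive Call where
  | set (cr cl : Fin 4)
  | right (c₁ c₂ c₃ : Fin 4)
  | left (c₁ c₂ c₃ : Fin 4)

theorem exists_third {T : Finset (Fin 4)} (hT : T.card = 3) {a b : Fin 4} (ha : a ∈ T \ {b})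
    (hb : b ∈ T) : ∃ d, {d} = T \ {a, b} := by
  have h : (T \ {a, b}).card = 1 := by
    simp only [Finset.mem_sdiff, Finset.mem_singleton] at ha
    rw [Finset.card_sdiff_of_subset, hT, Finset.card_pair ha.2]
    intro x hx
    simp only [Finset.mem_insert, Finset.mem_singleton] at hx
    rcases hx with rfl | rfl
    exacts [ha.1, hb]
  obtain ⟨d, hd⟩ := Finset.card_eq_one.1 h
  exact ⟨d, hd.symm⟩

open Classical in
/-- The parameters of the calls for the two children of a path. -/
noncomputable def childCalls (B : BinaryFamily M κ) (p : κ) (sc : Fin 4)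
    (third : Fin 4 → Fin 4) (r l : κ) (c : Call) : Call × Call :=
  if B.Touch p r ∧ B.Touch p l then
    match c with
    | .set cr cl => if B.HasSpecialEdge p r then (.set cr (third cl), .right cl sc (third cl))
        else (.left cr sc (third cr), .set (third cr) cl)
    | .right c₁ c₂ c₃ => (.right c₁ c₃ c₂, .right c₂ c₁ c₃)
    | .left c₁ c₂ c₃ => (.left c₂ c₁ c₃, .left c₁ c₃ c₂)
  else (c, c)

/-- The calls for the paths in `Touch_p` can be executed. -/
theorem exists_colorSpecialTouch [Finite κ] (B : BinaryFamily M κ) (p : κ)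
    (T : κ → Finset (Fin 4)) (sc : κ → Fin 4) (hT : (T p).card = 3) (hsc : sc p ∈ T p) :
    ∃ label : κ → Fin 4, B.ColorSpecialTouch ⟨label, T, sc⟩ p := by
  have hthird : ∀ a, ∃ d, a ∈ T p \ {sc p} → {d} = T p \ {a, sc p} := by
    intro a
    by_cases ha : a ∈ T p \ {sc p}
    · obtain ⟨d, hd⟩ := exists_third hT ha hsc
      exact ⟨d, fun _ => hd⟩
    · exact ⟨0, fun h => absurd h ha⟩
  choose third hthird using hthird
  obtain ⟨c, hc⟩ : (T p \ {sc p}).Nonempty := by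
    rw [← Finset.card_pos, Finset.card_sdiff_of_subset (by simpa using hsc), hT]
    simp
  -- The recursion is run on call parameters over the whole subtree of `p`; the values outside
  -- `Touch_p` play no role. The choice `c_r = c_ℓ = c` is permitted.
  obtain ⟨f, hfp, hf⟩ := B.system_binary.exists_propagation
    (fun _ => childCalls B p (sc p) third) _ p (.set c c) le_rfl
  let label : κ → Fin 4 := fun x => match f x with
    | .set _ _ => sc p
    | .right c₁ _ _ => c₁
    | .left c₁ _ _ => c₁
  refine ⟨label, c, hc, c, hc, ?_⟩
  have key : ∀ (n : ℕ) (t : κ), B.system.size t ≤ n → B.system.Le t p →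
      (∀ cr cl, f t = .set cr cl → cr ∈ T p \ {sc p} → cl ∈ T p \ {sc p} →
        B.SetColor ⟨label, T, sc⟩ p t cr cl) ∧
      (∀ c₁ c₂ c₃, f t = .right c₁ c₂ c₃ → B.RightColor ⟨label, T, sc⟩ p t c₁ c₂ c₃) ∧
      (∀ c₁ c₂ c₃, f t = .left c₁ c₂ c₃ → B.LeftColor ⟨label, T, sc⟩ p t c₁ c₂ c₃) := by
    intro n
    induction n with
    | zero =>
      intro t hn
      have := B.system.lo_lt_hi t
      unfold PathSystem.size at hn
      omega
    | succ n ih =>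
      intro t hn htp
      have hset : ∀ cr cl, f t = .set cr cl → label t = sc p := fun cr cl h => by
        simp only [label, h]
      have hright : ∀ c₁ c₂ c₃, f t = .right c₁ c₂ c₃ → label t = c₁ := fun c₁ c₂ c₃ h => by
        simp only [label, h]
      have hleft : ∀ c₁ c₂ c₃, f t = .left c₁ c₂ c₃ → label t = c₁ := fun c₁ c₂ c₃ h => by
        simp only [label, h]
      by_cases hnone : ∀ c, B.IsChild c t → ¬ B.Touch p c
      · exact ⟨fun cr cl h _ _ => .none (hset _ _ h) hnone, fun _ _ _ h => .none (hright _ _ _ h)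
          hnone, fun _ _ _ h => .none (hleft _ _ _ h) hnone⟩
      push Not at hnone
      obtain ⟨c₀, hc₀, -⟩ := hnone
      obtain ⟨r, l, hk⟩ := B.system_binary.exists_kids (B.system_isChild.2 hc₀)
      have hkB := B.system_kids.1 hk
      have hr := hk.right_le.size_lt hk.right.1
      have hl := hk.left_le.size_lt hk.left.1
      obtain ⟨i1, i2, i3⟩ := ih r (by omega) (hk.right_le.trans htp)
      obtain ⟨j1, j2, j3⟩ := ih l (by omega) (hk.left_le.trans htp)
      obtain ⟨hfr, hfl⟩ := hf t r l htp hk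
      by_cases htr : B.Touch p r <;> by_cases htl : B.Touch p l
      · simp only [childCalls, htr, htl, and_self, if_true] at hfr hfl
        refine ⟨fun cr cl h hcr hcl => ?_, fun c₁ c₂ c₃ h => ?_, fun c₁ c₂ c₃ h => ?_⟩
        · rw [h] at hfr hfl
          by_cases hsp : B.HasSpecialEdge p r
          · simp only [hsp, if_true] at hfr hfl
            refine .right (hset _ _ h) hkB htr htl hsp (hthird cl hcl) (i1 _ _ hfr hcr ?_)
              (j2 _ _ _ hfl)
            have h1 : third cl ∈ T p \ {cl, sc p} := hthird cl hcl ▸ Finset.mem_singleton_self _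
            simp only [Finset.mem_sdiff, Finset.mem_insert, Finset.mem_singleton, not_or] at h1 ⊢
            exact ⟨h1.1, h1.2.2⟩
          · simp only [hsp, if_false] at hfr hfl
            refine .left (hset _ _ h) hkB htr htl hsp (hthird cr hcr) (j1 _ _ hfl ?_ hcl)
              (i3 _ _ _ hfr)
            have h1 : third cr ∈ T p \ {cr, sc p} := hthird cr hcr ▸ Finset.mem_singleton_self _
            simp only [Finset.mem_sdiff, Finset.mem_insert, Finset.mem_singleton, not_or] at h1 ⊢
            exact ⟨h1.1, h1.2.2⟩
        · rw [h] at hfr hfl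
          exact .two (hright _ _ _ h) hkB htr htl (i2 _ _ _ hfr) (j2 _ _ _ hfl)
        · rw [h] at hfr hfl
          exact .two (hleft _ _ _ h) hkB htr htl (j3 _ _ _ hfl) (i3 _ _ _ hfr)
      · simp only [childCalls, htr, htl, and_false, if_false] at hfr
        have hone : ∀ c, B.IsChild c t ∧ B.Touch p c ↔ c = r := by
          intro c
          rw [← system_isChild, hk.2]
          constructor
          · rintro ⟨rfl | rfl, h⟩
            exacts [rfl, absurd h htl]
          · rintro rfl
            exact ⟨Or.inl rfl, htr⟩
        exact ⟨fun cr cl h hcr hcl => .one (hset _ _ h) hone (i1 _ _ (hfr.trans h) hcr hcl),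
          fun _ _ _ h => .one (hright _ _ _ h) hone (i2 _ _ _ (hfr.trans h)),
          fun _ _ _ h => .one (hleft _ _ _ h) hone (i3 _ _ _ (hfr.trans h))⟩
      · simp only [childCalls, htr, htl, false_and, if_false] at hfl
        have hone : ∀ c, B.IsChild c t ∧ B.Touch p c ↔ c = l := by
          intro c
          rw [← system_isChild, hk.2]
          constructor
          · rintro ⟨rfl | rfl, h⟩
            exacts [absurd h htr, rfl]
          · rintro rfl
            exact ⟨Or.inr rfl, htl⟩
        exact ⟨fun cr cl h hcr hcl => .one (hset _ _ h) hone (j1 _ _ (hfl.trans h) hcr hcl),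
          fun _ _ _ h => .one (hright _ _ _ h) hone (j2 _ _ _ (hfl.trans h)),
          fun _ _ _ h => .one (hleft _ _ _ h) hone (j3 _ _ _ (hfl.trans h))⟩
      · have hnone : ∀ c, B.IsChild c t → ¬ B.Touch p c := by
          intro c hc
          rcases (hk.2 c).1 (B.system_isChild.2 hc) with rfl | rfl <;> assumption
        exact ⟨fun cr cl h _ _ => .none (hset _ _ h) hnone, fun _ _ _ h => .none (hright _ _ _ h)
          hnone, fun _ _ _ h => .none (hleft _ _ _ h) hnone⟩
  exact (key _ p le_rfl (.refl p)).1 c c hfp hc hc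

/-- Why a two-element `Δ` exists: a chain in one direction from a called path uses at most two
labels of the triple. -/
theorem Called.exists_pair {p q : κ} (hsp : σ.special p ∈ σ.triple p)
    (h : B.Called σ p q) :
    (∃ D ⊆ σ.triple p, D.card = 2 ∧
      ∀ s, ReflTransGen (B.system.LStep p) q s → σ.label s ∈ D) ∧
    ∃ D ⊆ σ.triple p, D.card = 2 ∧
      ∀ s, ReflTransGen (B.system.mirror.LStep p) q s → σ.label s ∈ D := by
  rcases h with ⟨cr, hcr, cl, hcl, h⟩ | ⟨c₁, c₂, c₃, h1, h2, h3, h4, h⟩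
  · rw [Finset.mem_sdiff, Finset.mem_singleton] at hcr hcl
    refine ⟨⟨{σ.special p, cl}, ?_, Finset.card_pair (Ne.symm hcl.2), fun s hs => ?_⟩,
      {σ.special p, cr}, ?_, Finset.card_pair (Ne.symm hcr.2), fun s hs => ?_⟩
    · simp [Finset.insert_subset_iff, hsp, hcl.1]
    · simpa using h.chain.1 s hs
    · simp [Finset.insert_subset_iff, hsp, hcr.1]
    · simpa using h.chain.2 s hs
  · have hsub : ({c₁, c₂} : Finset (Fin 4)) ⊆ σ.triple p := by
      rw [h4]
      simp [Finset.insert_subset_iff]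
    rcases h with h | h
    · refine ⟨⟨{c₁, c₂}, hsub, Finset.card_pair h1, fun s hs => ?_⟩, {c₁, c₂}, hsub,
        Finset.card_pair h1, fun s hs => ?_⟩
      · simpa using h.chain.1 s hs
      · simpa using Or.inl (h.chain.2 s hs)
    · refine ⟨⟨{c₁, c₂}, hsub, Finset.card_pair h1, fun s hs => ?_⟩, {c₁, c₂}, hsub,
        Finset.card_pair h1, fun s hs => ?_⟩
      · simpa using Or.inl (h.chain.1 s hs)
      · simpa using h.chain.2 s hs

/-- A well-founded relation in which every element has at most one predecessor is bipartite. -/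
theorem exists_alternating {α : Type*} {D : α → α → Prop} (hD : WellFounded D)
    (huniq : ∀ a b c, D a c → D b c → a = b) :
    ∃ A : Set α, (∀ a b, D a b → (a ∈ A ↔ b ∉ A)) ∧ ∀ b, (∀ a, ¬ D a b) → b ∈ A := by
  -- An element is in `A` iff no predecessor is; with unique predecessors this is parity of the
  -- distance from the root.
  let F : α → Prop := hD.fix fun b rec => ∀ a (h : D a b), ¬ rec a h
  have hF : ∀ b, F b ↔ ∀ a, D a b → ¬ F a := fun b => iff_of_eq (hD.fix_eq _ b)
  refine ⟨{b | F b}, fun a b hab => ?_, fun b hb => (hF b).2 fun a hab => absurd hab (hb a)⟩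
  change F a ↔ ¬ F b
  rw [hF b]
  push Not
  constructor
  · exact fun h => ⟨a, hab, h⟩
  · rintro ⟨c, hc, h⟩
    rwa [huniq a c b hab hc]

/-- The touching siblings of `m` and `m'` are on one chain, leftmost or rightmost
(`Exit.same_side`). So these labels are constant on each tree of `⇢`, and a `Δ` computed from them
is too. -/
theorem DashArrow.sideLabels_eq [Finite κ] {p m m' : κ} (label : κ → Fin 4) (hm : B.MaxIII p m)
    (hm' : B.MaxIII p m') (h : B.DashArrow m' m) :
    B.system.sideLabels p label m' ∪ B.system.mirror.sideLabels p label m' =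
      B.system.sideLabels p label m ∪ B.system.mirror.sideLabels p label m := by
  obtain ⟨hmax, q, w, h1, h2, hne, hw⟩ := hm
  obtain ⟨hmax', q', w', h1', h2', hne', hw'⟩ := hm'
  obtain ⟨e, he, hem⟩ := h.exists_edge hmax hmax' h1 h2 hne
  have hqp := (B.system_touch.2 (hmax.touch_parent h1)).1
  have hwS := B.system_touch.2 hw
  obtain ⟨r, l, hk, ⟨rfl, hx⟩ | ⟨rfl, hx⟩⟩ := he.cases
  · obtain rfl := ((hk.2 m).1 (B.system_isChild.2 h1)).resolve_left (Ne.symm hne)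
    obtain ⟨hk', hchain⟩ := hx.same_side B.system_binary hk hqp hwS
      (by rwa [system_edges]) (by rw [system_touch]; exact hmax'.2.1) (B.system_isChild.2 h1')
      (B.system_isChild.2 h2') hne' (B.system_touch.2 hw')
    rw [PathSystem.sideLabels_eq label hk hwS, PathSystem.sideLabels_eq label hk'
      (B.system_touch.2 hw'), PathSystem.chainLabels_eq label hwS hchain]
  · obtain rfl := ((hk.2 m).1 (B.system_isChild.2 h1)).resolve_right (Ne.symm hne)
    have hwS' := PathSystem.mirror_touch.2 hwS
    have hwS'' := PathSystem.mirror_touch.2 (B.system_touch.2 hw')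
    obtain ⟨hk', hchain⟩ := hx.same_side B.system_binary.mirror hk.mirror
      ((PathSystem.mirror_le _).2 hqp) hwS'
      (by rwa [PathSystem.mirror_edges, system_edges])
      (by rw [PathSystem.mirror_touch, system_touch]; exact hmax'.2.1)
      ((PathSystem.mirror_isChild _).2 (B.system_isChild.2 h1'))
      ((PathSystem.mirror_isChild _).2 (B.system_isChild.2 h2')) hne' hwS''
    have e1 := PathSystem.sideLabels_eq label hk.mirror hwS'
    have e2 := PathSystem.sideLabels_eq label hk' hwS''
    rw [PathSystem.mirror_mirror, Set.union_comm] at e1 e2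
    rw [e1, e2, PathSystem.chainLabels_eq label hwS' hchain]

/-- The labels of the touching paths that interfere with the face above `m` lie in a set of two
labels of `triple p`, which depends on `sideLabels` only. -/
theorem MaxIII.exists_pair [Finite κ] {p m : κ} (hT : (σ.triple p).card = 3)
    (hsp : σ.special p ∈ σ.triple p) (hc : B.ColorSpecialTouch σ p) (hm : B.MaxIII p m) :
    (∃ D ⊆ σ.triple p, D.card = 2 ∧
      B.system.sideLabels p σ.label m ∪ B.system.mirror.sideLabels p σ.label m ⊆ D) ∧
    ∀ q s, B.IsChild m q → B.Touch p s → B.Interferes s q →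
      σ.label s ∈ B.system.sideLabels p σ.label m ∪ B.system.mirror.sideLabels p σ.label m := by
  have hcalled : ∀ u, B.Touch p u → B.Called σ p u :=
    fun u hu => hc.called hT hsp _ u (Nat.le_add_right _ _) hu
  obtain ⟨hmax, q, w, h1, h2, hne, hw⟩ := hm
  have hqp := (B.system_touch.2 (hmax.touch_parent h1)).1
  have hwS := B.system_touch.2 hw
  have hedge : ∀ q' s, B.IsChild m q' → B.Touch p s → B.Interferes s q' →
      ∃ e, B.ExtremalEdge q w e ∧ e ∈ (B.path s).edges := by
    rintro q' s hq' hs ⟨c, e, he, hes⟩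
    obtain rfl := (B.system_isChild.2 hq').parent_unique (B.system_isChild.2 h1)
    refine ⟨e, ?_, hes⟩
    by_cases hcm : c = m
    · exfalso
      rw [hcm] at he
      have h3 := he.le hes
      have h4 := (B.system_touch.2 hs).mono h3 (B.system_le.2 hmax.1)
      exact hmax.2.1 (B.system_touch.1 h4)
    · obtain ⟨r, l, hk⟩ := B.system_binary.exists_kids (B.system_isChild.2 h1)
      have hcw : c = w := by
        rcases (hk.2 m).1 (B.system_isChild.2 h1) with rfl | rfl <;>
        rcases (hk.2 w).1 (B.system_isChild.2 h2) with rfl | rfl <;>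
        rcases (hk.2 c).1 (B.system_isChild.2 he.1) with rfl | rfl <;> tauto
      rwa [← hcw]
  obtain ⟨r, l, hk⟩ := B.system_binary.exists_kids (B.system_isChild.2 h1)
  have hcases : (w = r ∧ m = l) ∨ (w = l ∧ m = r) := by
    rcases (hk.2 m).1 (B.system_isChild.2 h1) with rfl | rfl <;>
    rcases (hk.2 w).1 (B.system_isChild.2 h2) with rfl | rfl <;> tauto
  rcases hcases with ⟨rfl, rfl⟩ | ⟨rfl, rfl⟩
  · rw [PathSystem.sideLabels_eq σ.label hk hwS]
    refine ⟨?_, fun q' s hq' hs hint => ?_⟩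
    · obtain ⟨u, hu, hlab⟩ := PathSystem.chainLabels_top σ.label hwS
      obtain ⟨⟨D, hD, hD2, hDs⟩, -⟩ := (hcalled u (B.system_touch.1 hu)).exists_pair hsp
      refine ⟨D, hD, hD2, fun c hc => ?_⟩
      obtain ⟨s, hs, rfl⟩ := hlab c hc
      exact hDs s hs
    · obtain ⟨e, he, hes⟩ := hedge q' s hq' hs hint
      obtain ⟨r, l, hk', ⟨rfl, hx⟩ | ⟨hwl, hx⟩⟩ := he.cases
      · obtain ⟨-, rfl⟩ := hk.unique hk'
        exact ⟨w, s, hwS, .refl, hx.chain B.system_binary hk hqp (B.system_touch.2 hs)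
          (by rwa [system_edges]), rfl⟩
      · exact absurd (hwl.trans (hk.unique hk').2.symm) hk.ne
  · have hwS' := PathSystem.mirror_touch.2 hwS
    have e1 := PathSystem.sideLabels_eq σ.label hk.mirror hwS'
    rw [PathSystem.mirror_mirror, Set.union_comm] at e1
    rw [e1]
    refine ⟨?_, fun q' s hq' hs hint => ?_⟩
    · obtain ⟨u, hu, hlab⟩ := PathSystem.chainLabels_top σ.label hwS'
      obtain ⟨-, D, hD, hD2, hDs⟩ := (hcalled u (B.system_touch.1
        (PathSystem.mirror_touch.1 hu))).exists_pair hsp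
      refine ⟨D, hD, hD2, fun c hc => ?_⟩
      obtain ⟨s, hs, rfl⟩ := hlab c hc
      exact hDs s hs
    · obtain ⟨e, he, hes⟩ := hedge q' s hq' hs hint
      obtain ⟨r, l, hk', ⟨hwr, hx⟩ | ⟨rfl, hx⟩⟩ := he.cases
      · exact absurd (hwr.trans (hk.unique hk').1.symm) hk.ne.symm
      · obtain ⟨rfl, -⟩ := hk.unique hk'
        exact ⟨w, s, hwS', .refl, hx.chain B.system_binary.mirror hk.mirror
          ((PathSystem.mirror_le _).2 hqp) (PathSystem.mirror_touch.2 (B.system_touch.2 hs))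
          (by rwa [PathSystem.mirror_edges, system_edges]), rfl⟩

/-- If `m' ⇢ m`, the parent of `m'` is below the touching sibling of `m`, hence strictly smaller
than the parent of `m`. -/
theorem MaxIII.wellFounded [Finite κ] (B : BinaryFamily M κ) (p : κ) :
    WellFounded fun m' m => B.MaxIII p m' ∧ B.MaxIII p m ∧ B.DashArrow m' m := by
  classical
  choose! par hpar using fun (m : κ) (h : B.MaxIII p m) =>
    show ∃ q, B.IsChild m q from ⟨h.2.choose, h.2.choose_spec.choose_spec.1⟩
  refine Subrelation.wf (r := InvImage (· < ·) fun m => B.system.size (par m)) ?_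
    (InvImage.wf _ Nat.lt_wfRel.wf)
  rintro m' m ⟨hm', hm, harr⟩
  have hq' := B.system_isChild.2 (hpar m' hm')
  have hq := B.system_isChild.2 (hpar m hm)
  obtain ⟨hmax, q, w, h1, h2, hne, hw⟩ := hm
  obtain ⟨e, he, hem⟩ := harr.exists_edge hmax hm'.1 h1 h2 hne
  obtain rfl := (B.system_isChild.2 h1).parent_unique hq
  have hm'w : m' ≠ w := by rintro rfl; exact hm'.1.2.1 hw
  have h3 := hq'.le_of_lt (he.le hem) hm'w
  have h4 := (B.system_isChild.2 h2).2.1.size_lt h2.1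
  change B.system.size (par m') < B.system.size (par m)
  by_cases h5 : par m' = w
  · rwa [h5]
  · exact (h3.size_lt h5).trans h4

theorem RightColor.congr {σ' : Vars κ} {p q : κ} {c₁ c₂ c₃ : Fin 4}
    (hl : ∀ q, B.Touch p q → σ.label q = σ'.label q) (hq : B.Touch p q)
    (h : B.RightColor σ p q c₁ c₂ c₃) : B.RightColor σ' p q c₁ c₂ c₃ := by
  induction h with
  | none h1 h2 => exact .none (hl _ hq ▸ h1) h2
  | one h1 h2 _ ih => exact .one (hl _ hq ▸ h1) h2 (ih ((h2 _).2 rfl).2)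
  | two h1 hk hr hl' _ _ ih ih' => exact .two (hl _ hq ▸ h1) hk hr hl' (ih hr) (ih' hl')

theorem LeftColor.congr {σ' : Vars κ} {p q : κ} {c₁ c₂ c₃ : Fin 4}
    (hl : ∀ q, B.Touch p q → σ.label q = σ'.label q) (hq : B.Touch p q)
    (h : B.LeftColor σ p q c₁ c₂ c₃) : B.LeftColor σ' p q c₁ c₂ c₃ := by
  induction h with
  | none h1 h2 => exact .none (hl _ hq ▸ h1) h2
  | one h1 h2 _ ih => exact .one (hl _ hq ▸ h1) h2 (ih ((h2 _).2 rfl).2)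
  | two h1 hk hr hl' _ _ ih ih' => exact .two (hl _ hq ▸ h1) hk hr hl' (ih hl') (ih' hr)

/-- The calls for `p` read labels on `Touch_p` only, which allows executions to be pasted together.
-/
theorem ColorSpecialTouch.congr {σ' : Vars κ} {p : κ}
    (hl : ∀ q, B.Touch p q → σ.label q = σ'.label q) (ht : σ.triple p = σ'.triple p)
    (hs : σ.special p = σ'.special p) (h : B.ColorSpecialTouch σ p) :
    B.ColorSpecialTouch σ' p := by
  have key : ∀ q cr cl, B.Touch p q → B.SetColor σ p q cr cl → B.SetColor σ' p q cr cl := by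
    intro q cr cl hq h
    induction h with
    | none h1 h2 => exact .none (hl _ hq ▸ hs ▸ h1) h2
    | one h1 h2 _ ih => exact .one (hl _ hq ▸ hs ▸ h1) h2 (ih ((h2 _).2 rfl).2)
    | right h1 hk hr hl' hsp hd _ h2 ih =>
      exact .right (hl _ hq ▸ hs ▸ h1) hk hr hl' hsp (hs ▸ ht ▸ hd) (ih hr) (hs ▸ h2.congr hl hl')
    | left h1 hk hr hl' hsp hd _ h2 ih =>
      exact .left (hl _ hq ▸ hs ▸ h1) hk hr hl' hsp (hs ▸ ht ▸ hd) (ih hl') (hs ▸ h2.congr hl hr)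
  obtain ⟨cr, hcr, cl, hcl, h⟩ := h
  rw [ht, hs] at hcr hcl
  exact ⟨cr, hcr, cl, hcl, key p cr cl (B.system_touch.1 (.refl p)) h⟩

/-- The loops over the faces of type II and over the trees can be executed. -/
theorem exists_tripleSpecialMax [Finite κ] {p : κ} (label : κ → Fin 4) (T : Finset (Fin 4))
    (sc : Fin 4) (hT : T.card = 3) (hsc : sc ∈ T)
    (hc : B.ColorSpecialTouch ⟨label, fun _ => T, fun _ => sc⟩ p) :
    ∃ tr sp, tr p = T ∧ sp p = sc ∧ B.TripleSpecialMax ⟨label, tr, sp⟩ p := by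
  classical
  obtain ⟨a, ha, b, hb, hab⟩ := Finset.one_lt_card.1 (by omega : 1 < T.card)
  obtain ⟨x, hx⟩ : ∃ x, Finset.univ \ T = {x} := Finset.card_eq_one.1 (by
    rw [Finset.card_sdiff_of_subset (Finset.subset_univ _), hT]
    rfl)
  have hother : ∀ D, ∃ y, D ⊆ T → D.card = 2 → T \ D = {y} := by
    intro D
    by_cases h : D ⊆ T ∧ D.card = 2
    · obtain ⟨y, hy⟩ := Finset.card_eq_one.1 (by
        rw [Finset.card_sdiff_of_subset h.1, hT, h.2] : (T \ D).card = 1)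
      exact ⟨y, fun _ _ => hy⟩
    · exact ⟨0, fun h1 h2 => absurd ⟨h1, h2⟩ h⟩
  choose other hother using hother
  have hpair : ∀ X : Set (Fin 4), ∃ D : Finset (Fin 4), (∃ D ⊆ T, D.card = 2 ∧ X ⊆ D) →
      D ⊆ T ∧ D.card = 2 ∧ X ⊆ D := by
    intro X
    by_cases h : ∃ D ⊆ T, D.card = 2 ∧ X ⊆ D
    · obtain ⟨D, h⟩ := h
      exact ⟨D, fun _ => h⟩
    · exact ⟨∅, fun h' => absurd h' h⟩
  choose pair hpair using hpair
  obtain ⟨A, hA, hroot⟩ := exists_alternating (MaxIII.wellFounded B p)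
    fun m' m'' m h h' => h.2.2.unique h.2.1 h.1.1 h'.1.1 h'.2.2
  let Δ : κ → Finset (Fin 4) := fun m =>
    pair (B.system.sideLabels p label m ∪ B.system.mirror.sideLabels p label m)
  let tr : κ → Finset (Fin 4) := fun m => if B.MaxIII p m ∧ m ∈ A then Δ m ∪ {x} else T
  -- Class `A` gets the label `x` outside `T`, the other class the label of `T` beside `Δ`; for
  -- siblings of type II the right one gets `a` and the left one `b`.
  let sp : κ → Fin 4 := fun m => if m = p then sc else
    if B.MaxIII p m then if m ∈ A then x else other (Δ m)
    else if ∃ q l, B.Children q m l then a else b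
  have htr : ∀ m, ¬ B.MaxIII p m → tr m = T := fun m hm => if_neg fun h => hm h.1
  have hpnot : ¬ B.MaxIII p p := fun h => h.1.ne rfl
  have hp1 : tr p = T := htr p hpnot
  have hp2 : sp p = sc := if_pos rfl
  refine ⟨tr, sp, hp1, hp2, fun q r l hk hr hl => ?_, Δ, A, ?_, ?_⟩
  · have hk' := B.system_kids.2 hk
    have hnot : ∀ m, B.IsChild m q → ¬ B.MaxIII p m := by
      rintro m hm ⟨-, q', w, h1, h2, -, h4⟩
      obtain rfl := (B.system_isChild.2 hm).parent_unique (B.system_isChild.2 h1)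
      rcases (hk.2 w).1 h2 with rfl | rfl
      exacts [hr.2.1 h4, hl.2.1 h4]
    have hr3 := hnot r (B.system_isChild.1 hk'.right)
    have hl3 := hnot l (B.system_isChild.1 hk'.left)
    have hspr : sp r = a := by
      simp only [sp]
      rw [if_neg hr.ne, if_neg hr3, if_pos ⟨q, l, hk⟩]
    have hspl : sp l = b := by
      simp only [sp]
      rw [if_neg hl.ne, if_neg hl3, if_neg]
      rintro ⟨q', l', hk''⟩
      have hk3 := B.system_kids.2 hk''
      obtain rfl := hk'.left.parent_unique hk3.right
      exact hk'.ne (hk'.unique hk3).1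
    refine ⟨?_, ?_, ?_, ?_, ?_⟩
    · change sp r ∈ tr p
      rw [hspr, hp1]; exact ha
    · change sp l ∈ tr p
      rw [hspl, hp1]; exact hb
    · change sp r ≠ sp l
      rw [hspl, hspr]; exact hab
    · exact (htr r hr3).trans hp1.symm
    · exact (htr l hl3).trans hp1.symm
  · intro m m' hm hm' harr
    exact ⟨congrArg pair (harr.sideLabels_eq label hm' hm), hA m m' ⟨hm, hm', harr⟩⟩
  · intro m hm
    obtain ⟨h1, h2⟩ := hm.exists_pair (σ := ⟨label, fun _ => T, fun _ => sc⟩) hT hsc hc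
    obtain ⟨h3, h4, h5⟩ := hpair _ h1
    refine ⟨fun h => hroot m fun m' h' => h m' h'.1 h'.2.2, ?_, h4, fun q s hq hs hint =>
      h5 (h2 q s hq hs hint), fun hmA => ?_, fun hmA => ?_⟩
    · change Δ m ⊆ tr p
      rw [hp1]
      exact h3
    · have hspm : sp m = x := by
        simp only [sp]
        rw [if_neg hm.1.ne, if_pos hm, if_pos hmA]
      have htrm : tr m = Δ m ∪ {x} := if_pos ⟨hm, hmA⟩
      change {sp m} = Finset.univ \ tr p ∧ tr m = Δ m ∪ {sp m}
      rw [hspm, hp1, htrm, hx]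
      exact ⟨rfl, rfl⟩
    · have hspm : sp m = other (Δ m) := by
        simp only [sp]
        rw [if_neg hm.1.ne, if_pos hm, if_neg hmA]
      have htrm : tr m = T := if_neg fun h => hmA h.2
      change {sp m} = tr p \ Δ m ∧ tr m = tr p
      rw [hspm, hp1, htrm]
      exact ⟨(hother _ h3 h4).symm, rfl⟩

theorem TripleSpecialMax.congr {σ' : Vars κ} {p : κ}
    (hl : ∀ q, B.Touch p q → σ.label q = σ'.label q) (ht : σ.triple p = σ'.triple p)
    (hm : ∀ m, B.Max p m → σ.triple m = σ'.triple m ∧ σ.special m = σ'.special m)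
    (h : B.TripleSpecialMax σ p) : B.TripleSpecialMax σ' p := by
  obtain ⟨h1, Δ, A, h2, h3⟩ := h
  refine ⟨fun q r l hk hr hl => ?_, Δ, A, h2, fun m hmIII => ?_⟩
  · rw [← (hm r hr).1, ← (hm r hr).2, ← (hm l hl).1, ← (hm l hl).2, ← ht]
    exact h1 q r l hk hr hl
  · rw [← (hm m hmIII.1).1, ← (hm m hmIII.1).2, ← ht]
    obtain ⟨k1, k2, k3, k4, k5⟩ := h3 m hmIII
    exact ⟨k1, k2, k3, fun q s hq hs hint => hl s hs ▸ k4 q s hq hs hint, k5⟩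

theorem Max.eq_of_le {p s m m' : κ} (hm : B.Max p m) (hm' : B.Max p m') (h : B.Le s m)
    (h' : B.Le s m') : m = m' := by
  rcases (B.system_le.2 h).total (B.system_le.2 h') with h1 | h1
  · exact (hm.2.2 m' hm'.1 hm'.2.1 (B.system_le.1 h1)).symm
  · exact hm'.2.2 m hm.1 hm.2.1 (B.system_le.1 h1)

theorem Max.not_touch_of_le {p s m : κ} (hm : B.Max p m) (h : B.Le s m) : ¬ B.Touch p s :=
  fun hs => hm.2.1 (B.system_touch.1 ((B.system_touch.2 hs).mono (B.system_le.2 h)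
    (B.system_le.2 hm.1)))

theorem Max.le_of_reflTransGen {p p' : κ} (h : ReflTransGen B.Max p p') : B.Le p' p := by
  induction h with
  | refl => exact B.system_le.1 (.refl p)
  | tail _ h ih => exact B.system_le.1 ((B.system_le.2 h.1).trans (B.system_le.2 ih))

/-- Execute both loops at `p`, then recursively below each member of `Max_p` with the triple and
special label just assigned. A path below `p` either touches `p` or is below exactly one member of
`Max_p`, so the partial executions never conflict. -/
theorem exists_run_below [Finite κ] (B : BinaryFamily M κ) :
    ∀ (n : ℕ) (p : κ) (T : Finset (Fin 4)) (sc : Fin 4), B.system.size p ≤ n → T.card = 3 →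
      sc ∈ T → ∃ σ : Vars κ, σ.triple p = T ∧ σ.special p = sc ∧
        ∀ p', ReflTransGen B.Max p p' → B.ColorSpecialTouch σ p' ∧ B.TripleSpecialMax σ p' := by
  classical
  intro n
  induction n with
  | zero =>
    intro p T sc hn
    have := B.system.lo_lt_hi p
    unfold PathSystem.size at hn
    omega
  | succ n ih =>
    intro p T sc hn hT hsc
    obtain ⟨label, hc⟩ := exists_colorSpecialTouch B p (fun _ => T) (fun _ => sc) hT hsc
    obtain ⟨tr, sp, htr, hsp, hm⟩ := exists_tripleSpecialMax label T sc hT hsc hc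
    have hinv := fun m (h : B.Max p m) => hm.invariant ((congrArg Finset.card htr).trans hT) h
    have hih : ∀ m, ∃ σ : Vars κ, B.Max p m → σ.triple m = tr m ∧ σ.special m = sp m ∧
        ∀ p', ReflTransGen B.Max m p' → B.ColorSpecialTouch σ p' ∧ B.TripleSpecialMax σ p' := by
      intro m
      by_cases h : B.Max p m
      · obtain ⟨σ, hσ⟩ := ih m (tr m) (sp m) (by
          have := (B.system_le.2 h.1).size_lt h.ne
          omega) (hinv m h).1 (hinv m h).2
        exact ⟨σ, fun _ => hσ⟩
      · exact ⟨⟨label, tr, sp⟩, fun h' => absurd h' h⟩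
    choose τ hτ using hih
    let val : κ → Vars κ := fun s =>
      if h : ∃ m, B.Max p m ∧ B.Le s m then τ h.choose else ⟨label, tr, sp⟩
    have hval : ∀ s m, B.Max p m → B.Le s m → val s = τ m := by
      intro s m hm hs
      have hex : ∃ m, B.Max p m ∧ B.Le s m := ⟨m, hm, hs⟩
      have : val s = τ hex.choose := dif_pos hex
      rw [this, hex.choose_spec.1.eq_of_le hm hex.choose_spec.2 hs]
    have hval' : ∀ s, B.Touch p s → val s = ⟨label, tr, sp⟩ := by
      intro s hs
      refine dif_neg ?_
      rintro ⟨m, hm, hsm⟩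
      exact hm.not_touch_of_le hsm hs
    have hvalp := hval' p (B.system_touch.1 (.refl p))
    refine ⟨⟨fun s => (val s).label s, fun s => (val s).triple s, fun s => (val s).special s⟩,
      ?_, ?_, fun p' hp' => ?_⟩
    · simp only [hvalp, htr]
    · simp only [hvalp, hsp]
    · rcases hp'.cases_head with rfl | ⟨m, hmax, hp'⟩
      · refine ⟨hc.congr (fun q hq => ?_) ?_ ?_, hm.congr (fun q hq => ?_) ?_ fun m hmax => ?_⟩
        · simp only [hval' q hq]
        · simp only [hvalp, htr]
        · simp only [hvalp, hsp]
        · simp only [hval' q hq]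
        · simp only [hvalp]
        · obtain ⟨h1, h2, -⟩ := hτ m hmax
          simp only [hval m m hmax (B.system_le.1 (.refl m)), h1, h2, and_self]
      · have hp'm := Max.le_of_reflTransGen hp'
        have hle : ∀ s, B.Le s p' → val s = τ m := fun s hs =>
          hval s m hmax (B.system_le.1 ((B.system_le.2 hs).trans (B.system_le.2 hp'm)))
        obtain ⟨h1, h2⟩ := (hτ m hmax).2.2 p' hp'
        have hp'' := hle p' (B.system_le.1 (.refl p'))
        refine ⟨h1.congr (fun q hq => ?_) ?_ ?_, h2.congr (fun q hq => ?_) ?_ fun m' hm' => ?_⟩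
        · simp only [hle q hq.1]
        · simp only [hp'']
        · simp only [hp'']
        · simp only [hle q hq.1]
        · simp only [hp'']
        · simp only [hle m' hm'.1, and_self]

/-- The main loop can be executed. -/
theorem exists_run [Finite κ] (B : BinaryFamily M κ) : ∃ σ : Vars κ, B.Run σ := by
  obtain ⟨σ, h1, h2, h3⟩ := B.exists_run_below _ B.root {0, 1, 2} 0 le_rfl (by decide) (by decide)
  have hlevel : ∀ n, ∀ p ∈ B.MAXLevel n, ReflTransGen B.Max B.root p := by
    intro n
    induction n with
    | zero => rintro p rfl; exact .refl
    | succ n ih => rintro m ⟨p, hp, hm⟩; exact (ih p hp).tail hm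
  exact ⟨σ, h1, h2, fun n p hp => h3 p (hlevel n p hp)⟩

end BinaryFamily

/-! ### Completion to a binary family -/

/-- A path composed of an initial part of `u` and a part of `v`. -/
theorem GPath.Contig.join {V : Type*} {G : SimpleGraph V} {x u v w : GPath G} {n β : ℕ}
    (hn : n ≤ u.len) (hx : n ≤ x.len) (hβ : β + (x.len - n) ≤ v.len)
    (h1 : ∀ i ≤ n, x.vert i = u.vert i) (h2 : ∀ k ≤ x.len - n, x.vert (n + k) = v.vert (β + k))
    (huv : Contig u v) (huw : Contig u w) (hvw : Contig v w)
    (h : (∀ k ≤ x.len - n, v.vert (β + k) ∈ w.verts → v.vert (β + k) ∈ u.verts) ∨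
      ∀ i ≤ n, u.vert i ∈ w.verts → u.vert i ∈ v.verts) : Contig x w := by
  have h0 : u.vert n = v.vert β := (h1 n le_rfl).symm.trans (h2 0 (Nat.zero_le _))
  have h2' : ∀ i, n ≤ i → i ≤ x.len → x.vert i = v.vert (β + (i - n)) := fun i hi hi' => by
    rw [← h2 (i - n) (by omega)]; congr 1; omega
  -- In either case `x` is contiguous with one of `u`, `v`, and that one contains all common
  -- vertices of `x` and `w`; then `transit` applies.
  rcases h with h | h
  · refine Contig.transit (q := u) (fun i j hij hj hi hj' k hik hkj => ?_) huw ?_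
    · by_cases hk : k + 1 ≤ n
      · rw [h1 k (by omega), h1 _ hk]
        exact u.edge_mem (by omega)
      · rw [h2' k (by omega) (by omega), h2' (k + 1) (by omega) (by omega),
          show β + (k + 1 - n) = β + (k - n) + 1 by omega]
        rw [h2' j (by omega) hj] at hj'
        exact huv.symm β (β + (j - n)) (by omega) (by omega) (h0 ▸ u.vert_mem _) hj' _ (by omega)
          (by omega)
    · intro y hy hyw
      obtain ⟨i, hi, rfl⟩ := mem_verts.1 hy
      by_cases hin : i ≤ n
      · rw [h1 i hin]; exact u.vert_mem _
      · rw [h2' i (by omega) hi] at hyw ⊢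
        exact h _ (by omega) hyw
  · refine Contig.transit (q := v) (fun i j hij hj hi hj' k hik hkj => ?_) hvw ?_
    · by_cases hk : k + 1 ≤ n
      · rw [h1 k (by omega), h1 _ hk]
        rw [h1 i (by omega)] at hi
        exact huv i n (by omega) hn hi (h0 ▸ v.vert_mem _) k hik hk
      · rw [h2' k (by omega) (by omega), h2' (k + 1) (by omega) (by omega),
          show β + (k + 1 - n) = β + (k - n) + 1 by omega]
        exact v.edge_mem (by omega)
    · intro y hy hyw
      obtain ⟨i, hi, rfl⟩ := mem_verts.1 hy
      by_cases hin : i ≤ n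
      · rw [h1 i hin] at hyw ⊢
        exact h i hin hyw
      · rw [h2' i (by omega) hi]; exact v.vert_mem _

theorem GPath.Contig.sub {V : Type*} {G : SimpleGraph V} {x p w : GPath G} (h : Contig p w)
    {a : ℕ} (ha : a + x.len ≤ p.len) (hx : ∀ i ≤ x.len, x.vert i = p.vert (a + i)) :
    Contig x w := by
  intro i j hij hj hi hj' k hik hkj
  rw [hx i (by omega)] at hi
  rw [hx j hj] at hj'
  rw [hx k (by omega), hx (k + 1) (by omega)]
  exact h (a + i) (a + j) (by omega) (by omega) hi hj' (a + k) (by omega) (by omega)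

namespace PathSystem

variable {V : Type*} {G : SimpleGraph V} {κ : Type*} {S : PathSystem G κ}

theorem IsChild.disjoint {q c c' : κ} (h : S.IsChild c q) (h' : S.IsChild c' q) (hne : c ≠ c') :
    S.hi c ≤ S.lo c' ∨ S.hi c' ≤ S.lo c := by
  rcases S.wellFormed c c' with h1 | h1 | h1 | h1
  · rcases h.2.2 c' h'.2.1 h1 with h2 | h2
    exacts [absurd h2.symm hne, absurd h2 h'.1]
  · rcases h'.2.2 c h.2.1 h1 with h2 | h2
    exacts [absurd h2 hne, absurd h2 h.1]
  · exact Or.inl h1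
  · exact Or.inr h1

end PathSystem

/-! ### Saturated families. -/

namespace PlaneGraph

variable {V : Type*} [Finite V] {M : PlaneGraph V}

namespace Layout

variable {κ : Type*} {Q : κ → GPath M.G} (L : M.Layout Q)

/-- The path of the region `R` can be added to the family. -/
structure Compatible (R : Region M L.base) : Prop where
  lo_lt_hi : R.lo < R.hi
  wellFormed : ∀ j, (L.lo j ≤ R.lo ∧ R.hi ≤ L.hi j) ∨ (R.lo ≤ L.lo j ∧ L.hi j ≤ R.hi) ∨
    R.hi ≤ L.lo j ∨ L.hi j ≤ R.lo
  contig : ∀ j, GPath.Contig R.path (L.region j).path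

/-- No path with a new arc can be added to the family. -/
def Saturated : Prop :=
  ∀ R : Region M L.base, L.Compatible R → ∃ i, L.lo i = R.lo ∧ L.hi i = R.hi

variable {L}

/-- An arc whose extremal corners are adjacent vertices is in a saturated family. -/
theorem Saturated.exists_of_adj (h : L.Saturated) (hst : ∀ i j, (Q i).SingleTouch (Q j)) {a b : ℕ}
    (hab : a < b) (hb : b < M.outerLength)
    (hwf : ∀ j, (L.lo j ≤ a ∧ b ≤ L.hi j) ∨ (a ≤ L.lo j ∧ L.hi j ≤ b) ∨ b ≤ L.lo j ∨ L.hi j ≤ a)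
    (hadj : M.G.Adj (M.corner L.base a).fst (M.corner L.base b).fst) :
    ∃ i, L.lo i = a ∧ L.hi i = b := by
  suffices hx : ∃ x : GPath M.G, x.x = (M.corner L.base a).fst ∧ x.y = (M.corner L.base b).fst ∧
      ∀ j, GPath.Contig x (L.region j).path by
    obtain ⟨x, hx, hy, hc⟩ := hx
    exact h ⟨x, a, b, L.base_outer, by omega, hb, by omega, hx.symm, hy.symm⟩ ⟨hab, hwf, hc⟩
  set u := (M.corner L.base a).fst with hu
  set v := (M.corner L.base b).fst with hv
  -- If a member contains both vertices, its stretch between them is compatible with all members.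
  -- Otherwise the single edge is, since it meets each member in at most one vertex.
  by_cases hj : ∃ j, u ∈ (L.region j).path.verts ∧ v ∈ (L.region j).path.verts
  · obtain ⟨j, huj, hvj⟩ := hj
    have key : ∀ p : GPath M.G, (∀ w, GPath.Contig p (L.region w).path) → ∀ i k, i ≤ k →
        k ≤ p.len → p.vert i = u → p.vert k = v → ∃ x : GPath M.G, x.x = u ∧ x.y = v ∧
        ∀ j, GPath.Contig x (L.region j).path := by
      intro p hp i k hik hk hi hkv
      obtain ⟨x, hlen, hx⟩ := p.exists_sub hik hk
      refine ⟨x, ?_, ?_, fun w => (hp w).sub (a := i) (by omega) fun t ht => hx t (by omega)⟩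
      · rw [← x.vert_zero, hx 0 (Nat.zero_le _), ← hi]; rfl
      · rw [← x.vert_len, hx x.len hlen.le, ← hkv]; congr 1; omega
    obtain ⟨i, hi, hiu⟩ := GPath.mem_verts.1 huj
    obtain ⟨k, hk, hkv⟩ := GPath.mem_verts.1 hvj
    rcases le_total i k with hik | hik
    · exact key (L.region j).path (fun w => L.region_contig hst j w) i k hik hk hiu hkv
    · refine key (L.region j).path.rev (fun w => (L.region_contig hst j w).rev_left)
        ((L.region j).path.len - i) ((L.region j).path.len - k) (by omega)
        (by rw [GPath.rev_len]; omega) ?_ ?_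
      · rw [GPath.rev_vert, ← hiu]; congr 1; omega
      · rw [GPath.rev_vert, ← hkv]; congr 1; omega
  · push Not at hj
    refine ⟨⟨Walk.cons hadj Walk.nil, by simpa using hadj.ne⟩, rfl, rfl, fun j => ?_⟩
    intro i k hik hk hi hk'
    change k ≤ 1 at hk
    obtain rfl : k = 1 := by omega
    obtain rfl : i = 0 := by omega
    exact absurd hk' (hj j hi)

theorem Saturated.exists_unit (h : L.Saturated) (hst : ∀ i j, (Q i).SingleTouch (Q j)) {t : ℕ}
    (ht : t + 1 < M.outerLength) : ∃ i, L.lo i = t ∧ L.hi i = t + 1 := by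
  refine h.exists_of_adj hst (by omega) ht (fun j => ?_) ?_
  · have := L.lo_lt_hi j
    omega
  · rw [corner_succ_fst]
    exact (M.corner L.base t).adj

theorem Saturated.exists_root (h : L.Saturated) (hst : ∀ i j, (Q i).SingleTouch (Q j)) :
    ∃ i, L.lo i = 0 ∧ L.hi i = M.outerLength - 1 := by
  have h2 := two_le_outerLength L.base_outer
  refine h.exists_of_adj hst (by omega) (by omega) (fun j => ?_) ?_
  · have := L.hi_lt j
    omega
  · have h3 := (exists_period L.base_outer).1
    have h4 := corner_succ_fst (M := M) (base := L.base) (M.outerLength - 1)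
    rw [show M.outerLength - 1 + 1 = M.outerLength by omega, h3] at h4
    rw [corner_zero, h4]
    exact (M.corner L.base _).adj.symm

theorem system_lo (hst : ∀ i j, (Q i).SingleTouch (Q j)) (i : κ) :
    (L.system hst).lo i = L.lo i := rfl

theorem system_hi (hst : ∀ i j, (Q i).SingleTouch (Q j)) (i : κ) :
    (L.system hst).hi i = L.hi i := rfl

/-- In a saturated family, no path can be added that separates some children from the others. -/
theorem Saturated.false_of_region [Finite κ] (hst : ∀ i j, (Q i).SingleTouch (Q j))
    (h : L.Saturated) {q c₀ : κ} {R : Region M L.base}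
    (hR : R.lo < R.hi) (h1 : L.lo q ≤ R.lo) (h2 : R.hi ≤ L.hi q)
    (hne : ¬ (R.lo = L.lo q ∧ R.hi = L.hi q))
    (hch : ∀ c, (L.system hst).IsChild c q →
      (R.lo ≤ L.lo c ∧ L.hi c ≤ R.hi) ∨ R.hi ≤ L.lo c ∨ L.hi c ≤ R.lo)
    (hc₀ : (L.system hst).IsChild c₀ q) (h3 : R.lo ≤ L.lo c₀) (h4 : L.hi c₀ ≤ R.hi)
    (hne₀ : ¬ (R.lo = L.lo c₀ ∧ R.hi = L.hi c₀))
    (hcont : ∀ w, GPath.Contig R.path (L.region w).path) : False := by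
  have hbelow : ∀ w, (L.system hst).Le w q → w ≠ q →
      ∃ c, (L.system hst).IsChild c q ∧ L.lo c ≤ L.lo w ∧ L.hi w ≤ L.hi c := by
    intro w hw hwq
    obtain ⟨c, hc, hwc⟩ := PathSystem.exists_child_ge hw hwq
    exact ⟨c, hc, Int.ofNat_le.1 hwc.1, Int.ofNat_le.1 hwc.2⟩
  have hwf : ∀ w, (L.lo w ≤ R.lo ∧ R.hi ≤ L.hi w) ∨ (R.lo ≤ L.lo w ∧ L.hi w ≤ R.hi) ∨
      R.hi ≤ L.lo w ∨ L.hi w ≤ R.lo := by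
    intro w
    rcases L.wellFormed w q with k | k | k | k
    · by_cases hwq : w = q
      · subst hwq
        exact Or.inl ⟨h1, h2⟩
      · obtain ⟨c, hc, k1, k2⟩ := hbelow w ⟨Int.ofNat_le.2 k.1, Int.ofNat_le.2 k.2⟩ hwq
        have := hch c hc
        omega
    · omega
    · omega
    · omega
  -- A member with the arc of `R` is strictly below `q`, hence below a child. Since the arc covers
  -- `c₀`, that child is `c₀`, and then the arcs coincide, which is excluded.
  obtain ⟨i, hi1, hi2⟩ := h R ⟨hR, hwf, hcont⟩
  have hiq : i ≠ q := by
    rintro rfl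
    exact hne ⟨hi1.symm, hi2.symm⟩
  obtain ⟨c, hc, k1, k2⟩ := hbelow i
    ⟨Int.ofNat_le.2 (by omega), Int.ofNat_le.2 (by omega)⟩ hiq
  have := L.lo_lt_hi c₀
  by_cases hcc : c = c₀
  · subst hcc
    omega
  · have hd := hc.disjoint hc₀ hcc
    rw [system_lo, system_lo, system_hi, system_hi] at hd
    omega

end Layout

end PlaneGraph

/-! ### Saturated families are binary. -/

namespace PlaneGraph

variable {V : Type*} [Finite V] {M : PlaneGraph V}

namespace Layout

variable {κ : Type*} {Q : κ → GPath M.G} {L : M.Layout Q}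

/-- With `order_middle`, the analogue of the order axioms for three paths side by side; a path with
a third child needs it. -/
theorem order_first (hst : ∀ i j, (Q i).SingleTouch (Q j)) {a b c : κ} (hab : L.hi a ≤ L.lo b)
    (hbc : L.hi b ≤ L.lo c) {i j : ℕ} (hi : i ≤ (L.region a).path.len)
    (hib : (L.region a).path.vert i ∈ (L.region b).path.verts) (hj : j ≤ (L.region a).path.len)
    (hjc : (L.region a).path.vert j ∈ (L.region c).path.verts) : j ≤ i := by
  have h1 := L.lo_lt_hi a
  have h2 := L.lo_lt_hi b
  refine Region.order (L.disj_of_le hab) (L.disj_of_le (by omega)) (L.disj_of_le hbc) ?_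
    (L.region_contig hst a b) (L.region_contig hst a c) (L.region_contig hst b c) hi hib hj hjc
  intro t _ ht
  rw [L.region_lo, L.region_hi] at ht
  rw [L.region_lo, L.region_lo]
  unfold Cyc at ht ⊢
  omega

theorem order_middle (hst : ∀ i j, (Q i).SingleTouch (Q j)) {a b c : κ} (hab : L.hi a ≤ L.lo b)
    (hbc : L.hi b ≤ L.lo c) {i j : ℕ} (hi : i ≤ (L.region b).path.len)
    (hic : (L.region b).path.vert i ∈ (L.region c).path.verts) (hj : j ≤ (L.region b).path.len)
    (hja : (L.region b).path.vert j ∈ (L.region a).path.verts) : j ≤ i := by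
  have h1 := L.lo_lt_hi a
  have h2 := L.lo_lt_hi b
  have h3 := L.lo_lt_hi c
  refine Region.order (L.disj_of_le hbc) (L.disj_of_le hab).symm
    (L.disj_of_le (i := a) (j := c) (by omega)).symm ?_
    (L.region_contig hst b c) (L.region_contig hst b a) (L.region_contig hst c a) hi hic hj hja
  intro t _ ht
  rw [L.region_lo, L.region_hi] at ht
  rw [L.region_lo, L.region_lo]
  unfold Cyc at ht ⊢
  omega

/-- Unit arcs belong to the family, so the arcs of the children cover that of `q`; take the child at
the first corner and the one that follows it. -/
theorem Saturated.exists_children [Finite κ] (h : L.Saturated)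
    (hst : ∀ i j, (Q i).SingleTouch (Q j)) {q : κ} (hq : L.lo q + 1 < L.hi q) :
    ∃ r l, (L.system hst).IsChild r q ∧ (L.system hst).IsChild l q ∧ L.lo r = L.lo q ∧
      L.hi r = L.lo l := by
  have hlt := L.hi_lt q
  have hchild : ∀ t, L.lo q ≤ t → t + 1 ≤ L.hi q →
      ∃ c, (L.system hst).IsChild c q ∧ L.lo c ≤ t ∧ t + 1 ≤ L.hi c := by
    intro t h1 h2
    obtain ⟨i, hi1, hi2⟩ := h.exists_unit hst (t := t) (by omega)
    obtain ⟨c, hc, hic⟩ := PathSystem.exists_child_ge (S := L.system hst) (s := i) (q := q)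
      ⟨Int.ofNat_le.2 (by omega), Int.ofNat_le.2 (by omega)⟩ (by rintro rfl; omega)
    have h3 := Int.ofNat_le.1 hic.1
    have h4 := Int.ofNat_le.1 hic.2
    exact ⟨c, hc, by omega, by omega⟩
  obtain ⟨r, hr, hr1, hr2⟩ := hchild (L.lo q) le_rfl (by omega)
  have hrq1 := Int.ofNat_le.1 hr.2.1.1
  have hrq2 := Int.ofNat_le.1 hr.2.1.2
  have hrne : L.hi r ≠ L.hi q := fun he => hr.1 (L.arcs_distinct r q (by omega) he)
  obtain ⟨l, hl, hl1, hl2⟩ := hchild (L.hi r) (by omega) (by omega)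
  have hd := hr.disjoint hl (by rintro rfl; omega)
  rw [system_lo, system_lo, system_hi, system_hi] at hd
  exact ⟨r, l, hr, hl, by omega, by omega⟩

/-- If the second child meets its parent, it is the last child. -/
theorem Saturated.not_meets_parent [Finite κ] (h : L.Saturated)
    (hst : ∀ i j, (Q i).SingleTouch (Q j)) {q r l : κ} (hr : (L.system hst).IsChild r q)
    (hl : (L.system hst).IsChild l q) (hlo : L.lo r = L.lo q) (hrl : L.hi r = L.lo l)
    (hlt : L.hi l < L.hi q) {v : V} (hvl : v ∈ (L.region l).path.verts) :
    v ∉ (L.region q).path.verts := by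
  intro hvq
  have hr0 := L.lo_lt_hi r
  have hl0 := L.lo_lt_hi l
  have hq0 := L.lo_lt_hi q
  obtain ⟨j, hj, rfl⟩ := GPath.mem_verts.1 hvl
  -- The candidate follows `l` to its last vertex on `q` and then `q` to its end, grouping all
  -- children except `r`.
  obtain ⟨R, n, γ, -, hn, hγ, hnγ, -, -, hRlo, hRhi, hRlen, hR1, hR2⟩ :=
    Region.exists_cross (L.disj_rev_of_nested (i := l) (j := q) ⟨by omega, hlt.le⟩)
      (L.region_contig hst l q).rev_right hj (by
        change _ ∈ (L.region q).path.rev.verts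
        rwa [GPath.rev_verts])
  change R.hi = (L.region q).hi at hRhi
  change γ ≤ (L.region q).path.rev.len at hγ
  change _ = (L.region q).path.rev.vert γ at hnγ
  change ∀ k ≤ γ, R.path.vert (n + k) = (L.region q).path.rev.vert (γ - k) at hR2
  rw [L.region_lo] at hRlo
  rw [L.region_hi] at hRhi
  rw [GPath.rev_len] at hγ
  rw [GPath.rev_vert] at hnγ
  have hnq : (L.region l).path.vert n ∈ (L.region q).path.verts := hnγ ▸ GPath.vert_mem _ _
  have hql : (L.region q).path.vert ((L.region q).path.len - γ) ∈ (L.region l).path.verts :=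
    hnγ ▸ GPath.vert_mem _ _
  refine h.false_of_region hst (q := q) (c₀ := l) (R := R) (by omega) (by omega) (by omega)
    (by omega) (fun c hc => ?_) hl (by omega) (by omega) (by omega) fun w => ?_
  · have h1 := Int.ofNat_le.1 hc.2.1.1
    have h2 := Int.ofNat_le.1 hc.2.1.2
    have h3 := L.lo_lt_hi c
    by_cases hcr : c = r
    · subst hcr; omega
    · have hd := hr.disjoint hc (Ne.symm hcr)
      rw [system_lo, system_lo, system_hi, system_hi] at hd
      omega
  · refine GPath.Contig.join (n := n) (β := (L.region q).path.len - γ) hn (by omega) (by omega)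
      hR1 (fun k hk => ?_) (L.region_contig hst l q) (L.region_contig hst l w)
      (L.region_contig hst q w) ?_
    · rw [hR2 k (by omega), GPath.rev_vert]
      congr 1
      omega
    by_cases hw : (L.system hst).Le w q ∧ w ≠ q
    · obtain ⟨c, hc, hwc⟩ := PathSystem.exists_child_ge hw.1 hw.2
      have hw1 := Int.ofNat_le.1 hw.1.1
      have hw2 := Int.ofNat_le.1 hw.1.2
      have hc1 := Int.ofNat_le.1 hwc.1
      have hc2 := Int.ofNat_le.1 hwc.2
      by_cases hcl : c = l
      · subst hcl
        exact Or.inl fun k _ hk => PathSystem.sep_le hwc hc.2.1 hk (GPath.vert_mem _ _)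
      have hd := hc.disjoint hl hcl
      rw [system_lo, system_lo, system_hi, system_hi] at hd
      rcases hd with hd | hd
      · refine Or.inl fun k hk hkw => ?_
        have := (L.system hst).order_top q w l (Int.ofNat_le.2 hw1) (Int.ofNat_le.2 (by omega))
          (Int.ofNat_le.2 hlt.le) ((L.region q).path.len - γ + k) ((L.region q).path.len - γ)
          (by change _ ≤ (L.region q).path.len; omega)
          (Nat.sub_le _ _) hkw hql
        obtain rfl : k = 0 := by omega
        exact hql
      · refine Or.inr fun i hi hiw => ?_
        have := (L.system hst).order_right q l w (Int.ofNat_le.2 (by omega))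
          (Int.ofNat_le.2 (by omega)) (Int.ofNat_le.2 hw2) n i hn (hi.trans hn) hnq hiw
        obtain rfl : i = n := by omega
        exact hnq
    · refine Or.inr fun i _ hiw => ?_
      by_cases hwq : w = q
      · rwa [← hwq]
      · exact PathSystem.sep (S := L.system hst) hl.2.1 (fun h' => hw ⟨h', hwq⟩)
          (GPath.vert_mem _ _) hiw

/-- The first child does not meet a third child. -/
theorem Saturated.not_meets_child [Finite κ] (h : L.Saturated)
    (hst : ∀ i j, (Q i).SingleTouch (Q j)) {q r l c : κ} (hr : (L.system hst).IsChild r q)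
    (hlo : L.lo r = L.lo q) (hrl : L.hi r = L.lo l) (hc : (L.system hst).IsChild c q)
    (hlc : L.hi l ≤ L.lo c) {v : V} (hvr : v ∈ (L.region r).path.verts) :
    v ∉ (L.region c).path.verts := by
  intro hvc
  have hr0 := L.lo_lt_hi r
  have hl0 := L.lo_lt_hi l
  have hc0 := L.lo_lt_hi c
  have hcq1 := Int.ofNat_le.1 hc.2.1.1
  have hcq2 := Int.ofNat_le.1 hc.2.1.2
  obtain ⟨j, hj, rfl⟩ := GPath.mem_verts.1 hvr
  -- The candidate follows `r` to its last vertex on `c` and returns to the start of `c`, grouping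
  -- the children before `c`.
  obtain ⟨R, n, γ, -, hn, hγ, hnγ, -, -, hRlo, hRhi, hRlen, hR1, hR2⟩ :=
    Region.exists_cross (L.disj_of_le (i := r) (j := c) (by omega))
      (L.region_contig hst r c) hj hvc
  rw [L.region_lo] at hRlo hRhi
  have hnc : (L.region r).path.vert n ∈ (L.region c).path.verts := hnγ ▸ GPath.vert_mem _ _
  have hcr : (L.region c).path.vert γ ∈ (L.region r).path.verts := hnγ ▸ GPath.vert_mem _ _
  refine h.false_of_region hst (q := q) (c₀ := r) (R := R) (by omega) (by omega) (by omega)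
    (by omega) (fun d hd => ?_) hr (by omega) (by omega) (by omega) fun w => ?_
  · have h1 := Int.ofNat_le.1 hd.2.1.1
    have h2 := Int.ofNat_le.1 hd.2.1.2
    by_cases hdc : d = c
    · subst hdc; omega
    · have hd' := hd.disjoint hc hdc
      rw [system_lo, system_lo, system_hi, system_hi] at hd'
      omega
  · refine GPath.Contig.join (v := (L.region c).path.rev) (n := n) (β := (L.region c).path.len - γ)
      hn (by omega) (by rw [GPath.rev_len]; omega)
      hR1 (fun k hk => ?_) (L.region_contig hst r c).rev_right (L.region_contig hst r w)
      (L.region_contig hst c w).rev_left ?_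
    · rw [hR2 k (by omega), GPath.rev_vert]
      congr 1
      omega
    have hrev : ∀ k ≤ R.path.len - n, (L.region c).path.rev.vert ((L.region c).path.len - γ + k) =
        (L.region c).path.vert (γ - k) := by
      intro k hk
      rw [GPath.rev_vert]
      congr 1
      omega
    rw [GPath.rev_verts]
    by_cases hw : (L.system hst).Le w q ∧ w ≠ q
    · obtain ⟨d, hd, hwd⟩ := PathSystem.exists_child_ge hw.1 hw.2
      have hd1 := Int.ofNat_le.1 hwd.1
      have hd2 := Int.ofNat_le.1 hwd.2
      have hw0 := L.lo_lt_hi w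
      have hdq := Int.ofNat_le.1 hd.2.1.1
      by_cases hdr : d = r
      · subst hdr
        refine Or.inl fun k hk hkw => ?_
        rw [hrev k hk] at hkw ⊢
        refine PathSystem.sep hwd (r := c) (fun h' => ?_) hkw (GPath.vert_mem _ _)
        have := Int.ofNat_le.1 h'.2
        omega
      by_cases hdc : d = c
      · subst hdc
        refine Or.inr fun i hi hiw => ?_
        refine PathSystem.sep hwd (r := r) (fun h' => ?_) hiw (GPath.vert_mem _ _)
        have := Int.ofNat_le.1 h'.1
        omega
      have hd3 := hd.disjoint hr hdr
      have hd4 := hd.disjoint hc hdc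
      rw [system_lo, system_lo, system_hi, system_hi] at hd3 hd4
      rcases hd4 with hd4 | hd4
      · refine Or.inr fun i hi hiw => ?_
        have := order_first hst (a := r) (b := w) (c := c) (by omega) (by omega) (hi.trans hn) hiw
          hn hnc
        obtain rfl : i = n := by omega
        exact hnc
      · refine Or.inl fun k hk hkw => ?_
        rw [hrev k hk] at hkw ⊢
        have := order_middle hst (a := r) (b := c) (c := w) (by omega) (by omega)
          ((Nat.sub_le _ _).trans hγ) hkw hγ hcr
        rwa [show γ - k = γ by omega]
    · refine Or.inl fun k hk hkw => ?_
      rw [hrev k hk] at hkw ⊢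
      have hkq : (L.region c).path.vert (γ - k) ∈ (L.region q).path.verts := by
        by_cases hwq : w = q
        · rwa [← hwq]
        · exact PathSystem.sep (S := L.system hst) hc.2.1 (fun h' => hw ⟨h', hwq⟩)
            (GPath.vert_mem _ _) hkw
      have := (L.system hst).order_left q r c (Int.ofNat_le.2 hlo.ge)
        (Int.ofNat_le.2 (by omega)) (Int.ofNat_le.2 hcq2) γ (γ - k) hγ
        ((Nat.sub_le _ _).trans hγ) hcr hkq
      rwa [show γ - k = γ by omega]

/-- In a saturated family, the second child is the last one. -/
theorem Saturated.hi_eq [Finite κ] (h : L.Saturated)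
    (hst : ∀ i j, (Q i).SingleTouch (Q j)) {q r l : κ} (hr : (L.system hst).IsChild r q)
    (hl : (L.system hst).IsChild l q) (hlo : L.lo r = L.lo q) (hrl : L.hi r = L.lo l) :
    L.hi l = L.hi q := by
  classical
  by_contra hne
  have hr0 := L.lo_lt_hi r
  have hl0 := L.lo_lt_hi l
  have hlt : L.hi l < L.hi q := by
    have := Int.ofNat_le.1 hl.2.1.2
    omega
  have hex : ∃ i, i ≤ (L.region r).path.len ∧
      (L.region r).path.vert i ∈ (L.region l).path.verts := by
    refine ⟨_, le_rfl, ?_⟩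
    have h1 := (L.region r).hi_fst'
    have h2 := (L.region l).lo_fst'
    rw [L.region_hi] at h1
    rw [L.region_lo] at h2
    rw [← h1, hrl, h2]
    exact GPath.vert_mem _ _
  -- The candidate follows `r` to its first vertex on `l` and then `l` to its end, grouping the
  -- first two children; it is compatible because `r` avoids every third child and `l` avoids `q`.
  obtain ⟨n, hn, hnl, hmin⟩ : ∃ n ≤ (L.region r).path.len,
      (L.region r).path.vert n ∈ (L.region l).path.verts ∧
      ∀ i < n, (L.region r).path.vert i ∉ (L.region l).path.verts :=
    ⟨Nat.find hex, (Nat.find_spec hex).1, (Nat.find_spec hex).2, fun i hi hil =>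
      Nat.find_min hex hi ⟨hi.le.trans (Nat.find_spec hex).1, hil⟩⟩
  obtain ⟨β, hβ, hβn⟩ := GPath.mem_verts.1 hnl
  obtain ⟨x, hxlen, hx⟩ := GPath.exists_of_fun (G := M.G)
    (fun i => if i ≤ n then (L.region r).path.vert i else (L.region l).path.vert (β + (i - n)))
    (n + ((L.region l).path.len - β)) (fun i hi => by
      by_cases h1 : i + 1 ≤ n
      · rw [if_pos (by omega), if_pos h1]
        exact (L.region r).path.adj (by omega)
      · rw [if_neg h1]
        by_cases h2 : i ≤ n
        · obtain rfl : i = n := by omega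
          rw [if_pos le_rfl, ← hβn, show β + (i + 1 - i) = β + 1 by omega]
          exact (L.region l).path.adj (by omega)
        · rw [if_neg h2, show β + (i + 1 - n) = β + (i - n) + 1 by omega]
          exact (L.region l).path.adj (by omega))
    (fun i hi j hj hij => by
      by_cases h1 : i ≤ n <;> by_cases h2 : j ≤ n
      · rw [if_pos h1, if_pos h2] at hij
        exact (L.region r).path.vert_inj (by omega) (by omega) hij
      · rw [if_pos h1, if_neg h2] at hij
        rcases h1.eq_or_lt with rfl | h3
        · rw [← hβn] at hij
          have := (L.region l).path.vert_inj hβ (by omega) hij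
          omega
        · exact absurd (hij ▸ GPath.vert_mem _ _) (hmin i h3)
      · rw [if_neg h1, if_pos h2] at hij
        rcases h2.eq_or_lt with rfl | h3
        · rw [← hβn] at hij
          have := (L.region l).path.vert_inj (by omega) hβ hij
          omega
        · exact absurd (hij ▸ GPath.vert_mem _ _) (hmin j h3)
      · rw [if_neg h1, if_neg h2] at hij
        have := (L.region l).path.vert_inj (by omega) (by omega) hij
        omega)
  have hx1 : ∀ i ≤ n, x.vert i = (L.region r).path.vert i := fun i hi => by
    rw [hx i (by omega), if_pos hi]
  have hx2 : ∀ k ≤ x.len - n, x.vert (n + k) = (L.region l).path.vert (β + k) := fun k hk => by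
    rw [hx _ (by omega)]
    by_cases hk0 : k = 0
    · subst hk0
      rw [if_pos (by omega)]
      exact hβn.symm
    · rw [if_neg (by omega), show n + k - n = k by omega]
  have hxx : (M.corner L.base (L.lo r)).fst = x.x := by
    rw [← x.vert_zero, hx1 0 (Nat.zero_le _), ← (L.region r).lo_fst', L.region_lo]
  have hxy : (M.corner L.base (L.hi l)).fst = x.y := by
    rw [← x.vert_len, show x.len = n + (x.len - n) by omega, hx2 _ le_rfl,
      show β + (x.len - n) = (L.region l).path.len by omega, ← (L.region l).hi_fst', L.region_hi]
  have hq := L.hi_lt q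
  refine h.false_of_region hst (q := q) (c₀ := r) (R := ⟨x, L.lo r, L.hi l, L.base_outer, by omega,
    by omega, by omega, hxx, hxy⟩) (by change L.lo r < L.hi l; omega) hlo.ge hlt.le
    (by change ¬ (L.lo r = L.lo q ∧ L.hi l = L.hi q); omega) (fun d hd => ?_) hr le_rfl
    (by change L.hi r ≤ L.hi l; omega)
    (by change ¬ (L.lo r = L.lo r ∧ L.hi l = L.hi r); omega) fun w => ?_
  · change (L.lo r ≤ L.lo d ∧ L.hi d ≤ L.hi l) ∨ L.hi l ≤ L.lo d ∨ L.hi d ≤ L.lo r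
    have h1 := Int.ofNat_le.1 hd.2.1.1
    by_cases hdl : d = l
    · subst hdl; omega
    · have hd' := hd.disjoint hl hdl
      rw [system_lo, system_lo, system_hi, system_hi] at hd'
      omega
  · refine GPath.Contig.join (n := n) (β := β) hn (by change n ≤ x.len; omega)
      (by change _ + (x.len - _) ≤ _; omega) hx1 hx2 (L.region_contig hst r l)
      (L.region_contig hst r w) (L.region_contig hst l w) ?_
    by_cases hw : (L.system hst).Le w q ∧ w ≠ q
    · obtain ⟨d, hd, hwd⟩ := PathSystem.exists_child_ge hw.1 hw.2
      have hdq := Int.ofNat_le.1 hd.2.1.1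
      have hd0 := L.lo_lt_hi d
      by_cases hdr : d = r
      · subst hdr
        refine Or.inl fun k hk hkw => ?_
        refine PathSystem.sep hwd (r := l) (fun h' => ?_) hkw (GPath.vert_mem _ _)
        have := Int.ofNat_le.1 h'.2
        omega
      by_cases hdl : d = l
      · subst hdl
        refine Or.inr fun i hi hiw => ?_
        refine PathSystem.sep hwd (r := r) (fun h' => ?_) hiw (GPath.vert_mem _ _)
        have := Int.ofNat_le.1 h'.1
        omega
      have hd3 := hd.disjoint hr hdr
      have hd4 := hd.disjoint hl hdl
      rw [system_lo, system_lo, system_hi, system_hi] at hd3 hd4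
      refine Or.inr fun i hi hiw => ?_
      refine absurd (PathSystem.sep hwd (r := r) (fun h' => ?_) hiw (GPath.vert_mem _ _))
        (h.not_meets_child hst hr hlo hrl hd (by omega) (GPath.vert_mem _ _))
      have := Int.ofNat_le.1 h'.1
      omega
    · refine Or.inl fun k _ hkw => ?_
      refine absurd ?_ (h.not_meets_parent hst hr hl hlo hrl hlt
        (GPath.vert_mem (L.region l).path (β + k)))
      by_cases hwq : w = q
      · rwa [← hwq]
      · exact PathSystem.sep (S := L.system hst) hl.2.1 (fun h' => hw ⟨h', hwq⟩)
          (GPath.vert_mem _ _) hkw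

/-- In a saturated family, every path has no or exactly two children. -/
theorem Saturated.kids [Finite κ] (h : L.Saturated) (hst : ∀ i j, (Q i).SingleTouch (Q j))
    (q : κ) : (∀ i, (L.system hst).Le i q → i = q) ∨ ∃ r l, (L.system hst).Kids q r l := by
  by_cases hq : L.lo q + 1 < L.hi q
  · right
    obtain ⟨r, l, hr, hl, hlo, hrl⟩ := h.exists_children hst hq
    have hhi := h.hi_eq hst hr hl hlo hrl
    refine ⟨r, l, Int.ofNat_le.2 hrl.le, fun c => ⟨fun hc => ?_, ?_⟩⟩
    · by_contra hne
      push Not at hne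
      have h1 := hc.disjoint hr hne.1
      have h2 := hc.disjoint hl hne.2
      rw [system_lo, system_lo, system_hi, system_hi] at h1 h2
      have h3 := Int.ofNat_le.1 hc.2.1.1
      have h4 := Int.ofNat_le.1 hc.2.1.2
      have h5 := L.lo_lt_hi c
      omega
    · rintro (rfl | rfl) <;> assumption
  · left
    intro i hi
    have h1 := Int.ofNat_le.1 hi.1
    have h2 := Int.ofNat_le.1 hi.2
    have h3 := L.lo_lt_hi i
    exact L.arcs_distinct i q (by omega) (by omega)

/-- A saturated family is a binary family. -/
theorem Saturated.exists_binaryFamily [Finite κ] (h : L.Saturated)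
    (hst : ∀ i j, (Q i).SingleTouch (Q j)) : ∃ B : BinaryFamily M κ, B.path = Q := by
  obtain ⟨root, h1, h2⟩ := h.exists_root hst
  have hle : ∀ i j, (L.system hst).Le i j ↔ L.lo j ≤ L.lo i ∧ L.hi i ≤ L.hi j := fun i j =>
    and_congr Int.ofNat_le Int.ofNat_le
  refine ⟨⟨Q, L, hst, fun i j _ => L.nonCrossing_of_singleTouch hst i j, root, fun i => ?_,
    fun q => ?_⟩, rfl⟩
  · have := L.hi_lt i
    omega
  · rcases h.kids hst q with h3 | ⟨r, l, h3, h4⟩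
    · exact Or.inl fun i hi hi' => h3 i ((hle _ _).2 ⟨hi, hi'⟩)
    · refine Or.inr ⟨r, l, Int.ofNat_le.1 h3, fun c => ?_⟩
      rw [← h4]
      simp only [PathSystem.IsChild, hle, and_imp, and_assoc]

end Layout

end PlaneGraph

/-! ### Maximal completions. -/

namespace PlaneGraph

variable {V : Type*} [Finite V] {M : PlaneGraph V}

namespace Layout

variable {κ κ' : Type*} {Q : κ → GPath M.G}

/-- The terminal positions of a subfamily. -/
def comap (L : M.Layout Q) (f : κ' → κ) (hf : Function.Injective f) :
    M.Layout fun i => Q (f i) where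
  base := L.base
  base_outer := L.base_outer
  lo i := L.lo (f i)
  hi i := L.hi (f i)
  lo_lt_hi i := L.lo_lt_hi (f i)
  hi_lt i := L.hi_lt (f i)
  ends i := L.ends (f i)
  arcs_distinct _ _ h1 h2 := hf (L.arcs_distinct _ _ h1 h2)
  wellFormed i j := L.wellFormed (f i) (f j)

/-- The terminal positions of a family with an additional path. -/
def insert (L : M.Layout Q) (R : Region M L.base) (hR : L.Compatible R)
    (hnew : ∀ i, ¬ (L.lo i = R.lo ∧ L.hi i = R.hi)) :
    M.Layout fun o : Option κ => o.elim R.path Q where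
  base := L.base
  base_outer := L.base_outer
  lo o := o.elim R.lo L.lo
  hi o := o.elim R.hi L.hi
  lo_lt_hi
    | none => hR.lo_lt_hi
    | some i => L.lo_lt_hi i
  hi_lt
    | none => R.hi_lt
    | some i => L.hi_lt i
  ends
    | none => congrArg₂ (fun u v => s(u, v)) R.lo_fst R.hi_fst
    | some i => L.ends i
  arcs_distinct
    | none, none => fun _ _ => rfl
    | none, some j => fun h1 h2 => absurd ⟨h1.symm, h2.symm⟩ (hnew j)
    | some i, none => fun h1 h2 => absurd ⟨h1, h2⟩ (hnew i)
    | some i, some j => fun h1 h2 => congrArg some (L.arcs_distinct i j h1 h2)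
  wellFormed
    | none, none => Or.inl ⟨le_rfl, le_rfl⟩
    | none, some j => hR.wellFormed j
    | some i, none => by
      have := hR.wellFormed i
      change (R.lo ≤ L.lo i ∧ L.hi i ≤ R.hi) ∨ (L.lo i ≤ R.lo ∧ R.hi ≤ L.hi i) ∨
        L.hi i ≤ R.lo ∨ R.hi ≤ L.lo i
      tauto
    | some i, some j => L.wellFormed i j

theorem Compatible.singleTouch {L : M.Layout Q} {R : Region M L.base} (hR : L.Compatible R)
    (hst : ∀ i j, (Q i).SingleTouch (Q j)) (o o' : Option κ) :
    GPath.SingleTouch (o.elim R.path Q) (o'.elim R.path Q) := by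
  have hc : ∀ j, GPath.Contig R.path (Q j) := by
    intro j
    have h := hR.contig j
    rcases L.region_path j with h1 | h1
    · rwa [h1] at h
    · have h2 := h.rev_right
      rw [h1] at h2
      simpa [GPath.rev] using h2
  cases o with
  | none =>
    cases o' with
    | none => exact (GPath.Contig.refl _).singleTouch
    | some j => exact (hc j).singleTouch
  | some i =>
    cases o' with
    | none => exact (hc i).symm.singleTouch
    | some j => exact hst i j

/-- Distinct arcs are distinct pairs of corners. This bounds the number of auxiliary paths, so a
maximal completion exists. -/
theorem card_le [Finite κ] (L : M.Layout Q) : Nat.card κ ≤ M.outerLength * M.outerLength := by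
  have hinj : Function.Injective fun i : κ =>
      ((⟨L.lo i, (L.lo_lt_hi i).trans (L.hi_lt i)⟩, ⟨L.hi i, L.hi_lt i⟩) :
        Fin M.outerLength × Fin M.outerLength) := by
    intro i j hij
    simp only [Prod.mk.injEq, Fin.mk.injEq] at hij
    exact L.arcs_distinct i j hij.1 hij.2
  have := Nat.card_le_card_of_injective _ hinj
  simpa [Nat.card_eq_fintype_card] using this

end Layout

/-- Every single-touch family with terminal positions can be completed to a binary family. -/
theorem exists_completion {ι : Type*} [Finite ι] {P : ι → GPath M.G} (L : M.Layout P)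
    (hst : ∀ i j, (P i).SingleTouch (P j)) :
    ∃ (k : ℕ) (B : BinaryFamily M (ι ⊕ Fin k)), ∀ i, B.path (Sum.inl i) = P i := by
  classical
  let Ext : ℕ → Prop := fun k => ∃ (Q : ι ⊕ Fin k → GPath M.G) (_ : M.Layout Q),
    (∀ i, Q (Sum.inl i) = P i) ∧ ∀ i j, (Q i).SingleTouch (Q j)
  have h0 : Ext 0 := by
    refine ⟨fun s => P ((Equiv.sumEmpty ι (Fin 0)) s), L.comap _ (Equiv.injective _), fun i => ?_,
      fun i j => hst _ _⟩
    simp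
  have hbound : ∀ k, Ext k → k ≤ M.outerLength * M.outerLength := by
    rintro k ⟨Q, L', -, -⟩
    have := L'.card_le
    rw [Nat.card_sum, Nat.card_eq_fintype_card (α := Fin k), Fintype.card_fin] at this
    omega
  -- A completion with the largest number of auxiliary paths is saturated, since a compatible new
  -- arc would allow one more.
  obtain ⟨Q, L', hQ, hst'⟩ := Nat.findGreatest_spec (P := Ext) (Nat.zero_le _) h0
  set k := Nat.findGreatest Ext (M.outerLength * M.outerLength) with hk
  have hsat : L'.Saturated := by
    intro R hR
    by_contra hnew
    push Not at hnew
    -- Reindexing: the last index of `Fin (k + 1)` stands for the added path.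
    let g : ι ⊕ Fin (k + 1) → Option (ι ⊕ Fin k) := fun s => match s with
      | .inl i => some (.inl i)
      | .inr j => if h : j.val < k then some (.inr ⟨j, h⟩) else none
    have hg : Function.Injective g := by
      rintro (i | i) (j | j) hij
      · simpa [g] using hij
      · by_cases h : j.val < k <;> simp [g, h] at hij
      · by_cases h : i.val < k <;> simp [g, h] at hij
      · by_cases h1 : i.val < k <;> by_cases h2 : j.val < k <;> simp [g, h1, h2] at hij
        · rw [Sum.inr.injEq]; exact Fin.ext hij
        · rw [Sum.inr.injEq]; exact Fin.ext (by omega)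
    have hext : Ext (k + 1) := ⟨_, (L'.insert R hR fun i h => hnew i h.1 h.2).comap g hg, hQ,
      fun i j => hR.singleTouch hst' _ _⟩
    have := Nat.le_findGreatest (hbound _ hext) hext
    omega
  obtain ⟨B, hB⟩ := hsat.exists_binaryFamily hst'
  exact ⟨k, B, fun i => by rw [hB, hQ]⟩

end PlaneGraph

theorem mainTheorem1 {V : Type*} [Finite V] (M : PlaneGraph V)
    (len : Sym2 V → ℝ) (hlen : ∀ e ∈ M.G.edgeSet, 0 ≤ len e)
    {ι : Type*} [Finite ι] (P : ι → GPath M.G) (hP : M.IsNCS len P) :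
    (∃ L : ι → Fin 4, FourForests M P L) ∧
    (∀ L : ι → Fin 4, FourForests M P L → IsForestLabeling P L) ∧
    PCFN P ≤ 4 := by
  obtain ⟨L⟩ := hP.wellFormed
  obtain ⟨k, B, hB⟩ := PlaneGraph.exists_completion L hP.singleTouch
  obtain ⟨σ, hσ⟩ := B.exists_run
  have hrun : FourForests M P fun i => σ.label (Sum.inl i) := ⟨k, B, σ, hB, hσ, fun _ => rfl⟩
  exact ⟨⟨_, hrun⟩, fun _ h => h.isForestLabeling, by exact_mod_cast hrun.isForestLabeling.pcfn_le⟩
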